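/- Let $G$ be a non-discrete locally compact (Hausdorff) group with a left Haar measure $dx$. Let $\omega:G\to[1,\infty)$ be a weight, i.e. a measurable function with $\omega(e)=1$, $\omega(x^{-1})=\omega(x)$ and $\omega(xy)\le\omega(x)\omega(y)$ for all $x,y\in G$. Let $1\le p<\infty$ and $1/p+1/q=1$. Suppose that there exist a bounded measurable function $u:G\to[0,\infty)$ and real numbers $s<q$ and $r>0$ such that $\omega u$ is bounded away from zero, $$\frac{\omega(xy)}{\omega(x)\omega(y)}\le u(x)+u(y)\quad(x,y\in G),\qquad \int_G u(x)^s\,\omega(x)^r\,dx<\infty .$$ Let $\mathcal A=\{f\in L^2(G): f\omega\in L^p(G)\}$ with the norm $\|f\|_{\mathcal A}=\max\{\|f\omega\|_p,\|f\|_2\}$, and let $\widetilde{\mathcal A}=\mathcal A\times\mathbb C$ be its unitization, with product $(f,t)(g,s)=(f*g+sf+tg,\,ts)$ and norm $\|(f,t)\|_{\widetilde{\mathcal A}}=\|f\|_{\mathcal A}+|t|$, where $(f*g)(x)=\int_G f(y)\,g(y^{-1}x)\,dy$. Then all convolutions involved converge absolutely almost everywhere, $\widetilde{\mathcal A}$ is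 closed under this product, the product is continuous ($\|ab\|_{\widetilde{\mathcal A}}\le K\|a\|_{\widetilde{\mathcal A}}\|b\|_{\widetilde{\mathcal A}}$ for some constant $K$), and $$\Phi(f,t)\,g=f*g+tg,\qquad g\in L^2(G),$$ defines a continuous injective unital algebra homomorphism $\Phi:\widetilde{\mathcal A}\to B(L^2(G))$. Viewed through $\Phi$ as a subalgebra of $B(L^2(G))$: 1. $\widetilde{\mathcal A}$ is inverse-closed in $B(L^2(G))$: if $a\in\widetilde{\mathcal A}$ and $\Phi(a)$ is invertible in $B(L^2(G))$, then $\Phi(a)^{-1}=\Phi(b)$ for some $b\in\widetilde{\mathcal A}$ (then $b=a^{-1}$); 2. $\widetilde{\mathcal A}$ admits norm-controlled inversion in $B(L^2(G))$: there is a function $h$ of two real variables such that $\|a^{-1}\|_{\widetilde{\mathcal A}}\le h\bigl(\|a\|_{\widetilde{\mathcal A}},\|\Phi(a)^{-1}\|_{B(L^2(G))}\bigr)$ for every invertible $a\in\widetilde{\mathcal A}$. -/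

import Mathlib

open MeasureTheory
open scoped ENNReal

/-- A weight on a group: a measurable function `G → [0, ∞)` with value `1` at the identity,
symmetric and submultiplicative. -/
structure IsGroupWeight {G : Type*} [Group G] [MeasurableSpace G] (ω : G → ℝ) : Prop where
  measurable : Measurable ω
  nonneg : ∀ x, 0 ≤ ω x
  map_one : ω 1 = 1
  map_inv : ∀ x, ω x⁻¹ = ω x
  map_mul_le : ∀ x y, ω (x * y) ≤ ω x * ω y

/-- The convolution integral `(f ∗ g)(x) = ∫ f(y) g(y⁻¹ x) dy` converges absolutely at `x`. -/
def GroupConvExistsAt {G : Type*} [Group G] [MeasurableSpace G] (μ : Measure G)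
    (f g : G → ℂ) (x : G) : Prop :=
  Integrable (fun y => f y * g (y⁻¹ * x)) μ

/-- The convolution `(f ∗ g)(x) = ∫ f(y) g(y⁻¹ x) dy` with respect to `μ`. -/
noncomputable def groupConv {G : Type*} [Group G] [MeasurableSpace G] (μ : Measure G)
    (f g : G → ℂ) (x : G) : ℂ :=
  ∫ y, f y * g (y⁻¹ * x) ∂μ

/-- The space `L^p(G, ω) ∩ L²(G)`, as a subspace of `L²(G)`: the `f ∈ L²(G)` for which
`ω f ∈ L^p(G)`. -/
noncomputable def weightedInter {G : Type*} [MeasurableSpace G] (μ : Measure G)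
    (p : ℝ≥0∞) (ω : G → ℝ) : Submodule ℂ (Lp ℂ 2 μ) where
  carrier := {f | MemLp (fun x => (ω x : ℂ) * f x) p μ}
  zero_mem' := by
    refine (memLp_congr_ae ?_).2 (MemLp.zero (p := p) (μ := μ) (ε := ℂ))
    filter_upwards [Lp.coeFn_zero ℂ 2 μ] with x hx
    rw [hx, Pi.zero_apply, mul_zero]
  add_mem' := by
    intro f g hf hg
    refine (memLp_congr_ae ?_).2 (MemLp.add hf hg)
    filter_upwards [Lp.coeFn_add f g] with x hx
    rw [hx, Pi.add_apply, Pi.add_apply, mul_add]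
  smul_mem' := by
    intro c f hf
    refine (memLp_congr_ae ?_).2 (MemLp.const_smul hf c)
    filter_upwards [Lp.coeFn_smul c f] with x hx
    rw [hx, Pi.smul_apply, Pi.smul_apply, smul_eq_mul, smul_eq_mul, mul_left_comm]

/-- The norm `max (‖f ω‖_p) (‖f‖_2)` on `L^p(G, ω) ∩ L²(G)`. -/
noncomputable def weightedInterNorm {G : Type*} [MeasurableSpace G] {μ : Measure G}
    {p : ℝ≥0∞} {ω : G → ℝ} (f : weightedInter μ p ω) : ℝ :=
  max (eLpNorm (fun x => (ω x : ℂ) * (f : Lp ℂ 2 μ) x) p μ).toReal ‖(f : Lp ℂ 2 μ)‖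

/-- The underlying vector space `𝒜 × ℂ` of the unitization of `𝒜 = L^p(G, ω) ∩ L²(G)`. -/
abbrev WeightedUnitization {G : Type*} [MeasurableSpace G] (μ : Measure G)
    (p : ℝ≥0∞) (ω : G → ℝ) : Type _ :=
  weightedInter μ p ω × ℂ

/-- The unitization norm `‖(f, t)‖ = ‖f‖_𝒜 + |t|`. (The norm which Mathlib puts on a product
type is not used.) -/
noncomputable def weightedUnitizationNorm {G : Type*} [MeasurableSpace G] {μ : Measure G}
    {p : ℝ≥0∞} {ω : G → ℝ} (a : WeightedUnitization μ p ω) : ℝ :=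
  weightedInterNorm a.1 + ‖a.2‖

/-- `c` is the product `(f, t)(g, s) = (f ∗ g + s f + t g, t s)` of `a = (f, t)` and `b = (g, s)`
in the unitization, the convolution integral being absolutely convergent almost everywhere.
For given `a` and `b` there is at most one such `c`. -/
def IsUnitizationProduct {G : Type*} [Group G] [MeasurableSpace G] {μ : Measure G}
    {p : ℝ≥0∞} {ω : G → ℝ} (a b c : WeightedUnitization μ p ω) : Prop :=
  (∀ᵐ x ∂μ, GroupConvExistsAt μ (a.1 : Lp ℂ 2 μ) (b.1 : Lp ℂ 2 μ) x ∧
    (c.1 : Lp ℂ 2 μ) x = groupConv μ (a.1 : Lp ℂ 2 μ) (b.1 : Lp ℂ 2 μ) x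
      + b.2 * (a.1 : Lp ℂ 2 μ) x + a.2 * (b.1 : Lp ℂ 2 μ) x) ∧
  c.2 = a.2 * b.2

/-- The bounded operator `T` on `L²(G)` is the action `g ↦ f ∗ g + t g` of `a = (f, t)`. -/
def IsUnitizationAction {G : Type*} [Group G] [MeasurableSpace G] {μ : Measure G}
    {p : ℝ≥0∞} {ω : G → ℝ} (a : WeightedUnitization μ p ω)
    (T : Lp ℂ 2 μ →L[ℂ] Lp ℂ 2 μ) : Prop :=
  ∀ g : Lp ℂ 2 μ, ∀ᵐ x ∂μ, GroupConvExistsAt μ (a.1 : Lp ℂ 2 μ) g x ∧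
    T g x = groupConv μ (a.1 : Lp ℂ 2 μ) g x + a.2 * g x

/-- Inverse-closedness of the image of an embedding `Φ : E → B`: whenever `Φ a` is invertible
in `B`, its inverse again comes from `E`. -/
def InverseClosedVia {E B : Type*} [Ring B] (Φ : E → B) : Prop :=
  ∀ (a : E) (T : B), Φ a * T = 1 → T * Φ a = 1 → ∃ b : E, Φ b = T

/-- Norm-controlled inversion in `B` for `E` with norm `N`, embedded through `Φ`: there is one
function `h` with `‖a⁻¹‖_E ≤ h (‖a‖_E) (‖a⁻¹‖_B)` for all `a` that are invertible. -/
def NormControlledInversionVia {E B : Type*} [NormedRing B] (N : E → ℝ) (Φ : E → B) : Prop :=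
  ∃ h : ℝ → ℝ → ℝ, ∀ a b : E, Φ a * Φ b = 1 → Φ b * Φ a = 1 → N b ≤ h (N a) ‖Φ b‖

open Filter Topology

/-! The core is a differential norm inequality. If ω(xy) ≤ ω(x)ω(y)(h(x)+h(y)), Young's inequality
bounds ‖(f∗g)ω‖_p by ‖fωh‖₁‖gω‖_p + ‖fω‖_p‖gωh‖₁. If moreover hω^θ lies in a suitable Lebesgue
space, Hölder with three factors bounds ‖fωh‖₁ by a constant times ‖fω‖_p^(1-θ) ‖f‖₂^θ
(`IsInterpolationWeight.lintegral_le`). So squaring an element raises its weighted norm only to the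
power 2-θ < 2, the rest being paid by the L² norm.

The L² norm is governed by the operator norm: if ‖Φ(a)‖ ≤ ρ < 1, the L² part of a^(2^k) is O(2^k
ρ^(2^k)). Since (2-θ)^k is negligible against 2^k, high dyadic powers of a strict contraction are
small in the unitization norm, uniformly on balls (`exists_dyadic_small`, `exists_pow_small`).
Non-discreteness enters here: it gives |t| ≤ ‖Φ(f,t)‖, which controls the scalar parts and makes Φ
injective.

Inversion follows from a⁻¹ = (a∗a)⁻¹a∗, with a∗ the adjoint. For large β the element c = 1 - β⁻¹a∗a
acts as a strict contraction, so a high dyadic power of c is small in the unitization norm and the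
Neumann series for c, grouped by that power, converges there. All constants depend only on bounds
for ‖a‖ and ‖Φ(a)⁻¹‖, so inverse-closedness and norm control come together (`exists_ball_inverse`).

Two points need separate arguments. The involution and Young's inequality on both sides require
unimodularity, which is deduced from the weight (`one_le_modularCharacterFun_of_weight`): were the
modular function to take values below 1, a random walk on such elements would spread exponentially
fast, would mostly avoid the sets where u is not small, and log ω would drop below zero on average.
Secondly, for p > 1 one can take h = u with θ small, but for p = 1 the function u need not have
enough decay, and it is replaced by a local average (`exists_isInterpolationWeight_one`). -/

set_option linter.unusedSectionVars false

/-! ### Joint measurability of the group operations without second countability -/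

section Measurability

theorem AEMeasurable.comp_mul_left_const {G : Type*} [Group G] [MeasurableSpace G] [MeasurableMul G]
    {μ : Measure G} [μ.IsMulLeftInvariant] {f : G → ℝ≥0∞} (hf : AEMeasurable f μ) (y : G) :
    AEMeasurable (fun z => f (y * z)) μ :=
  hf.comp_quasiMeasurePreserving (measurePreserving_mul_left μ y).quasiMeasurePreserving

variable {G : Type*} [Group G] [TopologicalSpace G] [IsTopologicalGroup G]
    [LocallyCompactSpace G] [MeasurableSpace G] [BorelSpace G]
    {μ : Measure G} [μ.IsHaarMeasure] [μ.Regular] [SigmaFinite μ]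

/-- Up to a null set, a Borel set is a countable union of level sets of continuous compactly
supported functions. -/
theorem exists_levelSets_ae_cover {S : Set G} (hS : MeasurableSet S) :
    ∃ f : ℕ → G → ℝ, (∀ n, Continuous (f n)) ∧ (∀ n, HasCompactSupport (f n)) ∧
      (∀ n, f n ⁻¹' {1} ⊆ S) ∧ μ (S \ ⋃ n, f n ⁻¹' {1}) = 0 := by
  have key : ∀ T : Set G, MeasurableSet T → μ T ≠ ∞ → ∀ n : ℕ, ∃ f : G → ℝ, Continuous f ∧
      HasCompactSupport f ∧ f ⁻¹' {1} ⊆ T ∧ μ (T \ f ⁻¹' {1}) ≤ ((n : ℝ≥0∞) + 1)⁻¹ := by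
    intro T hT hTf n
    by_cases h0 : μ T = 0
    · refine ⟨fun _ => 0, continuous_const, HasCompactSupport.zero, ?_, ?_⟩
      · intro x hx; simp at hx
      · exact (measure_mono_null Set.sdiff_subset h0).le.trans zero_le
    have hε : ((n : ℝ≥0∞) + 1)⁻¹ ≠ 0 := by simp
    -- Inner regularity by level sets of compactly supported continuous functions: these remain
    -- measurable for the product σ-algebra after composition with the group operations, unlike
    -- general Borel sets.
    obtain ⟨K, hK, ⟨f, hf, hfc, rfl⟩, hr⟩ :=
      Measure.innerRegularWRT_preimage_one_hasCompactSupport_measure_ne_top_of_group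
        (μ := μ) ⟨hT, hTf⟩ _ (ENNReal.sub_lt_self hTf h0 hε)
    refine ⟨f, hf, hfc, hK, ?_⟩
    have hm : MeasurableSet (f ⁻¹' {1}) := hf.measurable (measurableSet_singleton _)
    rw [measure_sdiff hK hm.nullMeasurableSet (ne_top_of_le_ne_top hTf (measure_mono hK))]
    refine tsub_le_iff_left.2 ?_
    exact tsub_le_iff_right.1 hr.le
  choose! F hFc hFs hFS hFm using key
  let T : ℕ → Set G := fun i => S ∩ spanningSets μ i
  have hT : ∀ i, MeasurableSet (T i) := fun i => hS.inter (measurableSet_spanningSets μ i)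
  have hTf : ∀ i, μ (T i) ≠ ∞ := fun i =>
    ((measure_mono Set.inter_subset_right).trans_lt (measure_spanningSets_lt_top μ i)).ne
  refine ⟨fun k => F (T k.unpair.1) k.unpair.2, fun k => hFc _ (hT _) (hTf _) _,
    fun k => hFs _ (hT _) (hTf _) _,
    fun k => (hFS _ (hT _) (hTf _) _).trans Set.inter_subset_left, ?_⟩
  have hsub : S \ ⋃ k : ℕ, F (T k.unpair.1) k.unpair.2 ⁻¹' {1} ⊆
      ⋃ i, (T i \ ⋃ n, F (T i) n ⁻¹' {1}) := by
    rintro x ⟨hxS, hx⟩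
    have hxs : x ∈ ⋃ i, spanningSets μ i := by rw [iUnion_spanningSets]; trivial
    obtain ⟨i, hi⟩ := Set.mem_iUnion.1 hxs
    refine Set.mem_iUnion.2 ⟨i, ⟨hxS, hi⟩, fun h => hx ?_⟩
    obtain ⟨n, hn⟩ := Set.mem_iUnion.1 h
    refine Set.mem_iUnion.2 ⟨Nat.pair i n, ?_⟩
    simpa using hn
  refine measure_mono_null hsub (measure_iUnion_null fun i => ?_)
  refine le_antisymm (ge_of_tendsto' (x := atTop) (f := fun n : ℕ => ((n : ℝ≥0∞) + 1)⁻¹) ?_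
    fun n => ?_) zero_le
  · have := ENNReal.tendsto_inv_nat_nhds_zero.comp (tendsto_add_atTop_nat 1)
    simpa [Function.comp_def] using this
  · refine (measure_mono ?_).trans (hFm (T i) (hT i) (hTf i) n)
    exact Set.sdiff_subset_sdiff_right (Set.subset_iUnion (fun n => F (T i) n ⁻¹' {1}) n)

/-- The Borel σ-algebra of `G × G` can exceed the product σ-algebra, so continuity alone does not
suffice. Continuous functions of compact support on a product are measurable for the product
σ-algebra, and cut-offs reduce to them on countably many rectangles of full measure. -/
theorem aestronglyMeasurable_comp_mul_of_continuous {σ : G → G} (hσ : Continuous σ)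
    {h : G → ℝ} (hc : Continuous h) :
    AEStronglyMeasurable (fun z : G × G => h (σ z.1 * z.2)) (μ.prod μ) := by
  obtain ⟨f, hfc, hfs, -, hf0⟩ := exists_levelSets_ae_cover (μ := μ) MeasurableSet.univ
  let K : ℕ → Set G := fun n => f n ⁻¹' {1}
  have hK : ∀ n, MeasurableSet (K n) := fun n => (hfc n).measurable (measurableSet_singleton _)
  have hfull : μ.prod μ = (μ.prod μ).restrict (⋃ ij : ℕ × ℕ, K ij.1 ×ˢ K ij.2) := by
    have h1 : (⋃ n, K n) =ᵐ[μ] Set.univ := by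
      refine eventuallyEq_univ.2 ?_
      rw [mem_ae_iff, Set.compl_eq_univ_sdiff]
      exact hf0
    have h2 : (⋃ ij : ℕ × ℕ, K ij.1 ×ˢ K ij.2) = (⋃ n, K n) ×ˢ (⋃ n, K n) := by
      ext ⟨x, y⟩
      simp
    rw [h2, ← Measure.prod_restrict, Measure.restrict_congr_set h1, Measure.restrict_univ]
  rw [hfull, aestronglyMeasurable_iUnion_iff]
  rintro ⟨i, j⟩
  have hcs : HasCompactSupport (fun z : G × G => f i z.1 * f j z.2 * h (σ z.1 * z.2)) := by
    refine HasCompactSupport.intro ((hfs i).isCompact.prod (hfs j).isCompact) ?_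
    rintro ⟨x, y⟩ hxy
    by_cases hx : x ∈ tsupport (f i)
    · have hy : y ∉ tsupport (f j) := fun hy => hxy ⟨hx, hy⟩
      simp [image_eq_zero_of_notMem_tsupport hy]
    · simp [image_eq_zero_of_notMem_tsupport hx]
  have hcont : Continuous (fun z : G × G => f i z.1 * f j z.2 * h (σ z.1 * z.2)) := by
    have := hfc i
    have := hfc j
    fun_prop
  refine (hcs.stronglyMeasurable_of_prod hcont).aestronglyMeasurable.congr ?_
  refine (ae_restrict_iff' ((hK i).prod (hK j))).2 (Eventually.of_forall ?_)
  rintro ⟨x, y⟩ ⟨hx, hy⟩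
  have hx' : f i x = 1 := hx
  have hy' : f j y = 1 := hy
  simp [hx', hy']

/-- Every section of the preimage is a left translate of a null set. To apply Tonelli, `N` is first
enlarged to a null set `B` whose complement is a union of level sets, so that its preimage is null
measurable. -/
theorem measure_preimage_mul_of_null {σ : G → G} (hσ : Continuous σ)
    {N : Set G} (hN : MeasurableSet N)
    (h0 : μ N = 0) : (μ.prod μ) ((fun z : G × G => σ z.1 * z.2) ⁻¹' N) = 0 := by
  obtain ⟨f, hfc, hfs, hfS, hf0⟩ := exists_levelSets_ae_cover (μ := μ) hN.compl
  set B : Set G := (⋃ n, f n ⁻¹' {1})ᶜ with hB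
  have hBm : MeasurableSet B :=
    (MeasurableSet.iUnion fun n => (hfc n).measurable (measurableSet_singleton _)).compl
  have hNB : N ⊆ B := by
    intro x hx
    rw [hB, Set.mem_compl_iff, Set.mem_iUnion]
    rintro ⟨n, hn⟩
    exact hfS n hn hx
  have hB0 : μ B = 0 := by
    refine measure_mono_null (t := N ∪ (Nᶜ \ ⋃ n, f n ⁻¹' {1})) ?_ (measure_union_null h0 hf0)
    intro x hx
    by_cases hxN : x ∈ N
    · exact Or.inl hxN
    · exact Or.inr ⟨hxN, hx⟩
  have hnull : NullMeasurableSet ((fun z : G × G => σ z.1 * z.2) ⁻¹' B) (μ.prod μ) := by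
    rw [hB, Set.preimage_compl, Set.preimage_iUnion]
    refine (NullMeasurableSet.iUnion fun n => ?_).compl
    exact (aestronglyMeasurable_comp_mul_of_continuous
      hσ (hfc n)).aemeasurable.nullMeasurable (measurableSet_singleton (1 : ℝ))
  refine measure_mono_null (Set.preimage_mono hNB) ?_
  rw [← lintegral_indicator_one₀ hnull,
    lintegral_prod (Set.indicator _ 1) (aemeasurable_one.indicator₀ hnull)]
  refine lintegral_eq_zero_of_ae_eq_zero (Eventually.of_forall fun y => ?_)
  have : ∀ x, ((fun z : G × G => σ z.1 * z.2) ⁻¹' B).indicator (1 : G × G → ℝ≥0∞) (y, x) =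
      B.indicator 1 (σ y * x) := fun x => by
    by_cases hx : σ y * x ∈ B
    · rw [Set.indicator_of_mem hx, Set.indicator_of_mem (by exact hx)]; rfl
    · rw [Set.indicator_of_notMem hx, Set.indicator_of_notMem (by exact hx)]
  simp only [this, Pi.zero_apply]
  rw [lintegral_mul_left_eq_self (μ := μ) (B.indicator 1) (σ y), lintegral_indicator_one hBm, hB0]

/-- Without second countability, `(y, x) ↦ σ(y) x` is still null measurable for the product of
Haar measures. -/
theorem nullMeasurable_comp_mul {σ : G → G} (hσ : Continuous σ) :
    NullMeasurable (fun z : G × G => σ z.1 * z.2) (μ.prod μ) := by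
  intro S hS
  obtain ⟨f, hfc, hfs, hfS, hf0⟩ := exists_levelSets_ae_cover (μ := μ) hS
  have hU : MeasurableSet (⋃ n, f n ⁻¹' {1}) :=
    MeasurableSet.iUnion fun n => (hfc n).measurable (measurableSet_singleton _)
  have hS' : S = (⋃ n, f n ⁻¹' {1}) ∪ (S \ ⋃ n, f n ⁻¹' {1}) :=
    (Set.union_sdiff_cancel (Set.iUnion_subset hfS)).symm
  rw [hS', Set.preimage_union, Set.preimage_iUnion]
  refine NullMeasurableSet.union (NullMeasurableSet.iUnion fun n => ?_) ?_
  · exact (aestronglyMeasurable_comp_mul_of_continuous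
      hσ (hfc n)).aemeasurable.nullMeasurable (measurableSet_singleton (1 : ℝ))
  · exact NullMeasurableSet.of_null (measure_preimage_mul_of_null hσ (hS.diff hU) hf0)

theorem ae_prod_comp_mul {σ : G → G} (hσ : Continuous σ) {P : G → Prop} (h : ∀ᵐ x ∂μ, P x) :
    ∀ᵐ z ∂(μ.prod μ), P (σ z.1 * z.2) := by
  obtain ⟨N, hPN, hN, h0⟩ := exists_measurable_superset_of_null (mem_ae_iff.1 h)
  refine mem_ae_iff.2 (measure_mono_null ?_ (measure_preimage_mul_of_null hσ hN h0))
  intro z hz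
  exact hPN hz

variable {β : Type*} [TopologicalSpace β] [TopologicalSpace.PseudoMetrizableSpace β]
  [SecondCountableTopology β]

theorem MeasureTheory.AEStronglyMeasurable.comp_continuous_mul {σ : G → G} (hσ : Continuous σ)
    {f : G → β} (hf : AEStronglyMeasurable f μ) :
    AEStronglyMeasurable (fun z : G × G => f (σ z.1 * z.2)) (μ.prod μ) := by
  borelize β
  obtain ⟨f', hf', hff⟩ := hf
  have h : NullMeasurable (fun z : G × G => f' (σ z.1 * z.2)) (μ.prod μ) :=
    hf'.measurable.comp_nullMeasurable (nullMeasurable_comp_mul hσ)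
  have h2 : AEStronglyMeasurable (fun z : G × G => f' (σ z.1 * z.2)) (μ.prod μ) :=
    aestronglyMeasurable_iff_nullMeasurable_separable.2
      ⟨h, Set.univ, TopologicalSpace.IsSeparable.of_separableSpace _, by simp⟩
  refine h2.congr ?_
  filter_upwards [ae_prod_comp_mul hσ hff] with z hz using hz.symm

theorem MeasureTheory.AEStronglyMeasurable.comp_inv_mul {f : G → β}
    (hf : AEStronglyMeasurable f μ) :
    AEStronglyMeasurable (fun z : G × G => f (z.1⁻¹ * z.2)) (μ.prod μ) :=
  hf.comp_continuous_mul continuous_inv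

theorem AEMeasurable.comp_inv_mul {f : G → ℝ≥0∞} (hf : AEMeasurable f μ) :
    AEMeasurable (fun z : G × G => f (z.1⁻¹ * z.2)) (μ.prod μ) :=
  hf.aestronglyMeasurable.comp_inv_mul.aemeasurable

theorem AEMeasurable.comp_mul_prod {f : G → ℝ≥0∞} (hf : AEMeasurable f μ) :
    AEMeasurable (fun z : G × G => f (z.1 * z.2)) (μ.prod μ) :=
  (hf.aestronglyMeasurable.comp_continuous_mul continuous_id).aemeasurable

theorem AEMeasurable.mlconvolution {f g : G → ℝ≥0∞} (hf : AEMeasurable f μ)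
    (hg : AEMeasurable g μ) : AEMeasurable (MeasureTheory.mlconvolution f g μ) μ := by
  have h : AEMeasurable (fun z : G × G => f z.1 * g (z.1⁻¹ * z.2)) (μ.prod μ) :=
    (hf.comp_fst).mul hg.comp_inv_mul
  exact h.prod_swap.lintegral_prod_right'

/-- Tonelli and the substitution x = yz. Testing against φ = 1 gives total masses, against φ = log ω
the means of a random walk. -/
theorem lintegral_mlconvolution_mul {f g φ : G → ℝ≥0∞} (hf : AEMeasurable f μ)
    (hg : AEMeasurable g μ) (hφ : AEMeasurable φ μ) :
    ∫⁻ x, mlconvolution f g μ x * φ x ∂μ = ∫⁻ y, f y * ∫⁻ z, g z * φ (y * z) ∂μ ∂μ := by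
  have h1 : AEMeasurable (fun z : G × G => f z.1 * g (z.1⁻¹ * z.2)) (μ.prod μ) :=
    (hf.comp_fst).mul hg.comp_inv_mul
  have h2 : AEMeasurable (fun z : G × G => f z.1 * g (z.1⁻¹ * z.2) * φ z.2) (μ.prod μ) :=
    h1.mul hφ.comp_snd
  have hg' : ∀ y, AEMeasurable (fun x => g (y⁻¹ * x)) μ := fun y => hg.comp_mul_left_const y⁻¹
  calc ∫⁻ x, mlconvolution f g μ x * φ x ∂μ
      = ∫⁻ x, ∫⁻ y, f y * g (y⁻¹ * x) * φ x ∂μ ∂μ := by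
        have h3 : ∀ᵐ x ∂μ, AEMeasurable (fun y => f y * g (y⁻¹ * x)) μ :=
          by
          filter_upwards [h1.aestronglyMeasurable.prodMk_right] with x hx using hx.aemeasurable
        refine lintegral_congr_ae ?_
        filter_upwards [h3] with x hx
        rw [mlconvolution_def, lintegral_mul_const'' _ hx]
    _ = ∫⁻ y, ∫⁻ x, f y * g (y⁻¹ * x) * φ x ∂μ ∂μ := (lintegral_lintegral_swap h2).symm
    _ = ∫⁻ y, f y * ∫⁻ z, g z * φ (y * z) ∂μ ∂μ := by
        refine lintegral_congr fun y => ?_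
        rw [← lintegral_mul_left_eq_self (μ := μ) _ y]
        simp only [inv_mul_cancel_left, mul_assoc]
        exact lintegral_const_mul'' _ (hg.mul (hφ.comp_mul_left_const y))

end Measurability

/-! ### The modular character and the spreading of random walks -/

section Unimodular

open Measure

variable {G : Type*} [Group G] [TopologicalSpace G] [IsTopologicalGroup G]
    [LocallyCompactSpace G] [MeasurableSpace G] [BorelSpace G]
    {μ : Measure G} [μ.IsHaarMeasure] [μ.Regular]

theorem map_mul_right_eq_modularCharacterFun_smul (g : G) :
    μ.map (· * g) = modularCharacterFun g • μ := by
  have : (μ.map (· * g)).Regular := Regular.map (Homeomorph.mulRight g)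
  rw [modularCharacterFun_eq_haarScalarFactor μ g]
  exact isMulLeftInvariant_eq_smul_of_regular _ μ

theorem measurePreserving_mul_right_of_modularCharacterFun_eq_one {g : G}
    (h : modularCharacterFun g = 1) : μ.map (· * g) = μ := by
  rw [map_mul_right_eq_modularCharacterFun_smul, h, one_smul]

theorem lintegral_mul_right_eq_modularCharacterFun_mul {φ : G → ℝ≥0∞} (hφ : AEMeasurable φ μ)
    (g : G) : ∫⁻ x, φ (x * g) ∂μ = modularCharacterFun g * ∫⁻ x, φ x ∂μ := by
  have hm : AEMeasurable φ (μ.map (· * g)) := by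
    rw [map_mul_right_eq_modularCharacterFun_smul]
    exact hφ.smul_measure _
  have h := lintegral_map' hm (measurable_mul_const g).aemeasurable
  rw [map_mul_right_eq_modularCharacterFun_smul, lintegral_smul_measure] at h
  rw [← h]
  rfl

/-- The modular character is bounded away from `1` on an open set if it takes values below `1`. -/
theorem exists_isOpen_modularCharacterFun_le (μ : Measure G) [μ.IsHaarMeasure] [μ.Regular]
    {g₀ : G} (hg : modularCharacterFun g₀ < 1) :
    ∃ U : Set G, IsOpen U ∧ U.Nonempty ∧ ∃ c : ℝ, 0 < c ∧ c < 1 ∧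
      ∀ g ∈ U, (modularCharacterFun g : ℝ≥0∞) ≤ ENNReal.ofReal c := by
  obtain ⟨c, hc1, hc2⟩ := exists_between hg
  have hc0 : 0 < c := (modularCharacterFun_pos g₀).trans hc1
  obtain ⟨K, hKc, hK1⟩ := exists_compact_mem_nhds (1 : G)
  have hKpos : 0 < μ K := measure_pos_of_mem_nhds μ hK1
  have hpre : ∀ g, μ ((· * g) ⁻¹' K) = modularCharacterFun g * μ K := fun g => by
    have : μ.map (· * g) K = modularCharacterFun g * μ K := by
      rw [map_mul_right_eq_modularCharacterFun_smul]
      rfl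
    rw [← this]
    exact ((Homeomorph.mulRight g).measurableEmbedding.map_apply μ K).symm
  have hcalc : μ ((· * g₀) ⁻¹' K) < c * μ K := by
    rw [hpre]
    exact ENNReal.mul_lt_mul_left hKpos.ne' hKc.measure_lt_top.ne (by exact_mod_cast hc1)
  -- Outer regularity gives an open V around K g₀⁻¹ of almost the same measure, and compactness of K
  -- keeps K g⁻¹ inside V for g near g₀. Only this upper semicontinuity of the modular character is
  -- needed.
  obtain ⟨V, hKV, hVo, hVlt⟩ := Set.exists_isOpen_lt_of_lt _ _ hcalc
  have hnhds : ∀ᶠ g in 𝓝 g₀, ∀ k ∈ K, k * g⁻¹ ∈ V := by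
    refine hKc.eventually_forall_of_forall_eventually fun k hk => ?_
    have hcont : Continuous fun z : G × G => z.2 * z.1⁻¹ := by fun_prop
    exact hcont.continuousAt.eventually_mem (hVo.mem_nhds (hKV (by
      simpa using hk)))
  obtain ⟨U, hUsub, hUo, hgU⟩ := mem_nhds_iff.1 hnhds
  refine ⟨U, hUo, ⟨g₀, hgU⟩, c, by exact_mod_cast hc0, by exact_mod_cast hc2, fun g hgm => ?_⟩
  have h3 : (· * g) ⁻¹' K ⊆ V := by
    intro x hx
    have := hUsub hgm (x * g) hx
    simpa using this
  have h4 : (modularCharacterFun g : ℝ≥0∞) * μ K ≤ c * μ K := by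
    rw [← hpre]
    exact (measure_mono h3).trans hVlt.le
  rw [ENNReal.ofReal_coe_nnreal]
  exact (ENNReal.mul_le_mul_iff_left hKpos.ne' hKc.measure_lt_top.ne).1 h4

/-- Iterated convolution squares of a probability density `f₀`. -/
noncomputable def convSquareIter {G : Type*} [Group G] [MeasurableSpace G] (μ : Measure G)
    (f₀ : G → ℝ≥0∞) : ℕ → G → ℝ≥0∞
  | 0 => f₀
  | k + 1 => mlconvolution (convSquareIter μ f₀ k) (convSquareIter μ f₀ k) μ

variable [SigmaFinite μ]

theorem aemeasurable_convSquareIter {f₀ : G → ℝ≥0∞} (h : AEMeasurable f₀ μ) (k : ℕ) :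
    AEMeasurable (convSquareIter μ f₀ k) μ := by
  induction k with
  | zero => exact h
  | succ k ih => exact ih.mlconvolution ih

theorem lintegral_convSquareIter {f₀ : G → ℝ≥0∞} (h : AEMeasurable f₀ μ)
    (h1 : ∫⁻ x, f₀ x ∂μ = 1) (k : ℕ) : ∫⁻ x, convSquareIter μ f₀ k x ∂μ = 1 := by
  induction k with
  | zero => exact h1
  | succ k ih =>
    have hm := aemeasurable_convSquareIter h k
    have := lintegral_mlconvolution_mul hm hm (aemeasurable_const (b := (1 : ℝ≥0∞)))
    simp only [mul_one, ih] at this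
    exact this

/-- A point where the k-th iterate is nonzero is a product of 2^k points where `f₀` is nonzero. It
serves both for the modular character and for ω. -/
theorem le_pow_of_convSquareIter_ne_zero {G : Type*} [Group G] [MeasurableSpace G]
    {μ : Measure G} {F : G → ℝ≥0∞} (hF : ∀ x y, F (x * y) ≤ F x * F y)
    {f₀ : G → ℝ≥0∞} {c : ℝ≥0∞} (hf : ∀ x, f₀ x ≠ 0 → F x ≤ c) (k : ℕ) :
    ∀ x, convSquareIter μ f₀ k x ≠ 0 → F x ≤ c ^ 2 ^ k := by
  induction k with
  | zero => simpa [convSquareIter] using hf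
  | succ k ih =>
    intro x hx
    have hex : ∃ y, convSquareIter μ f₀ k y * convSquareIter μ f₀ k (y⁻¹ * x) ≠ 0 := by
      by_contra! hall
      exact hx (by simp [convSquareIter, mlconvolution_def, hall])
    obtain ⟨y, hy⟩ := hex
    have h := mul_le_mul' (ih y (left_ne_zero_of_mul hy)) (ih _ (right_ne_zero_of_mul hy))
    have h2 := (hF y (y⁻¹ * x)).trans h
    rw [mul_inv_cancel_left] at h2
    rwa [pow_succ, mul_two, pow_add]

/-- The density of the k-th iterate is at most C c^(2^k - 1): integrating out the left factor y in
φ(yz) produces the modular character at z, which is at most c^(2^k) on the support. The factor c on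
the left avoids the exponent 2^k - 1. -/
theorem lintegral_convSquareIter_mul_le {f₀ : G → ℝ≥0∞} (h : AEMeasurable f₀ μ)
    (h1 : ∫⁻ x, f₀ x ∂μ = 1) {c C : ℝ≥0∞}
    (hf : ∀ x, f₀ x ≠ 0 → (modularCharacterFun x : ℝ≥0∞) ≤ c) (hC : ∀ x, f₀ x ≤ C) (k : ℕ) :
    ∀ φ : G → ℝ≥0∞, AEMeasurable φ μ →
      c * ∫⁻ x, convSquareIter μ f₀ k x * φ x ∂μ ≤ C * c ^ 2 ^ k * ∫⁻ x, φ x ∂μ := by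
  have hsupp := le_pow_of_convSquareIter_ne_zero (μ := μ)
    (F := fun x => (modularCharacterFun x : ℝ≥0∞))
    (fun x y => by simp only [modularCharacterFun_map_mul, ENNReal.coe_mul, le_refl]) hf
  induction k with
  | zero =>
    intro φ hφ
    have : ∫⁻ x, f₀ x * φ x ∂μ ≤ C * ∫⁻ x, φ x ∂μ := by
      rw [← lintegral_const_mul'' _ hφ]
      exact lintegral_mono fun x => mul_le_mul' (hC x) le_rfl
    calc c * ∫⁻ x, convSquareIter μ f₀ 0 x * φ x ∂μ ≤ c * (C * ∫⁻ x, φ x ∂μ) :=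
          mul_le_mul' le_rfl this
      _ = _ := by ring
  | succ k ih =>
    intro φ hφ
    have hm := aemeasurable_convSquareIter h k
    set f := convSquareIter μ f₀ k with hfdef
    have hjoint : AEMeasurable (fun z : G × G => f z.1 * (f z.2 * φ (z.1 * z.2))) (μ.prod μ) :=
      hm.comp_fst.mul (hm.comp_snd.mul hφ.comp_mul_prod)
    have hfφ : ∀ z, AEMeasurable (fun y => φ (y * z)) μ := fun z => by
      have hq : QuasiMeasurePreserving (· * z) μ μ := by
        refine ⟨measurable_mul_const z, ?_⟩
        rw [map_mul_right_eq_modularCharacterFun_smul]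
        exact AbsolutelyContinuous.rfl.smul_left _
      exact hφ.comp_quasiMeasurePreserving hq
    calc c * ∫⁻ x, convSquareIter μ f₀ (k + 1) x * φ x ∂μ
        = c * ∫⁻ y, f y * ∫⁻ z, f z * φ (y * z) ∂μ ∂μ := by
          rw [← lintegral_mlconvolution_mul hm hm hφ]; rfl
      _ ≤ c * ∫⁻ y, ∫⁻ z, f y * (f z * φ (y * z)) ∂μ ∂μ := by
          gcongr with y
          exact lintegral_const_mul_le _ _
      _ = c * ∫⁻ z, ∫⁻ y, f y * (f z * φ (y * z)) ∂μ ∂μ := by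
          rw [lintegral_lintegral_swap hjoint]
      _ = c * ∫⁻ z, f z * ∫⁻ y, f y * φ (y * z) ∂μ ∂μ := by
          congr 2 with z
          rw [← lintegral_const_mul'' (f z) (f := fun y => f y * φ (y * z)) (hm.mul (hfφ z))]
          exact lintegral_congr fun y => by ring
      _ = ∫⁻ z, f z * (c * ∫⁻ y, f y * φ (y * z) ∂μ) ∂μ := by
          rw [← lintegral_const_mul'']
          · exact lintegral_congr fun y => by ring
          · have h2 : AEMeasurable (fun z : G × G => f z.1 * φ (z.1 * z.2)) (μ.prod μ) :=
              hm.comp_fst.mul hφ.comp_mul_prod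
            exact hm.mul h2.prod_swap.lintegral_prod_right'
      _ ≤ ∫⁻ z, f z * (C * c ^ 2 ^ k * (c ^ 2 ^ k * ∫⁻ y, φ y ∂μ)) ∂μ := by
          refine lintegral_mono fun z => ?_
          dsimp only
          by_cases hz : f z = 0
          · simp [hz]
          refine mul_le_mul' le_rfl ((ih _ (hfφ z)).trans (mul_le_mul' le_rfl ?_))
          rw [lintegral_mul_right_eq_modularCharacterFun_mul hφ]
          exact mul_le_mul' (hsupp k z hz) le_rfl
      _ = C * c ^ 2 ^ (k + 1) * ∫⁻ x, φ x ∂μ := by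
          rw [lintegral_mul_const'' _ hm, hfdef, lintegral_convSquareIter h h1, pow_succ, mul_two,
            pow_add]
          ring

end Unimodular

/-! ### The weight forces unimodularity -/

section WeightUnimodular

open Measure

variable {G : Type*} [Group G] [TopologicalSpace G] [IsTopologicalGroup G]
    [LocallyCompactSpace G] [MeasurableSpace G] [BorelSpace G]
    {μ : Measure G} [μ.IsHaarMeasure] [μ.Regular] [SigmaFinite μ]

/-- The mean of `log ω` under the convolution square of a probability density `f` is at most twice
the mean under `f`, with a gain proportional to the logarithm of the smallness of `u`. -/
theorem lintegral_mlconvolution_mul_log_weight_le {ω u : G → ℝ} (hω : Measurable ω)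
    (hω1 : ∀ x, 1 ≤ ω x) (hmul : ∀ x y, ω (x * y) ≤ ω x * ω y) (hu : Measurable u)
    (hωu : ∀ x y, ω (x * y) ≤ ω x * ω y * (u x + u y))
    {f : G → ℝ≥0∞} (hf : AEMeasurable f μ) (hf1 : ∫⁻ x, f x ∂μ = 1) {T : ℝ}
    (hbad : ∫⁻ x in {x | Real.exp (-T) / 2 ≤ u x}, f x ∂μ ≤ 2⁻¹) :
    ∫⁻ x, mlconvolution f f μ x * ENNReal.ofReal (Real.log (ω x)) ∂μ + ENNReal.ofReal T / 4 ≤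
      2 * ∫⁻ x, f x * ENNReal.ofReal (Real.log (ω x)) ∂μ := by
  set ℓ : G → ℝ≥0∞ := fun x => ENNReal.ofReal (Real.log (ω x)) with hℓ
  have hℓm : Measurable ℓ := (Real.measurable_log.comp hω).ennreal_ofReal
  set B : Set G := {x | Real.exp (-T) / 2 ≤ u x} with hB
  have hBm : MeasurableSet B := measurableSet_le measurable_const hu
  -- `g` marks the good points, where u < e^(-T)/2. If y and z are both good then u(y) + u(z) ≤
  -- e^(-T), and log ω(yz) falls short of log ω(y) + log ω(z) by T. Two independent points are both
  -- good with probability P² ≥ 1/4.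
  set g : G → ℝ≥0∞ := Bᶜ.indicator 1 with hg
  have hgm : Measurable g := measurable_one.indicator hBm.compl
  set P : ℝ≥0∞ := ∫⁻ x, f x * g x ∂μ with hP
  have hfg : ∀ x, f x * g x = Bᶜ.indicator f x := fun x => by
    by_cases hx : x ∈ Bᶜ <;> simp [hg, hx]
  have hPhalf : 2⁻¹ ≤ P := by
    have h1 : ∫⁻ x in B, f x ∂μ + P = 1 := by
      rw [hP, lintegral_congr hfg, lintegral_indicator hBm.compl, lintegral_add_compl f hBm, hf1]
    by_contra! hlt
    have : ∫⁻ x in B, f x ∂μ + P < 2⁻¹ + 2⁻¹ := ENNReal.add_lt_add_of_le_of_lt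
      (ne_top_of_le_ne_top (by simp) hbad) hbad hlt
    rw [h1, ENNReal.inv_two_add_inv_two] at this
    exact lt_irrefl _ this
  have hpt : ∀ y z, ℓ (y * z) + ENNReal.ofReal T * (g y * g z) ≤ ℓ y + ℓ z := by
    intro y z
    have hωpos : ∀ x, 0 < ω x := fun x => one_pos.trans_le (hω1 x)
    have hlog : ∀ x, 0 ≤ Real.log (ω x) := fun x => Real.log_nonneg (hω1 x)
    rw [hℓ]
    dsimp only
    rw [← ENNReal.ofReal_add (hlog y) (hlog z)]
    have hsub : Real.log (ω (y * z)) ≤ Real.log (ω y) + Real.log (ω z) := by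
      rw [← Real.log_mul (hωpos y).ne' (hωpos z).ne']
      exact Real.log_le_log (hωpos _) (hmul y z)
    by_cases hy : y ∈ B
    · simpa [hg, hy] using ENNReal.ofReal_le_ofReal hsub
    by_cases hz : z ∈ B
    · simpa [hg, hz] using ENNReal.ofReal_le_ofReal hsub
    by_cases hT : T ≤ 0
    · simpa [ENNReal.ofReal_of_nonpos hT] using ENNReal.ofReal_le_ofReal hsub
    push Not at hT
    have hgy : g y = 1 := Set.indicator_of_mem (show y ∈ Bᶜ from hy) _
    have hgz : g z = 1 := Set.indicator_of_mem (show z ∈ Bᶜ from hz) _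
    rw [hgy, hgz, mul_one, mul_one, ← ENNReal.ofReal_add (hlog _) hT.le]
    refine ENNReal.ofReal_le_ofReal ?_
    have h1 : u y + u z ≤ Real.exp (-T) := by
      have h1 : ¬ Real.exp (-T) / 2 ≤ u y := hy
      have h2 : ¬ Real.exp (-T) / 2 ≤ u z := hz
      push Not at h1 h2
      linarith
    have h2 : ω (y * z) ≤ ω y * ω z * Real.exp (-T) :=
      (hωu y z).trans (mul_le_mul_of_nonneg_left h1 (mul_pos (hωpos y) (hωpos z)).le)
    have h3 := Real.log_le_log (hωpos _) h2
    rw [Real.log_mul (mul_pos (hωpos y) (hωpos z)).ne' (Real.exp_pos _).ne',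
      Real.log_mul (hωpos y).ne' (hωpos z).ne', Real.log_exp] at h3
    linarith
  have hfℓ : AEMeasurable (fun x => f x * ℓ x) μ := hf.mul hℓm.aemeasurable
  have hfgm : AEMeasurable (fun x => f x * g x) μ := hf.mul hgm.aemeasurable
  have hfℓy : ∀ y, AEMeasurable (fun z => f z * ℓ (y * z)) μ := fun y =>
    hf.mul (hℓm.aemeasurable.comp_mul_left_const y)
  have hinner : ∀ y, f y * ∫⁻ z, f z * ℓ (y * z) ∂μ + ENNReal.ofReal T * (f y * g y * P) ≤
      f y * ℓ y + f y * ∫⁻ z, f z * ℓ z ∂μ := by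
    intro y
    calc f y * ∫⁻ z, f z * ℓ (y * z) ∂μ + ENNReal.ofReal T * (f y * g y * P)
        = f y * (∫⁻ z, f z * ℓ (y * z) ∂μ + (ENNReal.ofReal T * g y) * P) := by ring
      _ = f y * ∫⁻ z, (f z * ℓ (y * z) + (ENNReal.ofReal T * g y) * (f z * g z)) ∂μ := by
          rw [lintegral_add_left' (hfℓy y), lintegral_const_mul'' _ hfgm]
      _ ≤ f y * ∫⁻ z, (ℓ y * f z + f z * ℓ z) ∂μ := by
          refine mul_le_mul' le_rfl (lintegral_mono fun z => ?_)
          calc f z * ℓ (y * z) + (ENNReal.ofReal T * g y) * (f z * g z)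
              = f z * (ℓ (y * z) + ENNReal.ofReal T * (g y * g z)) := by ring
            _ ≤ f z * (ℓ y + ℓ z) := mul_le_mul' le_rfl (hpt y z)
            _ = ℓ y * f z + f z * ℓ z := by ring
      _ = f y * ℓ y + f y * ∫⁻ z, f z * ℓ z ∂μ := by
          rw [lintegral_add_left' (hf.const_mul _), lintegral_const_mul'' _ hf, hf1, mul_one,
            mul_add]
  have hmeas : AEMeasurable (fun y => f y * ∫⁻ z, f z * ℓ (y * z) ∂μ) μ := by
    have : AEMeasurable (fun z : G × G => f z.2 * ℓ (z.1 * z.2)) (μ.prod μ) :=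
      hf.comp_snd.mul hℓm.aemeasurable.comp_mul_prod
    exact hf.mul this.lintegral_prod_right'
  calc ∫⁻ x, mlconvolution f f μ x * ℓ x ∂μ + ENNReal.ofReal T / 4
      ≤ ∫⁻ x, mlconvolution f f μ x * ℓ x ∂μ + ENNReal.ofReal T * (P * P) := by
        gcongr
        rw [div_eq_mul_inv]
        gcongr
        calc (4 : ℝ≥0∞)⁻¹ = 2⁻¹ * 2⁻¹ := by
              rw [← ENNReal.mul_inv (by simp) (by simp)]
              norm_num
          _ ≤ P * P := mul_le_mul' hPhalf hPhalf
    _ = ∫⁻ y, (f y * ∫⁻ z, f z * ℓ (y * z) ∂μ + ENNReal.ofReal T * (f y * g y * P)) ∂μ := by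
        rw [lintegral_add_left' hmeas, lintegral_mlconvolution_mul hf hf hℓm.aemeasurable,
          lintegral_const_mul'' _ (hfgm.mul_const _), lintegral_mul_const'' _ hfgm]
    _ ≤ ∫⁻ y, (f y * ℓ y + f y * ∫⁻ z, f z * ℓ z ∂μ) ∂μ := lintegral_mono hinner
    _ = 2 * ∫⁻ x, f x * ℓ x ∂μ := by
        rw [lintegral_add_left' hfℓ, lintegral_mul_const'' _ hf, hf1, one_mul, two_mul]

/-- A sequence of nonnegative reals cannot satisfy `L (k + 1) + γ 2 ^ k ≤ 2 L k` eventually. -/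
theorem false_of_two_mul_sub_recursion {L : ℕ → ℝ} {γ : ℝ} (hγ : 0 < γ) (h0 : ∀ k, 0 ≤ L k)
    (h : ∀ᶠ k in atTop, L (k + 1) + γ * 2 ^ k ≤ 2 * L k) : False := by
  -- The quotient L k / 2^k drops by γ/2 at each step, so it eventually becomes negative.
  obtain ⟨N, hN⟩ := eventually_atTop.1 h
  have key : ∀ n : ℕ, L (N + n) / 2 ^ (N + n) + n * (γ / 2) ≤ L N / 2 ^ N := by
    intro n
    induction n with
    | zero => simp
    | succ n ih =>
      have h1 := hN (N + n) (by omega)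
      have h2 : L (N + (n + 1)) / 2 ^ (N + (n + 1)) + γ / 2 ≤ L (N + n) / 2 ^ (N + n) := by
        rw [← add_assoc, pow_succ]
        have hp : (0 : ℝ) < 2 ^ (N + n) := by positivity
        rw [← sub_nonneg]
        have : L (N + n) / 2 ^ (N + n) - (L (N + n + 1) / (2 ^ (N + n) * 2) + γ / 2) =
            (2 * L (N + n) - (L (N + n + 1) + γ * 2 ^ (N + n))) / (2 ^ (N + n) * 2) := by
          field_simp
        rw [this]
        exact div_nonneg (by linarith) (by positivity)
      push_cast
      linarith
  obtain ⟨n, hn⟩ := exists_nat_gt (L N / 2 ^ N / (γ / 2))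
  rw [div_lt_iff₀ (by positivity)] at hn
  have := key n
  have h3 : 0 ≤ L (N + n) / 2 ^ (N + n) := div_nonneg (h0 _) (by positivity)
  linarith

/-- A group carrying a weight with a submultiplicativity defect `u ∈ L^s` is unimodular. -/
theorem one_le_modularCharacterFun_of_weight (μ : Measure G) [μ.IsHaarMeasure] [μ.Regular]
    [SigmaFinite μ] {ω u : G → ℝ} (hω : Measurable ω)
    (hω1 : ∀ x, 1 ≤ ω x) (hmul : ∀ x y, ω (x * y) ≤ ω x * ω y) (hu : Measurable u)
    (hωu : ∀ x y, ω (x * y) ≤ ω x * ω y * (u x + u y)) {s : ℝ} (hs : 0 < s)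
    (hint : ∫⁻ x, ENNReal.ofReal (u x ^ s) ∂μ ≠ ∞) (g : G) : 1 ≤ modularCharacterFun g := by
  by_contra! hg
  obtain ⟨U, hUo, hUne, c, hc0, hc1, hUc⟩ := exists_isOpen_modularCharacterFun_le μ hg
  -- a set of positive finite measure on which `ω` is bounded and the modular function is small
  obtain ⟨n, hn⟩ : ∃ n : ℕ, μ (U ∩ (spanningSets μ n ∩ {x | ω x ≤ n})) ≠ 0 := by
    by_contra! hall
    have hcov : U ⊆ ⋃ n : ℕ, U ∩ (spanningSets μ n ∩ {x | ω x ≤ n}) := by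
      intro x hx
      obtain ⟨m, hm⟩ := exists_nat_ge (ω x)
      refine Set.mem_iUnion.2 ⟨max m (spanningSetsIndex μ x), hx,
        mem_spanningSets_of_index_le μ x (le_max_right _ _), ?_⟩
      exact hm.trans (by exact_mod_cast le_max_left _ _)
    exact (hUo.measure_pos μ hUne).ne' (measure_mono_null hcov (measure_iUnion_null hall))
  set V := U ∩ (spanningSets μ n ∩ {x | ω x ≤ n}) with hV
  have hVm : MeasurableSet V := hUo.measurableSet.inter
    ((measurableSet_spanningSets μ n).inter (measurableSet_le hω measurable_const))
  have hVfin : μ V ≠ ∞ := ((measure_mono (Set.inter_subset_right.trans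
    Set.inter_subset_left)).trans_lt (measure_spanningSets_lt_top μ n)).ne
  set f₀ : G → ℝ≥0∞ := V.indicator fun _ => (μ V)⁻¹ with hf₀
  have hf₀m : AEMeasurable f₀ μ := (measurable_const.indicator hVm).aemeasurable
  have hf₀1 : ∫⁻ x, f₀ x ∂μ = 1 := by
    rw [lintegral_indicator_const hVm, ENNReal.inv_mul_cancel hn hVfin]
  have hf₀c : ∀ x, f₀ x ≠ 0 → (modularCharacterFun x : ℝ≥0∞) ≤ ENNReal.ofReal c := fun x hx =>
    hUc x (Set.mem_of_indicator_ne_zero hx).1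
  have hf₀C : ∀ x, f₀ x ≤ (μ V)⁻¹ := fun x => Set.indicator_le_self' (fun _ _ => zero_le) x
  set f := convSquareIter μ f₀ with hf
  have hfm : ∀ k, AEMeasurable (f k) μ := aemeasurable_convSquareIter hf₀m
  have hf1 : ∀ k, ∫⁻ x, f k x ∂μ = 1 := lintegral_convSquareIter hf₀m hf₀1
  set L : ℕ → ℝ≥0∞ := fun k => ∫⁻ x, f k x * ENNReal.ofReal (Real.log (ω x)) ∂μ with hL
  -- This choice makes c e^(γs) = √c < 1. By Chebyshev the bad set {u ≥ e^(-γ2^k)/2} has measure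
  -- O(e^(γs2^k)), and the density of the k-th iterate is O(c^(2^k)), so the bad set has probability
  -- O(√c^(2^k)).
  set γ : ℝ := -Real.log c / (2 * s) with hγ
  have hlogc : Real.log c < 0 := Real.log_neg hc0 hc1
  have hγ0 : 0 < γ := div_pos (by linarith) (by positivity)
  have hCtop : (μ V)⁻¹ ≠ ∞ := ENNReal.inv_ne_top.2 hn
  have hc0' : ENNReal.ofReal c ≠ 0 := by simpa using hc0
  set I : ℝ≥0∞ := ∫⁻ x, ENNReal.ofReal (u x ^ s) ∂μ with hI
  -- the exceptional sets have small probability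
  have hbad : ∀ k, ENNReal.ofReal c *
      ∫⁻ x in {x | Real.exp (-(γ * 2 ^ k)) / 2 ≤ u x}, f k x ∂μ ≤
        (μ V)⁻¹ * (ENNReal.ofReal (2 ^ s) * I) * ENNReal.ofReal (Real.sqrt c) ^ 2 ^ k := by
    intro k
    set B := {x | Real.exp (-(γ * 2 ^ k)) / 2 ≤ u x}
    have hBm : MeasurableSet B := measurableSet_le measurable_const hu
    have h1 := lintegral_convSquareIter_mul_le hf₀m hf₀1 hf₀c hf₀C k (B.indicator 1)
      (aemeasurable_one.indicator hBm)
    have h2 : ∀ x, f k x * B.indicator 1 x = B.indicator (f k) x := fun x => by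
      by_cases hx : x ∈ B <;> simp [hx]
    have h3 : μ B ≤ ENNReal.ofReal (2 ^ s * Real.exp (γ * s * 2 ^ k)) * I := by
      have hε : 0 < Real.exp (-(γ * 2 ^ k)) / 2 := by positivity
      have h4 : ∀ x ∈ B, 1 ≤ ENNReal.ofReal (2 ^ s * Real.exp (γ * s * 2 ^ k)) *
          ENNReal.ofReal (u x ^ s) := by
        intro x hx
        rw [← ENNReal.ofReal_mul (by positivity), ENNReal.one_le_ofReal]
        have h5 : (Real.exp (-(γ * 2 ^ k)) / 2) ^ s ≤ u x ^ s :=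
          Real.rpow_le_rpow hε.le hx hs.le
        calc (1 : ℝ) = 2 ^ s * Real.exp (γ * s * 2 ^ k) * (Real.exp (-(γ * 2 ^ k)) / 2) ^ s := by
              rw [Real.div_rpow (Real.exp_pos _).le zero_le_two, ← Real.exp_mul]
              have : (2 : ℝ) ^ s ≠ 0 := by positivity
              field_simp
              rw [← Real.exp_add]
              ring_nf
              simp
          _ ≤ _ := by gcongr
      calc μ B = ∫⁻ x, B.indicator 1 x ∂μ := (lintegral_indicator_one hBm).symm
        _ ≤ ∫⁻ x, ENNReal.ofReal (2 ^ s * Real.exp (γ * s * 2 ^ k)) *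
              ENNReal.ofReal (u x ^ s) ∂μ := by
            refine lintegral_mono fun x => ?_
            by_cases hx : x ∈ B
            · simpa [hx] using h4 x hx
            · simp [hx]
        _ = _ := lintegral_const_mul' _ _ ENNReal.ofReal_ne_top
    simp only [← hf, h2] at h1
    rw [lintegral_indicator hBm, lintegral_indicator_one hBm] at h1
    refine h1.trans ((mul_le_mul' le_rfl h3).trans (le_of_eq ?_))
    have h6 : ENNReal.ofReal c ^ 2 ^ k * ENNReal.ofReal (2 ^ s * Real.exp (γ * s * 2 ^ k)) =
        ENNReal.ofReal (2 ^ s) * ENNReal.ofReal (Real.sqrt c) ^ 2 ^ k := by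
      rw [← ENNReal.ofReal_pow hc0.le, ← ENNReal.ofReal_pow (Real.sqrt_nonneg c),
        ← ENNReal.ofReal_mul (by positivity), ← ENNReal.ofReal_mul (by positivity)]
      congr 1
      have h7 : Real.exp (γ * s * 2 ^ k) = (Real.exp (γ * s)) ^ 2 ^ k := by
        rw [← Real.exp_nat_mul]
        push_cast
        ring_nf
      have h8 : c * Real.exp (γ * s) = Real.sqrt c := by
        have : γ * s = -(Real.log c / 2) := by
          rw [hγ]
          field_simp
        rw [this, Real.sqrt_eq_rpow, Real.rpow_def_of_pos hc0]
        nth_rewrite 1 [← Real.exp_log hc0]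
        rw [← Real.exp_add]
        ring_nf
      rw [h7, ← h8, mul_pow]
      ring
    calc (μ V)⁻¹ * ENNReal.ofReal c ^ 2 ^ k *
          (ENNReal.ofReal (2 ^ s * Real.exp (γ * s * 2 ^ k)) * I)
        = (μ V)⁻¹ * I * (ENNReal.ofReal c ^ 2 ^ k *
            ENNReal.ofReal (2 ^ s * Real.exp (γ * s * 2 ^ k))) := by ring
      _ = _ := by rw [h6]; ring
  have hev : ∀ᶠ k in atTop,
      ∫⁻ x in {x | Real.exp (-(γ * 2 ^ k)) / 2 ≤ u x}, f k x ∂μ ≤ 2⁻¹ := by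
    have hsq : ENNReal.ofReal (Real.sqrt c) < 1 := by
      rw [ENNReal.ofReal_lt_one, Real.sqrt_lt' one_pos]
      simpa using hc1
    have ht : Tendsto (fun k : ℕ => (μ V)⁻¹ * (ENNReal.ofReal (2 ^ s) * I) *
        ENNReal.ofReal (Real.sqrt c) ^ 2 ^ k) atTop (𝓝 0) := by
      have h1 := (ENNReal.tendsto_pow_atTop_nhds_zero_of_lt_one hsq).comp
        (tendsto_pow_atTop_atTop_of_one_lt (one_lt_two (α := ℕ)))
      have h2 := ENNReal.Tendsto.const_mul (a := (μ V)⁻¹ * (ENNReal.ofReal (2 ^ s) * I)) h1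
        (Or.inr (ENNReal.mul_ne_top hCtop (ENNReal.mul_ne_top ENNReal.ofReal_ne_top hint)))
      simpa [Function.comp_def] using h2
    have hpos : (0 : ℝ≥0∞) < ENNReal.ofReal c * 2⁻¹ :=
      ENNReal.mul_pos hc0' (by simp)
    filter_upwards [ht.eventually (ge_mem_nhds hpos)] with k hk
    exact (ENNReal.mul_le_mul_iff_right hc0' ENNReal.ofReal_ne_top).1 ((hbad k).trans hk)
  -- On the support of the k-th iterate ω ≤ n^(2^k), because ω ≤ n on V and ω is submultiplicative.
  have hLtop : ∀ k, L k ≠ ∞ := by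
    intro k
    have hsupp := le_pow_of_convSquareIter_ne_zero (μ := μ) (F := fun x => ENNReal.ofReal (ω x))
      (f₀ := f₀) (c := n) (fun x y => by
        rw [← ENNReal.ofReal_mul (zero_le_one.trans (hω1 x))]
        exact ENNReal.ofReal_le_ofReal (hmul x y)) (fun x hx => by
        have h1 : ω x ≤ n := (Set.mem_of_indicator_ne_zero hx).2.2
        simpa using ENNReal.ofReal_le_ofReal h1) k
    have hle : L k ≤ ∫⁻ x, (n : ℝ≥0∞) ^ 2 ^ k * f k x ∂μ := by
      refine lintegral_mono fun x => ?_
      dsimp only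
      by_cases hx : f k x = 0
      · simp [hx]
      rw [mul_comm]
      refine mul_le_mul' (le_trans (ENNReal.ofReal_le_ofReal ?_) (hsupp x hx)) le_rfl
      exact Real.log_le_self (zero_le_one.trans (hω1 x))
    refine ne_top_of_le_ne_top ?_ hle
    rw [lintegral_const_mul'' _ (hfm k), hf1, mul_one]
    exact ENNReal.pow_ne_top (ENNReal.natCast_ne_top n)
  refine false_of_two_mul_sub_recursion (L := fun k => (L k).toReal) (γ := γ / 4) (by positivity)
    (fun k => ENNReal.toReal_nonneg) ?_
  filter_upwards [hev] with k hk
  have h1 := lintegral_mlconvolution_mul_log_weight_le hω hω1 hmul hu hωu (hfm k) (hf1 k) hk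
  have h2 : L (k + 1) + ENNReal.ofReal (γ * 2 ^ k) / 4 ≤ 2 * L k := h1
  have h3 := ENNReal.toReal_mono (ENNReal.mul_ne_top (by simp) (hLtop k)) h2
  rw [ENNReal.toReal_add (hLtop _) (ENNReal.div_ne_top ENNReal.ofReal_ne_top (by simp)),
    ENNReal.toReal_mul, ENNReal.toReal_div, ENNReal.toReal_ofReal (by positivity)] at h3
  simp only [ENNReal.toReal_ofNat] at h3
  linarith

/-- A group carrying a weight with a submultiplicativity defect in `L^s` is unimodular. -/
theorem isMulRightInvariant_of_weight (μ : Measure G) [μ.IsHaarMeasure] [μ.Regular]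
    [SigmaFinite μ] {ω u : G → ℝ} (hω : Measurable ω)
    (hω1 : ∀ x, 1 ≤ ω x) (hmul : ∀ x y, ω (x * y) ≤ ω x * ω y) (hu : Measurable u)
    (hωu : ∀ x y, ω (x * y) ≤ ω x * ω y * (u x + u y)) {s : ℝ} (hs : 0 < s)
    (hint : ∫⁻ x, ENNReal.ofReal (u x ^ s) ∂μ ≠ ∞) : μ.IsMulRightInvariant := by
  have key := one_le_modularCharacterFun_of_weight μ hω hω1 hmul hu hωu hs hint
  refine ⟨fun g => measurePreserving_mul_right_of_modularCharacterFun_eq_one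
    (le_antisymm ?_ (key g))⟩
  by_contra! hlt
  -- The lower bound holds at g and at g⁻¹, and the two values multiply to 1.
  have h1 := modularCharacterFun_map_mul g g⁻¹
  rw [mul_inv_cancel, modularCharacterFun_map_one] at h1
  have h2 : (1 : NNReal) < modularCharacterFun g * modularCharacterFun g⁻¹ :=
    one_lt_mul_of_lt_of_le hlt (key g⁻¹)
  exact h2.ne h1

/-- A regular right-invariant Haar measure is invariant under inversion. -/
theorem isInvInvariant_of_isMulRightInvariant (μ : Measure G) [μ.IsHaarMeasure] [μ.Regular]
    [μ.IsMulRightInvariant] : μ.IsInvInvariant := by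
  constructor
  have : μ.inv.Regular := Regular.map (Homeomorph.inv G)
  let c : ℝ≥0∞ := haarScalarFactor μ.inv μ
  have hc : μ.inv = c • μ := isMulLeftInvariant_eq_smul_of_regular μ.inv μ
  -- Inversion is an involution, so the factor by which it scales μ has square 1.
  have : map Inv.inv (map Inv.inv μ) = c ^ 2 • μ := by
    rw [← inv_def μ, hc, Measure.map_smul, ← inv_def μ, hc, smul_smul, pow_two]
  have μeq : μ = c ^ 2 • μ := by
    rw [map_map continuous_inv.measurable continuous_inv.measurable] at this
    simpa only [inv_involutive, Function.Involutive.comp_self, Measure.map_id]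
  have K : TopologicalSpace.PositiveCompacts G := Classical.arbitrary _
  have : c ^ 2 * μ K = 1 ^ 2 * μ K := by
    conv_rhs => rw [μeq]
    simp
  have : c ^ 2 = 1 ^ 2 :=
    (ENNReal.mul_left_inj (measure_pos_of_nonempty_interior _ K.interior_nonempty).ne'
          K.isCompact.measure_lt_top.ne).1 this
  have : c = 1 := (ENNReal.pow_right_strictMono two_ne_zero).injective this
  rw [hc, this, one_smul]

end WeightUnimodular

/-! ### Young's inequality on both sides -/

section Young

variable {G : Type*} [Group G] [TopologicalSpace G] [IsTopologicalGroup G]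
    [LocallyCompactSpace G] [MeasurableSpace G] [BorelSpace G]
    {μ : Measure G} [μ.IsHaarMeasure] [μ.Regular] [SigmaFinite μ] [μ.IsInvInvariant]

/-- Inversion invariance enters here. It makes the convolution integrand measurable in y for every
x, and allows the second factor of a convolution to be changed on a null set. -/
theorem measurePreserving_inv_mul_const {G : Type*} [Group G] [MeasurableSpace G]
    [MeasurableMul G] [MeasurableInv G] (μ : Measure G) [μ.IsMulLeftInvariant]
    [μ.IsInvInvariant] (x : G) : MeasurePreserving (fun y => y⁻¹ * x) μ μ := by
  have h := (Measure.measurePreserving_inv μ).comp (measurePreserving_mul_left μ x⁻¹)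
  have h2 : (fun y => y⁻¹ * x) = Inv.inv ∘ (fun y => x⁻¹ * y) := by
    ext y
    simp
  rw [h2]
  exact h

/-- Young's inequality for the product of an integrable and a `p`-integrable function. -/
theorem eLpNorm_mlconvolution_le {F H : G → ℝ≥0∞} (hF : AEMeasurable F μ) (hH : AEMeasurable H μ)
    {p : ℝ≥0∞} (hp1 : 1 ≤ p) (hp : p ≠ ∞) :
    eLpNorm (mlconvolution F H μ) p μ ≤ eLpNorm F 1 μ * eLpNorm H p μ := by
  have hp0 : p ≠ 0 := (zero_lt_one.trans_le hp1).ne'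
  set P := p.toReal with hP
  have hP1 : 1 ≤ P := by simpa using ENNReal.toReal_mono hp hp1
  have hP0 : 0 < P := one_pos.trans_le hP1
  have hinv : 0 ≤ 1 - 1 / P := by
    rw [sub_nonneg, div_le_one hP0]
    exact hP1
  -- Hölder for the measure F(y) dy: FH = F^(1-1/P) (F H^P)^(1/P). Integration in x then leaves only
  -- masses.
  have hpt : ∀ x, mlconvolution F H μ x ^ P ≤
      (∫⁻ y, F y ∂μ) ^ (P - 1) * mlconvolution F (fun y => H y ^ P) μ x := by
    intro x
    have hHx : AEMeasurable (fun y => H (y⁻¹ * x)) μ :=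
      hH.comp_quasiMeasurePreserving (measurePreserving_inv_mul_const μ x).quasiMeasurePreserving
    have h1 := ENNReal.lintegral_mul_norm_pow_le (μ := μ) hF (hF.mul (hHx.pow_const P))
      hinv (by positivity : 0 ≤ 1 / P) (by ring)
    have h2 : ∀ y, F y ^ (1 - 1 / P) * (F y * H (y⁻¹ * x) ^ P) ^ (1 / P) =
        F y * H (y⁻¹ * x) := by
      intro y
      rw [ENNReal.mul_rpow_of_nonneg _ _ (by positivity), ← ENNReal.rpow_mul,
        mul_one_div_cancel hP0.ne', ENNReal.rpow_one, ← mul_assoc,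
        ← ENNReal.rpow_add_of_nonneg _ _ hinv (by positivity)]
      simp
    simp only [Pi.mul_apply, h2] at h1
    calc mlconvolution F H μ x ^ P
        ≤ ((∫⁻ y, F y ∂μ) ^ (1 - 1 / P) *
            (∫⁻ y, F y * H (y⁻¹ * x) ^ P ∂μ) ^ (1 / P)) ^ P :=
          ENNReal.rpow_le_rpow h1 hP0.le
      _ = _ := by
          rw [ENNReal.mul_rpow_of_nonneg _ _ hP0.le, ← ENNReal.rpow_mul, ← ENNReal.rpow_mul,
            one_div_mul_cancel hP0.ne', ENNReal.rpow_one, mlconvolution_def]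
          congr 2
          field_simp
  rw [eLpNorm_eq_lintegral_rpow_enorm_toReal hp0 hp, eLpNorm_eq_lintegral_rpow_enorm_toReal hp0 hp,
    eLpNorm_one_eq_lintegral_enorm]
  simp only [enorm_eq_self, ← hP]
  have hHP : AEMeasurable (fun y => H y ^ P) μ := hH.pow_const P
  have hint : ∫⁻ x, mlconvolution F (fun y => H y ^ P) μ x ∂μ =
      (∫⁻ y, F y ∂μ) * ∫⁻ y, H y ^ P ∂μ := by
    have h := lintegral_mlconvolution_mul hF hHP (aemeasurable_const (b := (1 : ℝ≥0∞)))
    simp only [mul_one] at h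
    rw [h, lintegral_mul_const'' _ hF]
  have hle : ∫⁻ x, mlconvolution F H μ x ^ P ∂μ ≤ (∫⁻ y, F y ∂μ) ^ P * ∫⁻ y, H y ^ P ∂μ := by
    calc ∫⁻ x, mlconvolution F H μ x ^ P ∂μ
        ≤ ∫⁻ x, (∫⁻ y, F y ∂μ) ^ (P - 1) * mlconvolution F (fun y => H y ^ P) μ x ∂μ :=
          lintegral_mono hpt
      _ = (∫⁻ y, F y ∂μ) ^ (P - 1) * ((∫⁻ y, F y ∂μ) * ∫⁻ y, H y ^ P ∂μ) := by
          rw [lintegral_const_mul'' _ (hF.mlconvolution hHP), hint]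
      _ = _ := by
          rw [← mul_assoc]
          congr 1
          nth_rewrite 2 [← ENNReal.rpow_one (∫⁻ y, F y ∂μ)]
          rw [← ENNReal.rpow_add_of_nonneg _ _ (by linarith) zero_le_one]
          ring_nf
  refine (ENNReal.rpow_le_rpow hle (by positivity)).trans (le_of_eq ?_)
  rw [ENNReal.mul_rpow_of_nonneg _ _ (by positivity), ← ENNReal.rpow_mul,
    mul_one_div_cancel hP0.ne', ENNReal.rpow_one]

/-- Inversion exchanges the two factors, which turns Young's inequality for one side into that for
the other. -/
theorem mlconvolution_inv_apply {G : Type*} [Group G] [MeasurableSpace G] [MeasurableMul G]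
    {μ : Measure G} [μ.IsMulLeftInvariant] (F H : G → ℝ≥0∞) (x : G) :
    mlconvolution F H μ x⁻¹ = mlconvolution (fun y => H y⁻¹) (fun y => F y⁻¹) μ x := by
  simp only [mlconvolution_def]
  rw [← lintegral_mul_left_eq_self (μ := μ) _ x⁻¹]
  refine lintegral_congr fun y => ?_
  simp [mul_comm]

theorem eLpNorm_comp_inv {ε : Type*} [TopologicalSpace ε] [ContinuousENorm ε] {F : G → ε}
    (hF : AEStronglyMeasurable F μ)
    (p : ℝ≥0∞) : eLpNorm (fun x => F x⁻¹) p μ = eLpNorm F p μ :=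
  eLpNorm_comp_measurePreserving hF (Measure.measurePreserving_inv μ)

/-- Young's inequality, with the integrable factor on the right (unimodular groups). -/
theorem eLpNorm_mlconvolution_le' {F H : G → ℝ≥0∞} (hF : AEMeasurable F μ)
    (hH : AEMeasurable H μ) {p : ℝ≥0∞} (hp1 : 1 ≤ p) (hp : p ≠ ∞) :
    eLpNorm (mlconvolution F H μ) p μ ≤ eLpNorm F p μ * eLpNorm H 1 μ := by
  have hinv := (Measure.measurePreserving_inv μ).quasiMeasurePreserving
  rw [← eLpNorm_comp_inv (hF.mlconvolution hH).aestronglyMeasurable,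
    ← eLpNorm_comp_inv hF.aestronglyMeasurable, ← eLpNorm_comp_inv hH.aestronglyMeasurable,
    mul_comm]
  simp only [mlconvolution_inv_apply]
  exact eLpNorm_mlconvolution_le (hH.comp_quasiMeasurePreserving hinv)
    (hF.comp_quasiMeasurePreserving hinv) hp1 hp

end Young

/-! ### Complex convolution: convergence, associativity, adjoints -/

section GroupConv

variable {G : Type*} [Group G] [TopologicalSpace G] [IsTopologicalGroup G]
    [LocallyCompactSpace G] [MeasurableSpace G] [BorelSpace G]
    {μ : Measure G} [μ.IsHaarMeasure] [μ.Regular] [SigmaFinite μ] [μ.IsInvInvariant]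

theorem aestronglyMeasurable_groupConv_integrand {f g : G → ℂ} (hf : AEStronglyMeasurable f μ)
    (hg : AEStronglyMeasurable g μ) (x : G) :
    AEStronglyMeasurable (fun y => f y * g (y⁻¹ * x)) μ :=
  hf.mul (hg.comp_quasiMeasurePreserving
    (measurePreserving_inv_mul_const μ x).quasiMeasurePreserving)

theorem MeasureTheory.AEStronglyMeasurable.groupConv {f g : G → ℂ} (hf : AEStronglyMeasurable f μ)
    (hg : AEStronglyMeasurable g μ) : AEStronglyMeasurable (groupConv μ f g) μ := by
  have h : AEStronglyMeasurable (fun z : G × G => f z.1 * g (z.1⁻¹ * z.2)) (μ.prod μ) :=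
    hf.comp_fst.mul hg.comp_inv_mul
  exact h.prod_swap.integral_prod_right'

theorem enorm_groupConv_le {G : Type*} [Group G] [MeasurableSpace G] (μ : Measure G)
    (f g : G → ℂ) (x : G) :
    ‖groupConv μ f g x‖ₑ ≤ mlconvolution (fun y => ‖f y‖ₑ) (fun y => ‖g y‖ₑ) μ x := by
  refine (enorm_integral_le_lintegral_enorm _).trans (le_of_eq ?_)
  simp [mlconvolution_def, enorm_mul]

theorem eLpNorm_groupConv_le_mlconvolution {G : Type*} [Group G] [MeasurableSpace G]
    (μ : Measure G) (f g : G → ℂ) (p : ℝ≥0∞) :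
    eLpNorm (groupConv μ f g) p μ ≤
      eLpNorm (mlconvolution (fun y => ‖f y‖ₑ) (fun y => ‖g y‖ₑ) μ) p μ :=
  eLpNorm_mono_enorm fun x => by simpa using enorm_groupConv_le μ f g x

theorem eLpNorm_groupConv_le {f g : G → ℂ} (hf : AEStronglyMeasurable f μ)
    (hg : AEStronglyMeasurable g μ) {p : ℝ≥0∞} (hp1 : 1 ≤ p) (hp : p ≠ ∞) :
    eLpNorm (groupConv μ f g) p μ ≤ eLpNorm f 1 μ * eLpNorm g p μ := by
  refine (eLpNorm_groupConv_le_mlconvolution μ f g p).trans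
    ((eLpNorm_mlconvolution_le hf.enorm hg.enorm hp1 hp).trans (le_of_eq ?_))
  rw [eLpNorm_enorm, eLpNorm_enorm]

theorem eLpNorm_groupConv_le' {f g : G → ℂ} (hf : AEStronglyMeasurable f μ)
    (hg : AEStronglyMeasurable g μ) {p : ℝ≥0∞} (hp1 : 1 ≤ p) (hp : p ≠ ∞) :
    eLpNorm (groupConv μ f g) p μ ≤ eLpNorm f p μ * eLpNorm g 1 μ := by
  refine (eLpNorm_groupConv_le_mlconvolution μ f g p).trans
    ((eLpNorm_mlconvolution_le' hf.enorm hg.enorm hp1 hp).trans (le_of_eq ?_))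
  rw [eLpNorm_enorm, eLpNorm_enorm]

theorem ae_mlconvolution_lt_top {F H : G → ℝ≥0∞} (hF : AEMeasurable F μ) (hH : AEMeasurable H μ)
    {p : ℝ≥0∞} (hp1 : 1 ≤ p) (hp : p ≠ ∞) (hF1 : eLpNorm F 1 μ ≠ ∞) (hHp : eLpNorm H p μ ≠ ∞) :
    ∀ᵐ x ∂μ, mlconvolution F H μ x < ∞ := by
  have h := (eLpNorm_mlconvolution_le hF hH hp1 hp).trans_lt (ENNReal.mul_lt_top hF1.lt_top
    hHp.lt_top)
  have hp0 : p ≠ 0 := (zero_lt_one.trans_le hp1).ne'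
  have h2 := lintegral_rpow_enorm_lt_top_of_eLpNorm_lt_top hp0 hp h
  have hpos : 0 < p.toReal := ENNReal.toReal_pos hp0 hp
  filter_upwards [ae_lt_top' ((hF.mlconvolution hH).enorm.pow_const _) h2.ne] with x hx
  simpa [ENNReal.rpow_lt_top_iff_of_pos hpos] using hx

theorem ae_groupConvExistsAt {f g : G → ℂ} (hf : Integrable f μ) {p : ℝ≥0∞} (hp1 : 1 ≤ p)
    (hp : p ≠ ∞) (hg : MemLp g p μ) : ∀ᵐ x ∂μ, GroupConvExistsAt μ f g x := by
  have h := ae_mlconvolution_lt_top hf.1.enorm hg.1.enorm hp1 hp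
    (by rw [eLpNorm_enorm]; exact (memLp_one_iff_integrable.2 hf).eLpNorm_ne_top)
    (by rw [eLpNorm_enorm]; exact hg.eLpNorm_ne_top)
  filter_upwards [h] with x hx
  refine ⟨aestronglyMeasurable_groupConv_integrand hf.1 hg.1 x, ?_⟩
  simpa [HasFiniteIntegral, mlconvolution_def, enorm_mul] using hx

theorem MeasureTheory.MemLp.groupConv {f g : G → ℂ} (hf : Integrable f μ) {p : ℝ≥0∞}
    (hp1 : 1 ≤ p) (hp : p ≠ ∞) (hg : MemLp g p μ) : MemLp (groupConv μ f g) p μ :=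
  ⟨AEStronglyMeasurable.groupConv hf.1 hg.1, (eLpNorm_groupConv_le hf.1 hg.1 hp1 hp).trans_lt
    (ENNReal.mul_lt_top (memLp_one_iff_integrable.2 hf).eLpNorm_lt_top hg.eLpNorm_lt_top)⟩

theorem groupConv_congr_left {G : Type*} [Group G] [MeasurableSpace G] {μ : Measure G}
    {f f' : G → ℂ} (hf : f =ᵐ[μ] f') (g : G → ℂ) : groupConv μ f g = groupConv μ f' g := by
  ext x
  exact integral_congr_ae (by filter_upwards [hf] with y hy; rw [hy])

theorem ae_comp_inv_mul {P : G → Prop} (h : ∀ᵐ y ∂μ, P y) (x : G) : ∀ᵐ y ∂μ, P (y⁻¹ * x) :=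
  (measurePreserving_inv_mul_const μ x).quasiMeasurePreserving.ae h

theorem groupConv_congr_right (f : G → ℂ) {g g' : G → ℂ} (hg : g =ᵐ[μ] g') :
    groupConv μ f g = groupConv μ f g' := by
  ext x
  exact integral_congr_ae (by filter_upwards [ae_comp_inv_mul hg x] with y hy; rw [hy])

/-- Associativity of convolution. -/
theorem groupConv_assoc {f g h : G → ℂ} (hf : Integrable f μ) (hg : Integrable g μ)
    {p : ℝ≥0∞} (hp1 : 1 ≤ p) (hp : p ≠ ∞) (hh : MemLp h p μ) :
    groupConv μ (groupConv μ f g) h =ᵐ[μ] groupConv μ f (groupConv μ g h) := by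
  have hff := (memLp_one_iff_integrable.2 hf).eLpNorm_lt_top
  have hgg := (memLp_one_iff_integrable.2 hg).eLpNorm_lt_top
  have hconvm := hf.1.enorm.mlconvolution hg.1.enorm
  -- Finiteness of (|f|∗|g|)∗|h| at x is exactly the absolute integrability needed for Fubini at
  -- that x.
  have hfin := ae_mlconvolution_lt_top (p := p) hconvm
    hh.1.enorm hp1 hp ((eLpNorm_mlconvolution_le hf.1.enorm hg.1.enorm le_rfl
      ENNReal.one_ne_top).trans_lt (by
        rw [eLpNorm_enorm, eLpNorm_enorm]; exact ENNReal.mul_lt_top hff hgg)).ne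
    (by rw [eLpNorm_enorm]; exact hh.eLpNorm_ne_top)
  filter_upwards [hfin] with x hx
  have hhx : AEStronglyMeasurable (fun z => h (z⁻¹ * x)) μ := hh.1.comp_quasiMeasurePreserving
    (measurePreserving_inv_mul_const μ x).quasiMeasurePreserving
  have hm0 : AEStronglyMeasurable (fun w : G × G => f w.1 * g (w.1⁻¹ * w.2)) (μ.prod μ) :=
    hf.1.comp_fst.mul hg.1.comp_inv_mul
  have hm : AEStronglyMeasurable (fun w : G × G => f w.1 * g (w.1⁻¹ * w.2) * h (w.2⁻¹ * x))
      (μ.prod μ) := hm0.mul hhx.comp_snd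
  have hint : Integrable (fun w : G × G => f w.1 * g (w.1⁻¹ * w.2) * h (w.2⁻¹ * x))
      (μ.prod μ) := by
    refine ⟨hm, ?_⟩
    rw [HasFiniteIntegral, lintegral_prod_symm _ hm.enorm]
    refine lt_of_le_of_lt (le_of_eq ?_) hx
    rw [mlconvolution_def]
    refine lintegral_congr_ae ?_
    filter_upwards [hm0.enorm.aestronglyMeasurable.prodMk_right] with z hz
    simp only [enorm_mul] at hz ⊢
    rw [lintegral_mul_const'' _ hz.aemeasurable, mlconvolution_def]
  calc groupConv μ (groupConv μ f g) h x
      = ∫ z, ∫ y, f y * g (y⁻¹ * z) * h (z⁻¹ * x) ∂μ ∂μ := by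
        refine integral_congr_ae (Eventually.of_forall fun z => ?_)
        simp only [groupConv]
        rw [integral_mul_const]
    _ = ∫ y, ∫ z, f y * g (y⁻¹ * z) * h (z⁻¹ * x) ∂μ ∂μ := (integral_integral_swap hint).symm
    _ = groupConv μ f (groupConv μ g h) x := by
        refine integral_congr_ae (Eventually.of_forall fun y => ?_)
        simp only [groupConv]
        rw [← integral_mul_left_eq_self (μ := μ) _ y, ← integral_const_mul]
        refine integral_congr_ae (Eventually.of_forall fun z => ?_)
        simp [mul_assoc]

/-- The adjoint of convolution by `f` is convolution by `y ↦ conj f(y⁻¹)`. -/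
theorem integral_groupConv_mul_conj {f g h : G → ℂ} (hf : Integrable f μ) (hg : MemLp g 2 μ)
    (hh : MemLp h 2 μ) :
    ∫ x, groupConv μ f g x * starRingEnd ℂ (h x) ∂μ =
      ∫ x, g x * starRingEnd ℂ (groupConv μ (fun y => starRingEnd ℂ (f y⁻¹)) h x) ∂μ := by
  have hm0 : AEStronglyMeasurable (fun w : G × G => f w.1 * g (w.1⁻¹ * w.2)) (μ.prod μ) :=
    hf.1.comp_fst.mul hg.1.comp_inv_mul
  have hhc : AEStronglyMeasurable (fun x => starRingEnd ℂ (h x)) μ :=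
    Complex.continuous_conj.comp_aestronglyMeasurable hh.1
  have hm : AEStronglyMeasurable
      (fun w : G × G => f w.1 * g (w.1⁻¹ * w.2) * starRingEnd ℂ (h w.2)) (μ.prod μ) :=
    hm0.mul hhc.comp_snd
  have hint : Integrable
      (fun w : G × G => f w.1 * g (w.1⁻¹ * w.2) * starRingEnd ℂ (h w.2)) (μ.prod μ) := by
    refine ⟨hm, ?_⟩
    rw [HasFiniteIntegral, lintegral_prod_symm _ hm.enorm]
    have hK : MemLp (mlconvolution (fun y => ‖f y‖ₑ) (fun y => ‖g y‖ₑ) μ) 2 μ := by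
      refine ⟨(hf.1.enorm.mlconvolution hg.1.enorm).aestronglyMeasurable, ?_⟩
      refine (eLpNorm_mlconvolution_le hf.1.enorm hg.1.enorm one_le_two
        ENNReal.ofNat_ne_top).trans_lt ?_
      rw [eLpNorm_enorm, eLpNorm_enorm]
      exact ENNReal.mul_lt_top (memLp_one_iff_integrable.2 hf).eLpNorm_lt_top hg.eLpNorm_lt_top
    -- Cauchy–Schwarz pairs |f|∗|g|, which is in L² by Young, with |h|.
    refine lt_of_le_of_lt (le_of_eq ?_)
      ((ENNReal.lintegral_mul_le_Lp_mul_Lq μ Real.HolderConjugate.two_two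
      (hf.1.enorm.mlconvolution hg.1.enorm) hh.1.enorm).trans_lt ?_)
    · refine lintegral_congr_ae ?_
      filter_upwards [hm0.enorm.aestronglyMeasurable.prodMk_right] with z hz
      simp only [enorm_mul, Pi.mul_apply] at hz ⊢
      rw [lintegral_mul_const'' _ hz.aemeasurable, mlconvolution_def]
      congr 1
      simp [enorm_eq_nnnorm]
    · have h1 := hK.eLpNorm_lt_top
      have h2 := hh.eLpNorm_lt_top
      rw [eLpNorm_eq_lintegral_rpow_enorm_toReal two_ne_zero ENNReal.ofNat_ne_top] at h1 h2
      simp only [enorm_eq_self, ENNReal.toReal_ofNat] at h1 h2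
      exact ENNReal.mul_lt_top h1 h2
  have hm2 : AEStronglyMeasurable
      (fun w : G × G => f w.1 * g w.2 * starRingEnd ℂ (h (w.1 * w.2))) (μ.prod μ) :=
    (hf.1.comp_fst.mul hg.1.comp_snd).mul (hhc.comp_continuous_mul continuous_id)
  have hint2 : Integrable
      (fun w : G × G => f w.1 * g w.2 * starRingEnd ℂ (h (w.1 * w.2))) (μ.prod μ) := by
    refine ⟨hm2, ?_⟩
    have h1 := hint.2
    rw [HasFiniteIntegral, lintegral_prod _ hm.enorm] at h1
    rw [HasFiniteIntegral, lintegral_prod _ hm2.enorm]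
    refine lt_of_le_of_lt (le_of_eq ?_) h1
    refine lintegral_congr fun y => ?_
    rw [← lintegral_mul_left_eq_self (μ := μ)
      (fun x => ‖f y * g (y⁻¹ * x) * starRingEnd ℂ (h x)‖ₑ) y]
    simp
  calc ∫ x, groupConv μ f g x * starRingEnd ℂ (h x) ∂μ
      = ∫ x, ∫ y, f y * g (y⁻¹ * x) * starRingEnd ℂ (h x) ∂μ ∂μ := by
        refine integral_congr_ae (Eventually.of_forall fun z => ?_)
        simp only [groupConv]
        rw [integral_mul_const]
    _ = ∫ y, ∫ x, f y * g (y⁻¹ * x) * starRingEnd ℂ (h x) ∂μ ∂μ :=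
        (integral_integral_swap hint).symm
    _ = ∫ y, ∫ x, f y * g x * starRingEnd ℂ (h (y * x)) ∂μ ∂μ := by
        refine integral_congr_ae (Eventually.of_forall fun y => ?_)
        dsimp only
        rw [← integral_mul_left_eq_self (μ := μ)
          (fun x => f y * g (y⁻¹ * x) * starRingEnd ℂ (h x)) y]
        simp
    _ = ∫ x, ∫ y, f y * g x * starRingEnd ℂ (h (y * x)) ∂μ ∂μ := integral_integral_swap hint2
    _ = ∫ x, g x * starRingEnd ℂ (groupConv μ (fun y => starRingEnd ℂ (f y⁻¹)) h x) ∂μ := by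
        refine integral_congr_ae (Eventually.of_forall fun x => ?_)
        simp only [groupConv]
        rw [← integral_conj, ← integral_const_mul, ← integral_inv_eq_self _ μ]
        refine integral_congr_ae (Eventually.of_forall fun y => ?_)
        simp only [map_mul, Complex.conj_conj]
        ring

end GroupConv

/-! ### Interpolation weights: the case p > 1 -/

section InterpolationWeight

variable {G : Type*} [Group G] [MeasurableSpace G] {μ : Measure G}

/-- `h` controls the failure of submultiplicativity of `ω`, and `h ω ^ θ` has the integrability
needed to bound `‖f ω h‖₁` by `‖f ω‖_P ^ (1 - θ) ‖f‖₂ ^ θ`. -/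
structure IsInterpolationWeight (μ : Measure G) (ω : G → ℝ) (P θ : ℝ) (h : G → ℝ≥0∞) :
    Prop where
  aemeasurable : AEMeasurable h μ
  pos : 0 < θ
  lt_one : θ < 1
  mul_le : ∀ x y, ENNReal.ofReal (ω (x * y)) ≤
    ENNReal.ofReal (ω x) * ENNReal.ofReal (ω y) * (h x + h y)
  lintegral_ne_top : ∫⁻ x, (h x * ENNReal.ofReal (ω x) ^ θ) ^
    ((1 - θ) * (1 - 1 / P) + θ / 2)⁻¹ ∂μ ≠ ∞

theorem ofReal_weight_mul_le {ω u : G → ℝ} (hω1 : ∀ x, 1 ≤ ω x) (hu0 : ∀ x, 0 ≤ u x)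
    (hωu : ∀ x y, ω (x * y) ≤ ω x * ω y * (u x + u y)) (x y : G) :
    ENNReal.ofReal (ω (x * y)) ≤ ENNReal.ofReal (ω x) * ENNReal.ofReal (ω y) *
      (ENNReal.ofReal (u x) + ENNReal.ofReal (u y)) := by
  have h0 : ∀ x, 0 ≤ ω x := fun x => zero_le_one.trans (hω1 x)
  rw [← ENNReal.ofReal_mul (h0 x), ← ENNReal.ofReal_add (hu0 x) (hu0 y),
    ← ENNReal.ofReal_mul (mul_nonneg (h0 x) (h0 y))]
  exact ENNReal.ofReal_le_ofReal (hωu x y)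

/-- Applied to a = u(x): boundedness of u allows the exponent s to be raised at the cost of a
constant, even when s is negative. -/
theorem rpow_le_const_mul_rpow {a B s t : ℝ} (ha : 0 < a) (haB : a ≤ B) (hst : s ≤ t) :
    a ^ t ≤ B ^ (t - s) * a ^ s := by
  have h : a ^ t = a ^ (t - s) * a ^ s := by
    rw [← Real.rpow_add ha]
    ring_nf
  rw [h]
  gcongr

/-- Here h = u works. As θ ↓ 0 the exponent D⁻¹ = ((1-θ)(1-1/P) + θ/2)⁻¹ tends to the conjugate
exponent of P, which exceeds s, while θ/D tends to 0 < r. For small θ the integrand is therefore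
dominated by u^s ω^r. -/
theorem exists_isInterpolationWeight_of_one_lt {ω u : G → ℝ} (hω1 : ∀ x, 1 ≤ ω x)
    (hu : Measurable u) (hu0 : ∀ x, 0 < u x) {B : ℝ} (huB : ∀ x, u x ≤ B)
    (hωu : ∀ x y, ω (x * y) ≤ ω x * ω y * (u x + u y)) {P s r : ℝ} (hP : 1 < P)
    (hsP : s * (1 - 1 / P) < 1) (hr : 0 < r)
    (hint : ∫⁻ x, ENNReal.ofReal (u x ^ s * ω x ^ r) ∂μ ≠ ∞) :
    ∃ θ h, IsInterpolationWeight μ ω P θ h := by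
  set κ := 1 - 1 / P with hκ
  have hκ0 : 0 < κ := by
    rw [hκ, sub_pos, div_lt_one (by linarith)]
    exact hP
  have hlim : Tendsto (fun θ : ℝ => (1 - θ) * κ + θ / 2) (𝓝[>] 0) (𝓝 κ) := by
    have : Continuous fun θ : ℝ => (1 - θ) * κ + θ / 2 := by fun_prop
    have h := this.tendsto 0
    simp only [sub_zero, one_mul, zero_div, add_zero] at h
    exact h.mono_left nhdsWithin_le_nhds
  have e1 : ∀ᶠ θ in 𝓝[>] (0 : ℝ), s * ((1 - θ) * κ + θ / 2) < 1 :=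
    (hlim.const_mul s).eventually (gt_mem_nhds hsP)
  have e2 : ∀ᶠ θ in 𝓝[>] (0 : ℝ), 0 < r * ((1 - θ) * κ + θ / 2) - θ := by
    have h := (hlim.const_mul r).sub (tendsto_nhdsWithin_of_tendsto_nhds
      (tendsto_id (α := ℝ) (x := 𝓝 0)) : Tendsto id (𝓝[>] (0 : ℝ)) (𝓝 0))
    rw [sub_zero] at h
    exact h.eventually (lt_mem_nhds (mul_pos hr hκ0))
  have e3 : ∀ᶠ θ in 𝓝[>] (0 : ℝ), θ < 1 :=
    nhdsWithin_le_nhds (gt_mem_nhds one_pos)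
  obtain ⟨θ, h1, h2, h3, h4⟩ := (e1.and (e2.and (e3.and self_mem_nhdsWithin))).exists
  have hθ0 : 0 < θ := h4
  set D := (1 - θ) * κ + θ / 2 with hD
  have hD0 : 0 < D := by
    have : 0 < (1 - θ) * κ := mul_pos (by linarith) hκ0
    positivity
  have hms : s ≤ D⁻¹ := by
    rw [← one_div, le_div_iff₀ hD0]
    exact h1.le
  have hmr : θ * D⁻¹ ≤ r := by
    rw [← div_eq_mul_inv, div_le_iff₀ hD0]
    linarith
  refine ⟨θ, fun x => ENNReal.ofReal (u x), hu.ennreal_ofReal.aemeasurable, hθ0, h3,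
    ofReal_weight_mul_le hω1 (fun x => (hu0 x).le) hωu, ?_⟩
  rw [← hκ, ← hD]
  have hle : ∀ x, (ENNReal.ofReal (u x) * ENNReal.ofReal (ω x) ^ θ) ^ D⁻¹ ≤
      ENNReal.ofReal (B ^ (D⁻¹ - s)) * ENNReal.ofReal (u x ^ s * ω x ^ r) := by
    intro x
    have hωpos : 0 < ω x := one_pos.trans_le (hω1 x)
    have hBpos : 0 < B := (hu0 x).trans_le (huB x)
    rw [ENNReal.ofReal_rpow_of_pos hωpos, ← ENNReal.ofReal_mul (hu0 x).le,
      ENNReal.ofReal_rpow_of_pos (mul_pos (hu0 x) (Real.rpow_pos_of_pos hωpos _)),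
      ← ENNReal.ofReal_mul (by positivity), Real.mul_rpow (hu0 x).le (by positivity),
      ← Real.rpow_mul hωpos.le, ← mul_assoc]
    refine ENNReal.ofReal_le_ofReal (mul_le_mul (rpow_le_const_mul_rpow (hu0 x) (huB x) hms)
      (Real.rpow_le_rpow_of_exponent_le (hω1 x) hmr) (by positivity) ?_)
    have := hu0 x
    positivity
  refine ne_top_of_le_ne_top ?_ (lintegral_mono hle)
  rw [lintegral_const_mul' _ _ ENNReal.ofReal_ne_top]
  exact ENNReal.mul_ne_top ENNReal.ofReal_ne_top hint

end InterpolationWeight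

/-! ### Interpolation weights: the case p = 1, by averaging the defect -/

section Regularization

variable {G : Type*} [Group G] [TopologicalSpace G] [IsTopologicalGroup G]
    [LocallyCompactSpace G] [MeasurableSpace G] [BorelSpace G]
    {μ : Measure G} [μ.IsHaarMeasure] [μ.Regular] [SigmaFinite μ] [μ.IsInvInvariant]
    [μ.IsMulRightInvariant]

/-- For P = 1 the integral is that of h^m ω² with m = 2/θ, so h must be small compared with ω even
if r is small, which u itself need not be. Since xy = (xv)(v⁻¹y), the defect at (x, y) is controlled
by u(xv) + u(v⁻¹y) for every v in a set V where ω is bounded. Averaging s-th powers over V yields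
h^s ≲ W ω^(-r) with W bounded and integrable; the factor ω^(-r) then supplies the decay once m is
large. -/
theorem exists_isInterpolationWeight_one {ω u : G → ℝ} (hω : IsGroupWeight ω)
    (hω1 : ∀ x, 1 ≤ ω x) (hu : Measurable u) (hu0 : ∀ x, 0 ≤ u x)
    (hωu : ∀ x y, ω (x * y) ≤ ω x * ω y * (u x + u y)) {s r : ℝ}
    (hs : 1 ≤ s) (hr : 0 < r) (hint : ∫⁻ x, ENNReal.ofReal (u x ^ s * ω x ^ r) ∂μ ≠ ∞) :
    ∃ θ h, IsInterpolationWeight μ ω 1 θ h := by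
  have hs0 : 0 < s := one_pos.trans_le hs
  have hωpos : ∀ x, 0 < ω x := fun x => one_pos.trans_le (hω1 x)
  obtain ⟨n, hn⟩ : ∃ n : ℕ, μ (spanningSets μ n ∩ {x | ω x ≤ n}) ≠ 0 := by
    by_contra! hall
    have hcov : Set.univ ⊆ ⋃ n : ℕ, spanningSets μ n ∩ {x | ω x ≤ n} := by
      intro x _
      obtain ⟨m, hm⟩ := exists_nat_ge (ω x)
      refine Set.mem_iUnion.2 ⟨max m (spanningSetsIndex μ x),
        mem_spanningSets_of_index_le μ x (le_max_right _ _), ?_⟩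
      exact hm.trans (by exact_mod_cast le_max_left _ _)
    exact (isOpen_univ.measure_pos μ Set.univ_nonempty).ne'
      (measure_mono_null hcov (measure_iUnion_null hall))
  set V := spanningSets μ n ∩ {x | ω x ≤ n} with hV
  have hVm : MeasurableSet V :=
    (measurableSet_spanningSets μ n).inter (measurableSet_le hω.measurable measurable_const)
  have hVfin : μ V ≠ ∞ :=
    ((measure_mono Set.inter_subset_left).trans_lt (measure_spanningSets_lt_top μ n)).ne
  set b : ℝ := (n : ℝ) with hb
  have hb1 : 1 ≤ b := by
    obtain ⟨v, hv⟩ := nonempty_of_measure_ne_zero hn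
    exact (hω1 v).trans hv.2
  have hb0 : 0 < b := one_pos.trans_le hb1
  set Q : G → ℝ≥0∞ := fun x => ENNReal.ofReal (u x ^ s * ω x ^ r) with hQ
  have hQm : Measurable Q :=
    ((hu.pow_const s).mul (hω.measurable.pow_const r)).ennreal_ofReal
  set I := ∫⁻ x, Q x ∂μ with hI
  set χ : G → ℝ≥0∞ := V.indicator 1 with hχ
  have hχm : Measurable χ := measurable_one.indicator hVm
  have hχ1 : ∀ x, χ x ≤ 1 := fun x => Set.indicator_le_self' (fun _ _ => zero_le) x
  have hχint : ∫⁻ x, χ x ∂μ = μ V := lintegral_indicator_one hVm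
  -- Averages of Q over V from the right and from the left. Each is bounded by ∫ Q and has integral
  -- μ(V) ∫ Q; the integral of `W₁` uses right invariance and the bound on `W₂` uses inversion
  -- invariance.
  set W₁ : G → ℝ≥0∞ := fun x => ∫⁻ v, χ v * Q (x * v) ∂μ with hW₁
  set W₂ : G → ℝ≥0∞ := mlconvolution χ Q μ with hW₂
  have hjoint : AEMeasurable (fun z : G × G => χ z.2 * Q (z.1 * z.2)) (μ.prod μ) :=
    hχm.aemeasurable.comp_snd.mul hQm.aemeasurable.comp_mul_prod
  have hW₁m : AEMeasurable W₁ μ := hjoint.lintegral_prod_right'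
  have hW₂m : AEMeasurable W₂ μ := hχm.aemeasurable.mlconvolution hQm.aemeasurable
  have hW₁le : ∀ x, W₁ x ≤ I := fun x => by
    calc W₁ x ≤ ∫⁻ v, Q (x * v) ∂μ :=
          lintegral_mono fun v => mul_le_of_le_one_left' (hχ1 v)
      _ = I := lintegral_mul_left_eq_self _ x
  have hW₂le : ∀ x, W₂ x ≤ I := fun x => by
    calc W₂ x ≤ ∫⁻ v, Q (v⁻¹ * x) ∂μ :=
          lintegral_mono fun v => mul_le_of_le_one_left' (hχ1 v)
      _ = I := (measurePreserving_inv_mul_const μ x).lintegral_comp hQm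
  have hW₁int : ∫⁻ x, W₁ x ∂μ = μ V * I := by
    rw [hW₁, lintegral_lintegral_swap hjoint, ← hχint, ← lintegral_mul_const'' _ hχm.aemeasurable]
    refine lintegral_congr fun v => ?_
    rw [lintegral_const_mul'' (f := fun x => Q (x * v)) _
      (hQm.comp (measurable_mul_const v)).aemeasurable,
      lintegral_mul_right_eq_self (μ := μ) Q v]
  have hW₂int : ∫⁻ x, W₂ x ∂μ = μ V * I := by
    have h := lintegral_mlconvolution_mul hχm.aemeasurable hQm.aemeasurable
      (aemeasurable_const (μ := μ) (b := (1 : ℝ≥0∞)))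
    simp only [mul_one] at h
    rw [hW₂, h, lintegral_mul_const'' _ hχm.aemeasurable, hχint]
  set D : ℝ := 2 ^ s * b ^ (2 * s + r) with hD
  have hD0 : 0 < D := by positivity
  -- the defect of `ω` at `(x, y)`, compared with the defect at `(x v, v⁻¹ y)`
  have hpt : ∀ x y v, v ∈ V → ENNReal.ofReal ((ω (x * y) / (ω x * ω y)) ^ s) ≤
      ENNReal.ofReal D * (Q (x * v) * ENNReal.ofReal (ω x ^ (-r)) +
        Q (v⁻¹ * y) * ENNReal.ofReal (ω y ^ (-r))) := by
    intro x y v hv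
    have hvb : ω v ≤ b := hv.2
    have hvb' : ω v⁻¹ ≤ b := by rw [hω.map_inv]; exact hvb
    have h1 : ω (x * v) ≤ b * ω x := by
      calc ω (x * v) ≤ ω x * ω v := hω.map_mul_le _ _
        _ ≤ ω x * b := by gcongr; exact (hωpos x).le
        _ = b * ω x := mul_comm _ _
    have h2 : ω (v⁻¹ * y) ≤ b * ω y := by
      calc ω (v⁻¹ * y) ≤ ω v⁻¹ * ω y := hω.map_mul_le _ _
        _ ≤ b * ω y := by gcongr; exact (hωpos y).le
    have h1' : ω x ≤ b * ω (x * v) := by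
      calc ω x = ω (x * v * v⁻¹) := by simp
        _ ≤ ω (x * v) * ω v⁻¹ := hω.map_mul_le _ _
        _ ≤ ω (x * v) * b := by gcongr; exact (hωpos _).le
        _ = b * ω (x * v) := mul_comm _ _
    have h2' : ω y ≤ b * ω (v⁻¹ * y) := by
      calc ω y = ω (v * (v⁻¹ * y)) := by simp
        _ ≤ ω v * ω (v⁻¹ * y) := hω.map_mul_le _ _
        _ ≤ b * ω (v⁻¹ * y) := by gcongr; exact (hωpos _).le
    have h3 : ω (x * y) / (ω x * ω y) ≤ b ^ 2 * (u (x * v) + u (v⁻¹ * y)) := by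
      rw [div_le_iff₀ (mul_pos (hωpos x) (hωpos y))]
      have hsum : 0 ≤ u (x * v) + u (v⁻¹ * y) := add_nonneg (hu0 _) (hu0 _)
      calc ω (x * y) = ω (x * v * (v⁻¹ * y)) := by simp [mul_assoc]
        _ ≤ ω (x * v) * ω (v⁻¹ * y) * (u (x * v) + u (v⁻¹ * y)) := hωu _ _
        _ ≤ (b * ω x) * (b * ω y) * (u (x * v) + u (v⁻¹ * y)) := by
            have := (hωpos x).le
            have := (hωpos (v⁻¹ * y)).le
            gcongr
        _ = _ := by ring
    have hpow : ∀ a c : ℝ, 0 ≤ a → 0 ≤ c → (a + c) ^ s ≤ 2 ^ s * (a ^ s + c ^ s) := by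
      intro a c ha hc
      rcases le_total a c with hac | hac
      · calc (a + c) ^ s ≤ (2 * c) ^ s := by gcongr; linarith
          _ = 2 ^ s * c ^ s := Real.mul_rpow zero_le_two hc
          _ ≤ _ := by
            gcongr
            have := Real.rpow_nonneg ha s
            linarith
      · calc (a + c) ^ s ≤ (2 * a) ^ s := by gcongr; linarith
          _ = 2 ^ s * a ^ s := Real.mul_rpow zero_le_two ha
          _ ≤ _ := by
            gcongr
            have := Real.rpow_nonneg hc s
            linarith
    -- Used for a = xv, c = x and for a = v⁻¹y, c = y, where ω(a) and ω(c) are comparable: the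
    -- factor ω(a)^r completes u(a)^s to Q(a) and leaves ω(c)^(-r), which does not depend on v.
    have hcomp : ∀ a c : G, ω c ≤ b * ω a → u a ^ s ≤ b ^ r * (u a ^ s * ω a ^ r * ω c ^ (-r)) := by
      intro a c hac
      have h4 : ω c ^ r ≤ b ^ r * ω a ^ r := by
        rw [← Real.mul_rpow hb0.le (hωpos a).le]
        exact Real.rpow_le_rpow (hωpos c).le hac hr.le
      have h5 : 0 ≤ u a ^ s := Real.rpow_nonneg (hu0 a) s
      have h6 : 0 < ω c ^ r := Real.rpow_pos_of_pos (hωpos c) r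
      rw [Real.rpow_neg (hωpos c).le]
      have h7 : b ^ r * (u a ^ s * ω a ^ r * (ω c ^ r)⁻¹) =
          u a ^ s * (b ^ r * ω a ^ r / ω c ^ r) := by
        field_simp
      rw [h7]
      refine le_mul_of_one_le_right h5 ?_
      rwa [one_le_div h6]
    have hratio : 0 ≤ ω (x * y) / (ω x * ω y) :=
      div_nonneg (hωpos _).le (mul_pos (hωpos x) (hωpos y)).le
    have hreal : (ω (x * y) / (ω x * ω y)) ^ s ≤
        D * (u (x * v) ^ s * ω (x * v) ^ r * ω x ^ (-r) +
          u (v⁻¹ * y) ^ s * ω (v⁻¹ * y) ^ r * ω y ^ (-r)) := by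
      calc (ω (x * y) / (ω x * ω y)) ^ s
          ≤ (b ^ 2 * (u (x * v) + u (v⁻¹ * y))) ^ s := by gcongr
        _ = (b ^ 2) ^ s * (u (x * v) + u (v⁻¹ * y)) ^ s :=
            Real.mul_rpow (by positivity) (add_nonneg (hu0 _) (hu0 _))
        _ ≤ (b ^ 2) ^ s * (2 ^ s * (u (x * v) ^ s + u (v⁻¹ * y) ^ s)) := by
            gcongr
            exact hpow _ _ (hu0 _) (hu0 _)
        _ ≤ (b ^ 2) ^ s * (2 ^ s * (b ^ r * (u (x * v) ^ s * ω (x * v) ^ r * ω x ^ (-r)) +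
              b ^ r * (u (v⁻¹ * y) ^ s * ω (v⁻¹ * y) ^ r * ω y ^ (-r)))) := by
            gcongr
            · exact hcomp _ _ h1'
            · exact hcomp _ _ h2'
        _ = _ := by
            rw [hD, Real.rpow_add hb0, Real.rpow_mul hb0.le, Real.rpow_two]
            ring
    have hnn : ∀ a c : G, 0 ≤ u a ^ s * ω a ^ r * ω c ^ (-r) := fun a c =>
      mul_nonneg (mul_nonneg (Real.rpow_nonneg (hu0 a) _) (Real.rpow_nonneg (hωpos a).le _))
        (Real.rpow_nonneg (hωpos c).le _)
    have hnn' : ∀ a : G, 0 ≤ u a ^ s * ω a ^ r := fun a =>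
      mul_nonneg (Real.rpow_nonneg (hu0 a) _) (Real.rpow_nonneg (hωpos a).le _)
    simp only [hQ]
    rw [← ENNReal.ofReal_mul (hnn' _), ← ENNReal.ofReal_mul (hnn' _),
      ← ENNReal.ofReal_add (hnn _ _) (hnn _ _), ← ENNReal.ofReal_mul hD0.le]
    exact ENNReal.ofReal_le_ofReal hreal
  set ρ : G → ℝ≥0∞ := fun x => ENNReal.ofReal (ω x ^ (-r)) with hρ
  have hρm : Measurable ρ := (hω.measurable.pow_const _).ennreal_ofReal
  have hρ1 : ∀ x, ρ x ≤ 1 := fun x => by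
    rw [hρ, ENNReal.ofReal_le_one]
    exact Real.rpow_le_one_of_one_le_of_nonpos (hω1 x) (by linarith)
  have havg : ∀ x y, μ V * ENNReal.ofReal ((ω (x * y) / (ω x * ω y)) ^ s) ≤
      ENNReal.ofReal D * (W₁ x * ρ x + W₂ y * ρ y) := by
    intro x y
    have hm1 : AEMeasurable (fun v => χ v * Q (x * v)) μ :=
      hχm.aemeasurable.mul (hQm.comp (measurable_const_mul x)).aemeasurable
    have hm2 : AEMeasurable (fun v => χ v * Q (v⁻¹ * y)) μ :=
      hχm.aemeasurable.mul (hQm.comp (measurePreserving_inv_mul_const μ y).measurable).aemeasurable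
    calc μ V * ENNReal.ofReal ((ω (x * y) / (ω x * ω y)) ^ s)
        = ∫⁻ v, χ v * ENNReal.ofReal ((ω (x * y) / (ω x * ω y)) ^ s) ∂μ := by
          rw [lintegral_mul_const'' _ hχm.aemeasurable, hχint]
      _ ≤ ∫⁻ v, ENNReal.ofReal D * (χ v * Q (x * v) * ρ x + χ v * Q (v⁻¹ * y) * ρ y) ∂μ := by
          refine lintegral_mono fun v => ?_
          by_cases hv : v ∈ V
          · have hv1 : χ v = 1 := Set.indicator_of_mem hv _
            simpa [hv1] using hpt x y v hv
          · have hv1 : χ v = 0 := Set.indicator_of_notMem hv _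
            simp [hv1]
      _ = _ := by
          rw [lintegral_const_mul' _ _ ENNReal.ofReal_ne_top, lintegral_add_left' (hm1.mul_const _),
            lintegral_mul_const'' _ hm1, lintegral_mul_const'' _ hm2, hW₂, mlconvolution_def]
  -- m ≥ s makes W^(m/s) ≤ I^(m/s-1) W, m ≥ 2s/r makes ω^(-rm/s) absorb ω², and m ≥ 4 gives θ = 2/m
  -- < 1.
  set m : ℝ := max s (max (2 * s / r) 4) with hm
  have hms : s ≤ m := le_max_left _ _
  have hmr : 2 * s / r ≤ m := (le_max_left _ _).trans (le_max_right _ _)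
  have hm4 : 4 ≤ m := (le_max_right _ _).trans (le_max_right _ _)
  have hm0 : 0 < m := by linarith
  set C : ℝ≥0∞ := (ENNReal.ofReal D / μ V) ^ (1 / s) with hC
  have hCtop : C ≠ ∞ := ENNReal.rpow_ne_top_of_nonneg (by positivity)
    (ENNReal.div_ne_top ENNReal.ofReal_ne_top hn)
  set h₁ : G → ℝ≥0∞ := fun x => (W₁ x * ρ x) ^ (1 / s) with hh₁
  set h₂ : G → ℝ≥0∞ := fun x => (W₂ x * ρ x) ^ (1 / s) with hh₂
  have hh₁m : AEMeasurable h₁ μ := (hW₁m.mul hρm.aemeasurable).pow_const _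
  have hh₂m : AEMeasurable h₂ μ := (hW₂m.mul hρm.aemeasurable).pow_const _
  have hdefect : ∀ x y, ENNReal.ofReal (ω (x * y) / (ω x * ω y)) ≤ C * (h₁ x + h₂ y) := by
    intro x y
    have hratio : 0 ≤ ω (x * y) / (ω x * ω y) :=
      div_nonneg (hωpos _).le (mul_pos (hωpos x) (hωpos y)).le
    have h1 : ENNReal.ofReal (ω (x * y) / (ω x * ω y)) ^ s ≤
        ENNReal.ofReal D / μ V * (W₁ x * ρ x + W₂ y * ρ y) := by
      rw [ENNReal.ofReal_rpow_of_nonneg hratio hs0.le, ← ENNReal.mul_div_right_comm,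
        ENNReal.le_div_iff_mul_le (Or.inl hn) (Or.inl hVfin), mul_comm]
      exact havg x y
    have h2 := ENNReal.rpow_le_rpow h1 (by positivity : 0 ≤ 1 / s)
    rw [← ENNReal.rpow_mul, mul_one_div_cancel hs0.ne', ENNReal.rpow_one,
      ENNReal.mul_rpow_of_nonneg _ _ (by positivity)] at h2
    refine h2.trans (mul_le_mul' le_rfl ?_)
    -- Subadditivity of t ↦ t^(1/s) needs s ≥ 1.
    exact ENNReal.rpow_add_le_add_rpow _ _ (by positivity) ((div_le_one hs0).2 hs)
  have hpiece : ∀ W : G → ℝ≥0∞, AEMeasurable W μ → (∀ x, W x ≤ I) → ∫⁻ x, W x ∂μ = μ V * I →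
      ∫⁻ x, ((W x * ρ x) ^ (1 / s)) ^ m * ENNReal.ofReal (ω x) ^ (2 : ℝ) ∂μ ≠ ∞ := by
    intro W hWm hWle hWint
    have hle : ∀ x, ((W x * ρ x) ^ (1 / s)) ^ m * ENNReal.ofReal (ω x) ^ (2 : ℝ) ≤
        I ^ (m / s - 1) * W x := by
      intro x
      have hexp : 0 ≤ m / s - 1 := by
        rw [sub_nonneg, le_div_iff₀ hs0]
        linarith
      have hms0 : 0 ≤ m / s := by positivity
      rw [← ENNReal.rpow_mul, one_div_mul_eq_div, ENNReal.mul_rpow_of_nonneg _ _ hms0, mul_assoc]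
      have h1 : W x ^ (m / s) ≤ I ^ (m / s - 1) * W x := by
        calc W x ^ (m / s) = W x ^ (m / s - 1 + 1) := by ring_nf
          _ = W x ^ (m / s - 1) * W x := by
              rw [ENNReal.rpow_add_of_nonneg _ _ hexp zero_le_one, ENNReal.rpow_one]
          _ ≤ _ := mul_le_mul' (ENNReal.rpow_le_rpow (hWle x) hexp) le_rfl
      have h2 : ρ x ^ (m / s) * ENNReal.ofReal (ω x) ^ (2 : ℝ) ≤ 1 := by
        rw [hρ]
        dsimp only
        rw [ENNReal.ofReal_rpow_of_pos (Real.rpow_pos_of_pos (hωpos x) _),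
          ENNReal.ofReal_rpow_of_pos (hωpos x), ← Real.rpow_mul (hωpos x).le,
          ← ENNReal.ofReal_mul (Real.rpow_nonneg (hωpos x).le _), ← Real.rpow_add (hωpos x),
          ENNReal.ofReal_le_one]
        refine Real.rpow_le_one_of_one_le_of_nonpos (hω1 x) ?_
        have : 2 ≤ r * (m / s) := by
          rw [div_le_iff₀ hr] at hmr
          rw [mul_div_assoc', le_div_iff₀ hs0]
          linarith
        linarith
      calc _ ≤ I ^ (m / s - 1) * W x * 1 := mul_le_mul' h1 h2
        _ = _ := mul_one _
    refine ne_top_of_le_ne_top ?_ (lintegral_mono hle)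
    rw [lintegral_const_mul'' _ hWm, hWint]
    have hexp : 0 ≤ m / s - 1 := by
      rw [sub_nonneg, le_div_iff₀ hs0]
      linarith
    exact ENNReal.mul_ne_top (ENNReal.rpow_ne_top_of_nonneg hexp hint)
      (ENNReal.mul_ne_top hVfin hint)
  -- The defect bound has `h₁` in the first variable and `h₂` in the second; their sum serves in
  -- both.
  refine ⟨2 / m, fun x => C * (h₁ x + h₂ x), (hh₁m.add hh₂m).const_mul C, by positivity, ?_, ?_, ?_⟩
  · rw [div_lt_one hm0]
    linarith
  · intro x y
    have h1 : ω (x * y) = ω x * ω y * (ω (x * y) / (ω x * ω y)) := by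
      have := (hωpos x).ne'
      have := (hωpos y).ne'
      field_simp
    rw [h1, ENNReal.ofReal_mul (mul_pos (hωpos x) (hωpos y)).le, ENNReal.ofReal_mul (hωpos x).le,
      ← mul_add]
    gcongr
    refine (hdefect x y).trans ?_
    gcongr
    · exact le_self_add
    · exact le_add_self
  · have hexp : ((1 - 2 / m) * (1 - 1 / 1) + 2 / m / 2)⁻¹ = m := by
      field_simp
      norm_num
    rw [hexp]
    have hle : ∀ x, (C * (h₁ x + h₂ x) * ENNReal.ofReal (ω x) ^ (2 / m)) ^ m ≤
        C ^ m * 2 ^ (m - 1) * (h₁ x ^ m * ENNReal.ofReal (ω x) ^ (2 : ℝ) +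
          h₂ x ^ m * ENNReal.ofReal (ω x) ^ (2 : ℝ)) := by
      intro x
      rw [ENNReal.mul_rpow_of_nonneg _ _ hm0.le, ENNReal.mul_rpow_of_nonneg _ _ hm0.le,
        ← ENNReal.rpow_mul (ENNReal.ofReal (ω x)), div_mul_cancel₀ _ hm0.ne', ← add_mul]
      calc C ^ m * (h₁ x + h₂ x) ^ m * ENNReal.ofReal (ω x) ^ (2 : ℝ)
          ≤ C ^ m * (2 ^ (m - 1) * (h₁ x ^ m + h₂ x ^ m)) * ENNReal.ofReal (ω x) ^ (2 : ℝ) :=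
            mul_le_mul' (mul_le_mul' le_rfl
              (ENNReal.rpow_add_le_mul_rpow_add_rpow _ _ (by linarith))) le_rfl
        _ = _ := by ring
    refine ne_top_of_le_ne_top ?_ (lintegral_mono hle)
    have hct : C ^ m * 2 ^ (m - 1) ≠ ∞ := ENNReal.mul_ne_top
      (ENNReal.rpow_ne_top_of_nonneg hm0.le hCtop)
      (ENNReal.rpow_ne_top_of_nonneg (by linarith) (by simp))
    rw [lintegral_const_mul' _ _ hct, lintegral_add_left'
      (f := fun x => h₁ x ^ m * ENNReal.ofReal (ω x) ^ (2 : ℝ))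
      ((hh₁m.pow_const m).mul (hω.measurable.ennreal_ofReal.pow_const _).aemeasurable)]
    exact ENNReal.mul_ne_top hct (ENNReal.add_ne_top.2
      ⟨hpiece W₁ hW₁m hW₁le hW₁int, hpiece W₂ hW₂m hW₂le hW₂int⟩)

end Regularization

/-! ### The differential norm inequality -/

section WeightedEstimates

/-- The weighted seminorm `‖f ω‖_p`. -/
noncomputable def weightedENorm {G : Type*} [MeasurableSpace G] (μ : Measure G) (p : ℝ≥0∞)
    (ω : G → ℝ) (f : G → ℂ) : ℝ≥0∞ :=
  eLpNorm (fun x => (ω x : ℂ) * f x) p μ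

theorem enorm_weight {G : Type*} {ω : G → ℝ} (hω : ∀ x, 0 ≤ ω x) (x : G) :
    ‖(ω x : ℂ)‖ₑ = ENNReal.ofReal (ω x) := by
  rw [← ofReal_norm, Complex.norm_real, Real.norm_of_nonneg (hω x)]

theorem weightedENorm_eq_mul {G : Type*} [MeasurableSpace G] {μ : Measure G} {p : ℝ≥0∞}
    {ω : G → ℝ} (hω : ∀ x, 0 ≤ ω x) (f : G → ℂ) :
    weightedENorm μ p ω f = eLpNorm (fun x => ‖f x‖ₑ * ENNReal.ofReal (ω x)) p μ := by
  refine eLpNorm_congr_enorm_ae (Eventually.of_forall fun x => ?_)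
  rw [enorm_mul, enorm_weight hω, enorm_eq_self, mul_comm]

/-- Interpolation between `‖f ω‖_p` and `‖f‖₂`. -/
theorem IsInterpolationWeight.lintegral_le {G : Type*} [Group G] [MeasurableSpace G]
    {μ : Measure G} {p : ℝ≥0∞} {ω : G → ℝ} {θ : ℝ} {h : G → ℝ≥0∞}
    (H : IsInterpolationWeight μ ω p.toReal θ h) (hωm : Measurable ω) (hω1 : ∀ x, 1 ≤ ω x)
    (hp1 : 1 ≤ p) (hp : p ≠ ∞) {f : G → ℂ} (hf : AEStronglyMeasurable f μ) :
    ∫⁻ x, ‖f x‖ₑ * ENNReal.ofReal (ω x) * h x ∂μ ≤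
      (∫⁻ x, (h x * ENNReal.ofReal (ω x) ^ θ) ^
        ((1 - θ) * (1 - 1 / p.toReal) + θ / 2)⁻¹ ∂μ) ^
          ((1 - θ) * (1 - 1 / p.toReal) + θ / 2) *
      (weightedENorm μ p ω f ^ (1 - θ) * eLpNorm f 2 μ ^ θ) := by
  have hp0 : p ≠ 0 := (zero_lt_one.trans_le hp1).ne'
  set P := p.toReal with hP
  have hP1 : 1 ≤ P := by simpa using ENNReal.toReal_mono hp hp1
  have hP0 : 0 < P := one_pos.trans_le hP1
  have hθ0 := H.pos
  have hθ1 : 0 < 1 - θ := sub_pos.2 H.lt_one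
  set D := (1 - θ) * (1 - 1 / P) + θ / 2 with hD
  have hD0 : 0 < D := by
    have : 0 ≤ 1 - 1 / P := by
      rw [sub_nonneg, div_le_one hP0]
      exact hP1
    positivity
  have hω0 : ∀ x, 0 ≤ ω x := fun x => zero_le_one.trans (hω1 x)
  set W : G → ℝ≥0∞ := fun x => ENNReal.ofReal (ω x) with hW
  have hWm : AEMeasurable W μ := hωm.ennreal_ofReal.aemeasurable
  have hW0 : ∀ x, W x ≠ 0 := fun x => by
    simpa [hW] using one_pos.trans_le (hω1 x)
  have hWt : ∀ x, W x ≠ ∞ := fun x => ENNReal.ofReal_ne_top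
  have hfm := hf.enorm
  -- Write |f|ωh = (hω^θ) (|f|ω)^(1-θ) |f|^θ. The Hölder exponents D, (1-θ)/P and θ/2 add up to 1 by
  -- the definition of D.
  let F : Fin 3 → G → ℝ≥0∞ := ![fun x => (h x * W x ^ θ) ^ D⁻¹, fun x => (‖f x‖ₑ * W x) ^ P,
    fun x => ‖f x‖ₑ ^ (2 : ℝ)]
  let e : Fin 3 → ℝ := ![D, (1 - θ) / P, θ / 2]
  have hmain := ENNReal.lintegral_prod_norm_pow_le (μ := μ) Finset.univ (f := F) (p := e) ?_ ?_ ?_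
  · simp only [Fin.prod_univ_three, F, e, Matrix.cons_val_zero, Matrix.cons_val_one,
      Matrix.cons_val_two, Matrix.head_cons, Matrix.tail_cons] at hmain
    have hprod : ∀ x, ((h x * W x ^ θ) ^ D⁻¹) ^ D * ((‖f x‖ₑ * W x) ^ P) ^ ((1 - θ) / P) *
        (‖f x‖ₑ ^ (2 : ℝ)) ^ (θ / 2) = ‖f x‖ₑ * W x * h x := by
      intro x
      rw [← ENNReal.rpow_mul, ← ENNReal.rpow_mul, ← ENNReal.rpow_mul,
        inv_mul_cancel₀ hD0.ne', ENNReal.rpow_one, mul_div_cancel₀ _ hP0.ne',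
        mul_div_cancel₀ _ two_ne_zero, ENNReal.mul_rpow_of_nonneg _ _ hθ1.le]
      calc h x * W x ^ θ * (‖f x‖ₑ ^ (1 - θ) * W x ^ (1 - θ)) * ‖f x‖ₑ ^ θ
          = (‖f x‖ₑ ^ (1 - θ) * ‖f x‖ₑ ^ θ) * (W x ^ (1 - θ) * W x ^ θ) * h x := by ring
        _ = _ := by
          rw [← ENNReal.rpow_add_of_nonneg _ _ hθ1.le hθ0.le,
            ← ENNReal.rpow_add_of_nonneg _ _ hθ1.le hθ0.le, sub_add_cancel, ENNReal.rpow_one,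
            ENNReal.rpow_one]
    rw [lintegral_congr hprod] at hmain
    refine hmain.trans (le_of_eq ?_)
    rw [mul_assoc]
    congr 2
    · rw [weightedENorm_eq_mul hω0, eLpNorm_eq_lintegral_rpow_enorm_toReal hp0 hp,
        ← ENNReal.rpow_mul]
      simp only [enorm_eq_self]
      congr 1
      rw [← hP]
      field_simp
    · rw [eLpNorm_eq_lintegral_rpow_enorm_toReal two_ne_zero ENNReal.ofNat_ne_top,
        ← ENNReal.rpow_mul]
      simp only [ENNReal.toReal_ofNat]
      congr 1
      ring
  · intro i _
    fin_cases i
    · exact (H.aemeasurable.mul (hWm.pow_const θ)).pow_const _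
    · exact (hfm.mul hWm).pow_const _
    · exact hfm.pow_const _
  · simp only [Fin.sum_univ_three, e, Matrix.cons_val_zero, Matrix.cons_val_one,
      Matrix.cons_val_two, Matrix.head_cons, Matrix.tail_cons, hD]
    field_simp
    ring
  · intro i _
    fin_cases i
    · exact hD0.le
    · exact div_nonneg hθ1.le hP0.le
    · exact div_nonneg hθ0.le zero_le_two

variable {G : Type*} [Group G] [TopologicalSpace G] [IsTopologicalGroup G]
    [LocallyCompactSpace G] [MeasurableSpace G] [BorelSpace G]
    {μ : Measure G} [μ.IsHaarMeasure] [μ.Regular] [SigmaFinite μ] [μ.IsInvInvariant]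

/-- Distributing ω(x) over y and y⁻¹x splits the convolution in two. The factor carrying h is
measured in L¹ and the other in L^p, so Young's inequality is needed on each side. -/
theorem weightedENorm_groupConv_le {p : ℝ≥0∞} {ω : G → ℝ} (hωm : Measurable ω)
    (hω1 : ∀ x, 1 ≤ ω x) (hp1 : 1 ≤ p) (hp : p ≠ ∞) {h : G → ℝ≥0∞} (hh : AEMeasurable h μ)
    (hmul : ∀ x y, ENNReal.ofReal (ω (x * y)) ≤
      ENNReal.ofReal (ω x) * ENNReal.ofReal (ω y) * (h x + h y))
    {f g : G → ℂ} (hf : AEStronglyMeasurable f μ) (hg : AEStronglyMeasurable g μ) :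
    weightedENorm μ p ω (groupConv μ f g) ≤
      (∫⁻ x, ‖f x‖ₑ * ENNReal.ofReal (ω x) * h x ∂μ) * weightedENorm μ p ω g +
      weightedENorm μ p ω f * ∫⁻ x, ‖g x‖ₑ * ENNReal.ofReal (ω x) * h x ∂μ := by
  have hω0 : ∀ x, 0 ≤ ω x := fun x => zero_le_one.trans (hω1 x)
  set W : G → ℝ≥0∞ := fun x => ENNReal.ofReal (ω x) with hW
  have hWm : AEMeasurable W μ := hωm.ennreal_ofReal.aemeasurable
  have hF : AEMeasurable (fun x => ‖f x‖ₑ * W x) μ := hf.enorm.mul hWm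
  have hH : AEMeasurable (fun x => ‖g x‖ₑ * W x) μ := hg.enorm.mul hWm
  have hF' : AEMeasurable (fun x => ‖f x‖ₑ * W x * h x) μ := hF.mul hh
  have hH' : AEMeasurable (fun x => ‖g x‖ₑ * W x * h x) μ := hH.mul hh
  set A := mlconvolution (fun x => ‖f x‖ₑ * W x * h x) (fun x => ‖g x‖ₑ * W x) μ with hA
  set B := mlconvolution (fun x => ‖f x‖ₑ * W x) (fun x => ‖g x‖ₑ * W x * h x) μ with hB
  have hpt : ∀ x, ‖(ω x : ℂ) * groupConv μ f g x‖ₑ ≤ ‖(A + B) x‖ₑ := by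
    intro x
    have hm1 : AEMeasurable (fun y => ‖f y‖ₑ * W y * h y * (‖g (y⁻¹ * x)‖ₑ * W (y⁻¹ * x))) μ :=
      hF'.mul (hH.comp_quasiMeasurePreserving
        (measurePreserving_inv_mul_const μ x).quasiMeasurePreserving)
    rw [enorm_mul, enorm_weight hω0, enorm_eq_self]
    calc W x * ‖groupConv μ f g x‖ₑ
        ≤ W x * ∫⁻ y, ‖f y‖ₑ * ‖g (y⁻¹ * x)‖ₑ ∂μ :=
          mul_le_mul' le_rfl (enorm_groupConv_le μ f g x)
      _ = ∫⁻ y, W x * (‖f y‖ₑ * ‖g (y⁻¹ * x)‖ₑ) ∂μ :=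
          (lintegral_const_mul' _ _ ENNReal.ofReal_ne_top).symm
      _ ≤ ∫⁻ y, (‖f y‖ₑ * W y * h y * (‖g (y⁻¹ * x)‖ₑ * W (y⁻¹ * x)) +
            ‖f y‖ₑ * W y * (‖g (y⁻¹ * x)‖ₑ * W (y⁻¹ * x) * h (y⁻¹ * x))) ∂μ := by
          refine lintegral_mono fun y => ?_
          have h1 := hmul y (y⁻¹ * x)
          rw [mul_inv_cancel_left] at h1
          calc W x * (‖f y‖ₑ * ‖g (y⁻¹ * x)‖ₑ)
              ≤ W y * W (y⁻¹ * x) * (h y + h (y⁻¹ * x)) * (‖f y‖ₑ * ‖g (y⁻¹ * x)‖ₑ) :=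
                mul_le_mul' h1 le_rfl
            _ = _ := by ring
      _ = (A + B) x := by
          rw [lintegral_add_left' hm1]
          rfl
  have hAm : AEMeasurable A μ := hF'.mlconvolution hH
  have hBm : AEMeasurable B μ := hF.mlconvolution hH'
  calc weightedENorm μ p ω (groupConv μ f g) ≤ eLpNorm (A + B) p μ := eLpNorm_mono_enorm hpt
    _ ≤ eLpNorm A p μ + eLpNorm B p μ :=
        eLpNorm_add_le hAm.aestronglyMeasurable hBm.aestronglyMeasurable hp1
    _ ≤ _ := by
        refine add_le_add ((eLpNorm_mlconvolution_le hF' hH hp1 hp).trans (le_of_eq ?_))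
          ((eLpNorm_mlconvolution_le' hF hH' hp1 hp).trans (le_of_eq ?_))
        · rw [weightedENorm_eq_mul hω0, eLpNorm_one_eq_lintegral_enorm]
          simp only [enorm_eq_self, hW]
        · rw [weightedENorm_eq_mul hω0, eLpNorm_one_eq_lintegral_enorm]
          simp only [enorm_eq_self, hW]

/-- The differential norm inequality for the weighted seminorm of a convolution. -/
theorem IsInterpolationWeight.exists_weightedENorm_groupConv_le {p : ℝ≥0∞} {ω : G → ℝ} {θ : ℝ}
    {h : G → ℝ≥0∞} (H : IsInterpolationWeight μ ω p.toReal θ h) (hωm : Measurable ω)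
    (hω1 : ∀ x, 1 ≤ ω x) (hp1 : 1 ≤ p) (hp : p ≠ ∞) :
    ∃ C : ℝ≥0∞, C ≠ ∞ ∧ ∀ f g : G → ℂ, AEStronglyMeasurable f μ → AEStronglyMeasurable g μ →
      weightedENorm μ p ω (groupConv μ f g) ≤
        C * (weightedENorm μ p ω f ^ (1 - θ) * eLpNorm f 2 μ ^ θ * weightedENorm μ p ω g +
          weightedENorm μ p ω f * (weightedENorm μ p ω g ^ (1 - θ) * eLpNorm g 2 μ ^ θ)) := by
  have hD0 : 0 ≤ (1 - θ) * (1 - 1 / p.toReal) + θ / 2 := by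
    have hP1 : 1 ≤ p.toReal := by simpa using ENNReal.toReal_mono hp hp1
    have h1 : 0 ≤ 1 - 1 / p.toReal := by
      rw [sub_nonneg, div_le_one (by linarith)]
      exact hP1
    have h2 := H.pos
    have h3 : 0 < 1 - θ := sub_pos.2 H.lt_one
    positivity
  refine ⟨_, ENNReal.rpow_ne_top_of_nonneg hD0 H.lintegral_ne_top, fun f g hf hg => ?_⟩
  refine (weightedENorm_groupConv_le hωm hω1 hp1 hp H.aemeasurable H.mul_le hf hg).trans ?_
  refine (add_le_add (mul_le_mul' (H.lintegral_le hωm hω1 hp1 hp hf) le_rfl)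
    (mul_le_mul' le_rfl (H.lintegral_le hωm hω1 hp1 hp hg))).trans (le_of_eq ?_)
  ring

end WeightedEstimates

/-! ### The embedding of the weighted space into L¹ -/

section Embedding

variable {G : Type*} [MeasurableSpace G] {μ : Measure G}

/-- Since ωu ≥ δ, one has 1/ω ≤ u/δ, and u^q is at most a constant times u^s ω^r because s ≤ q, u is
bounded and ω ≥ 1. For q = ∞ only ω ≥ 1 matters. -/
theorem memLp_inv_weight {ω u : G → ℝ} (hωm : Measurable ω) (hω1 : ∀ x, 1 ≤ ω x)
    (hu0 : ∀ x, 0 < u x) {B : ℝ} (huB : ∀ x, u x ≤ B) {δ : ℝ} (hδ : 0 < δ)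
    (hσ : ∀ x, δ ≤ ω x * u x) {s r : ℝ} {q : ℝ≥0∞} (hq0 : q ≠ 0)
    (hs : q ≠ ∞ → s ≤ q.toReal) (hr : 0 < r)
    (hint : ∫⁻ x, ENNReal.ofReal (u x ^ s * ω x ^ r) ∂μ ≠ ∞) :
    MemLp (fun x => (((ω x)⁻¹ : ℝ) : ℂ)) q μ := by
  have hm : AEStronglyMeasurable (fun x => (((ω x)⁻¹ : ℝ) : ℂ)) μ :=
    (Complex.measurable_ofReal.comp hωm.inv).aestronglyMeasurable
  have hω0 : ∀ x, 0 < ω x := fun x => one_pos.trans_le (hω1 x)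
  by_cases hq : q = ∞
  · rw [hq]
    refine memLp_top_of_bound hm 1 (Eventually.of_forall fun x => ?_)
    rw [Complex.norm_real, Real.norm_of_nonneg (inv_nonneg.2 (hω0 x).le)]
    exact inv_le_one_of_one_le₀ (hω1 x)
  refine ⟨hm, ?_⟩
  have hqr : 0 < q.toReal := ENNReal.toReal_pos hq0 hq
  rw [eLpNorm_lt_top_iff_lintegral_rpow_enorm_lt_top hq0 hq]
  have hle : ∀ x, ‖(((ω x)⁻¹ : ℝ) : ℂ)‖ₑ ^ q.toReal ≤
      ENNReal.ofReal (δ⁻¹ ^ q.toReal * B ^ (q.toReal - s)) *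
        ENNReal.ofReal (u x ^ s * ω x ^ r) := by
    intro x
    have hB : 0 < B := (hu0 x).trans_le (huB x)
    rw [← ofReal_norm, Complex.norm_real, Real.norm_of_nonneg (inv_nonneg.2 (hω0 x).le),
      ENNReal.ofReal_rpow_of_pos (inv_pos.2 (hω0 x)), ← ENNReal.ofReal_mul (by positivity)]
    refine ENNReal.ofReal_le_ofReal ?_
    have h1 : (ω x)⁻¹ ≤ δ⁻¹ * u x := by
      rw [inv_le_iff_one_le_mul₀ (hω0 x), mul_assoc, ← div_eq_inv_mul, le_div_iff₀ hδ, one_mul]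
      linarith [hσ x]
    have h2 : 0 ≤ u x ^ s := Real.rpow_nonneg (hu0 x).le s
    calc (ω x)⁻¹ ^ q.toReal ≤ (δ⁻¹ * u x) ^ q.toReal :=
          Real.rpow_le_rpow (inv_nonneg.2 (hω0 x).le) h1 hqr.le
      _ = δ⁻¹ ^ q.toReal * u x ^ q.toReal :=
          Real.mul_rpow (inv_nonneg.2 hδ.le) (hu0 x).le
      _ ≤ δ⁻¹ ^ q.toReal * (B ^ (q.toReal - s) * (u x ^ s * 1)) := by
          rw [mul_one]
          gcongr
          exact rpow_le_const_mul_rpow (hu0 x) (huB x) (hs hq)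
      _ ≤ δ⁻¹ ^ q.toReal * (B ^ (q.toReal - s) * (u x ^ s * ω x ^ r)) := by
          gcongr
          exact Real.one_le_rpow (hω1 x) hr.le
      _ = _ := by ring
  refine (lintegral_mono hle).trans_lt ?_
  rw [lintegral_const_mul' _ _ ENNReal.ofReal_ne_top]
  exact ENNReal.mul_lt_top ENNReal.ofReal_lt_top hint.lt_top

/-- Hölder for f = ω⁻¹ · (ωf). -/
theorem eLpNorm_one_le_weightedENorm {ω : G → ℝ} (hωm : Measurable ω) (hω1 : ∀ x, 1 ≤ ω x)
    {p q : ℝ≥0∞} (hpq : p⁻¹ + q⁻¹ = 1) {f : G → ℂ} (hf : AEStronglyMeasurable f μ) :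
    eLpNorm f 1 μ ≤ eLpNorm (fun x => (((ω x)⁻¹ : ℝ) : ℂ)) q μ * weightedENorm μ p ω f := by
  have : ENNReal.HolderTriple q p 1 := ⟨by rw [inv_one, add_comm, hpq]⟩
  have hm : AEStronglyMeasurable (fun x => (((ω x)⁻¹ : ℝ) : ℂ)) μ :=
    (Complex.measurable_ofReal.comp hωm.inv).aestronglyMeasurable
  have hm2 : AEStronglyMeasurable (fun x => (ω x : ℂ) * f x) μ :=
    (Complex.measurable_ofReal.comp hωm).aestronglyMeasurable.mul hf
  refine le_trans (le_of_eq ?_) (eLpNorm_smul_le_mul_eLpNorm (r := 1) hm2 hm)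
  congr 1
  ext x
  have : (ω x : ℂ) ≠ 0 := by
    exact_mod_cast (one_pos.trans_le (hω1 x)).ne'
  simp [this]

end Embedding

/-! ### Convolution operators on L² -/

section ConvolutionOperator

variable {G : Type*} [Group G] [TopologicalSpace G] [IsTopologicalGroup G]
    [LocallyCompactSpace G] [MeasurableSpace G] [BorelSpace G]
    {μ : Measure G} [μ.IsHaarMeasure] [μ.Regular] [SigmaFinite μ] [μ.IsInvInvariant]

theorem memLp_groupConv_Lp {f : G → ℂ} (hf : Integrable f μ) (g : Lp ℂ 2 μ) :
    MemLp (groupConv μ f g) 2 μ :=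
  MemLp.groupConv hf one_le_two ENNReal.ofNat_ne_top (Lp.memLp g)

theorem ae_groupConvExistsAt_Lp {f : G → ℂ} (hf : Integrable f μ) (g : Lp ℂ 2 μ) :
    ∀ᵐ x ∂μ, GroupConvExistsAt μ f g x :=
  ae_groupConvExistsAt hf one_le_two ENNReal.ofNat_ne_top (Lp.memLp g)

/-- Left convolution by an integrable function, as a bounded operator on `L²`. -/
noncomputable def convOp (f : G → ℂ) (hf : Integrable f μ) : Lp ℂ 2 μ →L[ℂ] Lp ℂ 2 μ :=
  LinearMap.mkContinuous
    { toFun := fun g => (memLp_groupConv_Lp hf g).toLp _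
      map_add' := by
        intro g₁ g₂
        rw [← MemLp.toLp_add, MemLp.toLp_eq_toLp_iff]
        filter_upwards [ae_groupConvExistsAt_Lp hf g₁, ae_groupConvExistsAt_Lp hf g₂] with x h₁ h₂
        rw [groupConv_congr_right f (Lp.coeFn_add g₁ g₂), Pi.add_apply]
        simp only [groupConv, Pi.add_apply, mul_add]
        exact integral_add h₁ h₂
      map_smul' := by
        intro c g
        rw [RingHom.id_apply, ← MemLp.toLp_const_smul, MemLp.toLp_eq_toLp_iff]
        refine Eventually.of_forall fun x => ?_
        rw [groupConv_congr_right f (Lp.coeFn_smul c g), Pi.smul_apply, smul_eq_mul]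
        simp only [groupConv, Pi.smul_apply, smul_eq_mul]
        rw [← integral_const_mul]
        exact integral_congr_ae (Eventually.of_forall fun y => by ring) }
    (eLpNorm f 1 μ).toReal (by
      intro g
      rw [LinearMap.coe_mk, AddHom.coe_mk, Lp.norm_toLp, Lp.norm_def, ← ENNReal.toReal_mul]
      refine ENNReal.toReal_mono (ENNReal.mul_ne_top
        (memLp_one_iff_integrable.2 hf).eLpNorm_ne_top (Lp.memLp g).eLpNorm_ne_top) ?_
      exact eLpNorm_groupConv_le hf.1 (Lp.memLp g).1 one_le_two ENNReal.ofNat_ne_top)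

theorem coeFn_convOp {f : G → ℂ} (hf : Integrable f μ) (g : Lp ℂ 2 μ) :
    convOp f hf g =ᵐ[μ] groupConv μ f g :=
  MemLp.coeFn_toLp (memLp_groupConv_Lp hf g)

theorem norm_convOp_le {f : G → ℂ} (hf : Integrable f μ) :
    ‖convOp f hf‖ ≤ (eLpNorm f 1 μ).toReal :=
  LinearMap.mkContinuous_norm_le _ ENNReal.toReal_nonneg _

/-- Applied to indicators of small sets, whose L¹ norm is small relative to their L² norm. -/
theorem norm_convOp_apply_le {f : G → ℂ} (hf : Integrable f μ) (hf2 : MemLp f 2 μ)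
    (g : Lp ℂ 2 μ) (hg : Integrable g μ) :
    ‖convOp f hf g‖ ≤ (eLpNorm f 2 μ).toReal * (eLpNorm g 1 μ).toReal := by
  rw [Lp.norm_def, eLpNorm_congr_ae (coeFn_convOp hf g), ← ENNReal.toReal_mul]
  refine ENNReal.toReal_mono (ENNReal.mul_ne_top hf2.eLpNorm_ne_top
    (memLp_one_iff_integrable.2 hg).eLpNorm_ne_top) ?_
  exact eLpNorm_groupConv_le' hf.1 hg.1 one_le_two ENNReal.ofNat_ne_top

theorem convOp_congr {f f' : G → ℂ} (hf : Integrable f μ) (hf' : Integrable f' μ)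
    (h : f =ᵐ[μ] f') : convOp f hf = convOp f' hf' := by
  ext1 g
  refine Lp.ext ((coeFn_convOp hf g).trans ?_)
  rw [groupConv_congr_left h]
  exact (coeFn_convOp hf' g).symm

theorem convOp_add {f₁ f₂ : G → ℂ} (h₁ : Integrable f₁ μ) (h₂ : Integrable f₂ μ) :
    convOp (f₁ + f₂) (h₁.add h₂) = convOp f₁ h₁ + convOp f₂ h₂ := by
  ext1 g
  refine Lp.ext ?_
  rw [add_apply]
  filter_upwards [coeFn_convOp (h₁.add h₂) g, coeFn_convOp h₁ g, coeFn_convOp h₂ g,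
    Lp.coeFn_add (convOp f₁ h₁ g) (convOp f₂ h₂ g), ae_groupConvExistsAt_Lp h₁ g,
    ae_groupConvExistsAt_Lp h₂ g] with x e e₁ e₂ ea c₁ c₂
  rw [e, ea, Pi.add_apply, e₁, e₂]
  simp only [groupConv, Pi.add_apply, add_mul]
  exact integral_add c₁ c₂

theorem convOp_smul {f : G → ℂ} (h : Integrable f μ) (c : ℂ) :
    convOp (c • f) (h.smul c) = c • convOp f h := by
  ext1 g
  refine Lp.ext ?_
  rw [smul_apply]
  filter_upwards [coeFn_convOp (h.smul c) g, coeFn_convOp h g,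
    Lp.coeFn_smul c (convOp f h g)] with x e e₁ ea
  rw [e, ea, Pi.smul_apply, e₁]
  simp only [groupConv, Pi.smul_apply, smul_eq_mul, mul_assoc]
  exact integral_const_mul _ _

theorem integrable_groupConv {f g : G → ℂ} (hf : Integrable f μ) (hg : Integrable g μ) :
    Integrable (groupConv μ f g) μ :=
  memLp_one_iff_integrable.1
    (MemLp.groupConv hf le_rfl ENNReal.one_ne_top (memLp_one_iff_integrable.2 hg))

theorem convOp_groupConv {f g : G → ℂ} (hf : Integrable f μ) (hg : Integrable g μ) :
    convOp (groupConv μ f g) (integrable_groupConv hf hg) = convOp f hf * convOp g hg := by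
  ext1 k
  refine Lp.ext ?_
  rw [mul_apply_eq_comp]
  refine (coeFn_convOp _ k).trans ?_
  refine (groupConv_assoc hf hg one_le_two ENNReal.ofNat_ne_top (Lp.memLp k)).trans ?_
  rw [← groupConv_congr_right f (coeFn_convOp hg k)]
  exact (coeFn_convOp hf _).symm

/-- The involution `f ↦ conj f(x⁻¹)` (for unimodular groups). -/
noncomputable def convStar {G : Type*} [Group G] (f : G → ℂ) : G → ℂ :=
  fun x => starRingEnd ℂ (f x⁻¹)

theorem MeasureTheory.MemLp.convStar {f : G → ℂ} {p : ℝ≥0∞} (hf : MemLp f p μ) :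
    MemLp (convStar f) p μ :=
  (hf.comp_measurePreserving (Measure.measurePreserving_inv μ)).star

theorem integrable_convStar {f : G → ℂ} (hf : Integrable f μ) : Integrable (convStar f) μ :=
  memLp_one_iff_integrable.1 (memLp_one_iff_integrable.2 hf).convStar

theorem adjoint_convOp {f : G → ℂ} (hf : Integrable f μ) :
    ContinuousLinearMap.adjoint (convOp f hf) = convOp (convStar f) (integrable_convStar hf) := by
  symm
  rw [ContinuousLinearMap.eq_adjoint_iff]
  intro h g
  rw [L2.inner_def, L2.inner_def]
  simp only [RCLike.inner_apply]
  have key := integral_groupConv_mul_conj hf (Lp.memLp g) (Lp.memLp h)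
  calc ∫ x, g x * starRingEnd ℂ (convOp (convStar f) (integrable_convStar hf) h x) ∂μ
      = ∫ x, g x * starRingEnd ℂ (groupConv μ (fun y => starRingEnd ℂ (f y⁻¹)) h x) ∂μ := by
        refine integral_congr_ae ?_
        filter_upwards [coeFn_convOp (integrable_convStar hf) h] with x hx
        rw [hx]
        rfl
    _ = ∫ x, groupConv μ f g x * starRingEnd ℂ (h x) ∂μ := key.symm
    _ = ∫ x, convOp f hf g x * starRingEnd ℂ (h x) ∂μ := by
        refine integral_congr_ae ?_
        filter_upwards [coeFn_convOp hf g] with x hx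
        rw [hx]

/-- On a nondiscrete group, the scalar part of `convOp f + t` is bounded by its norm. -/
theorem norm_le_norm_convOp_add_smul [T2Space G] (hG : ¬ DiscreteTopology G) {f : G → ℂ}
    (hf : Integrable f μ) (hf2 : MemLp f 2 μ) (t : ℂ) :
    ‖t‖ ≤ ‖convOp f hf + t • (1 : Lp ℂ 2 μ →L[ℂ] Lp ℂ 2 μ)‖ := by
  set T := convOp f hf + t • (1 : Lp ℂ 2 μ →L[ℂ] Lp ℂ 2 μ) with hT
  have hne : (𝓝[≠] (1 : G)).NeBot := by
    by_contra hbot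
    rw [not_neBot] at hbot
    exact hG (discreteTopology_of_isOpen_singleton_one
      (isOpen_singleton_iff_punctured_nhds 1 |>.2 hbot))
  have h1 : μ {1} = 0 := by
    exact measure_singleton 1
  -- Test T on the indicator g of an open neighbourhood U of 1 with μ(U) = a < ε², available because
  -- points are null. Then ‖g‖₂ = √a while ‖f∗g‖₂ ≤ ‖f‖₂ a, so on g the operator T is nearly
  -- multiplication by t.
  have hsmall : ∀ ε : ℝ, 0 < ε → ‖t‖ ≤ ‖T‖ + (eLpNorm f 2 μ).toReal * ε := by
    intro ε hε
    have hlt : μ {1} < ENNReal.ofReal (ε ^ 2) := by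
      rw [h1, ENNReal.ofReal_pos]
      positivity
    obtain ⟨U, hU1, hUo, hUlt⟩ := Set.exists_isOpen_lt_of_lt _ _ hlt
    have hUfin : μ U ≠ ∞ := hUlt.ne_top
    have hUpos : 0 < μ U := hUo.measure_pos μ ⟨1, hU1 rfl⟩
    set g : Lp ℂ 2 μ := indicatorConstLp 2 hUo.measurableSet hUfin (1 : ℂ) with hg
    have hgc : g =ᵐ[μ] U.indicator fun _ => (1 : ℂ) := indicatorConstLp_coeFn
    have hgint : Integrable g μ :=
      (integrable_congr hgc).2 ((integrable_indicator_iff hUo.measurableSet).2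
        (integrableOn_const hUfin))
    set a : ℝ := (μ U).toReal with ha
    have ha0 : 0 < a := ENNReal.toReal_pos hUpos.ne' hUfin
    have hg2 : ‖g‖ = Real.sqrt a := by
      rw [hg, norm_indicatorConstLp two_ne_zero ENNReal.ofNat_ne_top, norm_one, one_mul,
        Real.sqrt_eq_rpow]
      simp [ha, Measure.real]
    have hg1 : (eLpNorm g 1 μ).toReal = a := by
      rw [eLpNorm_congr_ae hgc, eLpNorm_indicator_const hUo.measurableSet one_ne_zero
        ENNReal.one_ne_top]
      simp [ha]
    have hsa : 0 < Real.sqrt a := Real.sqrt_pos.2 ha0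
    have hsε : Real.sqrt a ≤ ε := by
      rw [Real.sqrt_le_left hε.le]
      have := ENNReal.toReal_mono ENNReal.ofReal_ne_top hUlt.le
      rwa [ENNReal.toReal_ofReal (by positivity)] at this
    have h2 : t • g = T g - convOp f hf g := by
      rw [hT]
      simp
    have h3 : ‖t‖ * Real.sqrt a ≤ ‖T‖ * Real.sqrt a + (eLpNorm f 2 μ).toReal * a := by
      calc ‖t‖ * Real.sqrt a = ‖t • g‖ := by rw [norm_smul, hg2]
        _ = ‖T g - convOp f hf g‖ := by rw [h2]
        _ ≤ ‖T g‖ + ‖convOp f hf g‖ := norm_sub_le _ _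
        _ ≤ ‖T‖ * Real.sqrt a + (eLpNorm f 2 μ).toReal * a := by
            refine add_le_add ?_ ?_
            · rw [← hg2]
              exact T.le_opNorm g
            · rw [← hg1]
              exact norm_convOp_apply_le hf hf2 g hgint
    have h4 : a = Real.sqrt a * Real.sqrt a := (Real.mul_self_sqrt ha0.le).symm
    have h5 : ‖t‖ ≤ ‖T‖ + (eLpNorm f 2 μ).toReal * Real.sqrt a := by
      refine le_of_mul_le_mul_right ?_ hsa
      calc ‖t‖ * Real.sqrt a ≤ ‖T‖ * Real.sqrt a + (eLpNorm f 2 μ).toReal * a := h3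
        _ = _ := by rw [add_mul, mul_assoc, ← h4]
    refine h5.trans ?_
    gcongr
  refine le_of_forall_pos_le_add fun η hη => ?_
  set A := (eLpNorm f 2 μ).toReal with hA
  have hA0 : 0 ≤ A := ENNReal.toReal_nonneg
  refine (hsmall (η / (A + 1)) (by positivity)).trans ?_
  gcongr
  rw [mul_div_assoc', div_le_iff₀ (by positivity)]
  nlinarith

/-- Convolution operators determine their kernel. -/
theorem ae_eq_zero_of_convOp_eq_zero {f : G → ℂ} (hf : Integrable f μ)
    (hf2 : MemLp f 2 μ) (h : convOp f hf = 0) : f =ᵐ[μ] 0 := by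
  set F : Lp ℂ 2 μ := hf2.toLp f with hF
  have hFf : F =ᵐ[μ] f := hf2.coeFn_toLp
  set F' : Lp ℂ 2 μ := hf2.convStar.toLp _ with hF'
  have hFf' : F' =ᵐ[μ] convStar f := hf2.convStar.coeFn_toLp
  have hfact : Fact ((2 : ℝ≥0∞) ≠ ∞) := ⟨ENNReal.ofNat_ne_top⟩
  -- `R x` is the left translate of f by x. The pairing of `R x` with f is the value at x of f
  -- convolved with its involution; it is continuous in x and vanishes almost everywhere, hence
  -- everywhere, and at x = 1 it equals ‖f‖₂².
  let R : G → Lp ℂ 2 μ := fun x => DomMulAct.mk x⁻¹ • F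
  have hRcont : Continuous R :=
    (DomMulAct.continuous_mk.comp continuous_inv).smul continuous_const
  have hR : ∀ x, R x =ᵐ[μ] fun y => f (x⁻¹ * y) := by
    intro x
    refine (DomMulAct.smul_Lp_ae_eq _ _).trans ?_
    exact (measurePreserving_mul_left μ x⁻¹).quasiMeasurePreserving.ae_eq_comp hFf
  have hzero : ∀ᵐ x ∂μ, inner ℂ (R x) F = 0 := by
    have h1 : convOp f hf F' =ᵐ[μ] 0 := by
      rw [h]
      exact Lp.coeFn_zero ℂ 2 μ
    filter_upwards [(coeFn_convOp hf F').symm.trans h1] with x hx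
    rw [groupConv_congr_right _ hFf', Pi.zero_apply] at hx
    rw [← hx, L2.inner_def, groupConv]
    refine integral_congr_ae ?_
    filter_upwards [hFf, hR x] with y h₁ h₂
    rw [h₁, h₂]
    simp [convStar]
  have hcont : Continuous fun x => inner ℂ (R x) F := hRcont.inner continuous_const
  have hall : (fun x => inner ℂ (R x) F) = fun _ => (0 : ℂ) :=
    (hcont.ae_eq_iff_eq μ continuous_const).1 hzero
  have h1 : inner ℂ (R 1) F = 0 := congrFun hall 1
  have hR1 : R 1 = F := by
    simp only [R, inv_one]
    exact one_smul _ F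
  rw [hR1, inner_self_eq_zero] at h1
  rw [h1] at hFf
  exact hFf.symm.trans (Lp.coeFn_zero ℂ 2 μ)

end ConvolutionOperator

/-! ### The dyadic recursion -/

section DyadicRecursion

/-- The logarithm is 2^k (log σ + (k+1)(τ/2)^k log Q), and τ/2 < 1 leaves log σ < 0 as the leading
term. -/
theorem tendsto_pow_two_pow_mul_rpow {σ Q τ : ℝ} (hσ0 : 0 < σ) (hσ1 : σ < 1) (hQ : 1 ≤ Q)
    (hτ0 : 0 ≤ τ) (hτ2 : τ < 2) :
    Tendsto (fun k : ℕ => σ ^ 2 ^ k * Q ^ (((k : ℝ) + 1) * τ ^ k)) atTop (𝓝 0) := by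
  have hQ0 : 0 < Q := one_pos.trans_le hQ
  have heq : ∀ k : ℕ, σ ^ 2 ^ k * Q ^ (((k : ℝ) + 1) * τ ^ k) =
      Real.exp (2 ^ k * (Real.log σ + (k * (τ / 2) ^ k + (τ / 2) ^ k) * Real.log Q)) := by
    intro k
    rw [Real.rpow_def_of_pos hQ0, ← Real.exp_log (pow_pos hσ0 (2 ^ k)), Real.log_pow,
      ← Real.exp_add]
    congr 1
    push_cast
    rw [div_pow]
    field_simp
  simp only [heq]
  refine Real.tendsto_exp_atBot.comp ?_
  have h1 : Tendsto (fun k : ℕ => Real.log σ + (k * (τ / 2) ^ k + (τ / 2) ^ k) * Real.log Q)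
      atTop (𝓝 (Real.log σ)) := by
    have ha := tendsto_self_mul_const_pow_of_lt_one (r := τ / 2) (by positivity) (by linarith)
    have hb := tendsto_pow_atTop_nhds_zero_of_lt_one (r := τ / 2) (by positivity) (by linarith)
    have := ((ha.add hb).mul_const (Real.log Q)).const_add (Real.log σ)
    simpa using this
  exact (tendsto_pow_atTop_atTop_of_one_lt one_lt_two).atTop_mul_neg (Real.log_neg hσ0 hσ1) h1

/-- A quantitative form of the spectral radius estimate coming from a differential norm
inequality, along powers of two. -/
theorem exists_dyadic_small {C R R' ρ θ ε : ℝ} (hC : 0 ≤ C) (hR : 0 ≤ R) (hR' : 0 ≤ R')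
    (hρ0 : 0 < ρ) (hρ1 : ρ < 1) (hθ0 : 0 < θ) (hθ1 : θ < 1) (hε : 0 < ε) :
    ∃ k : ℕ, ∀ X Y : ℕ → ℝ, (∀ k, 0 ≤ X k) → (∀ k, 0 ≤ Y k) → X 0 ≤ R →
      (∀ k, Y k ≤ 2 ^ k * ρ ^ 2 ^ k * R') →
      (∀ k, X (k + 1) ≤ C * (X k ^ (1 - θ) * X k * Y k ^ θ) + 2 * ρ ^ 2 ^ k * X k) →
      X k + Y k + ρ ^ 2 ^ k ≤ ε := by
  -- Half of the decay ρ^(2^k) = σ^(2^k) σ^(2^k) absorbs the factor 2^k in the bound on Y; the other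
  -- half normalizes X.
  set σ := Real.sqrt ρ with hσ
  have hσ0 : 0 < σ := Real.sqrt_pos.2 hρ0
  have hσ1 : σ < 1 := by
    rw [hσ, Real.sqrt_lt' one_pos]
    simpa using hρ1
  have hσρ : σ * σ = ρ := Real.mul_self_sqrt hρ0.le
  have h2k : Tendsto (fun k : ℕ => 2 ^ k) atTop atTop :=
    tendsto_pow_atTop_atTop_of_one_lt (one_lt_two (α := ℕ))
  obtain ⟨D₀, hD₀⟩ : ∃ D₀ : ℝ, ∀ k : ℕ, (2 : ℝ) ^ k * σ ^ 2 ^ k ≤ D₀ := by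
    obtain ⟨D₀, hD₀⟩ := (tendsto_self_mul_const_pow_of_lt_one hσ0.le hσ1).bddAbove_range
    refine ⟨D₀, fun k => ?_⟩
    have := hD₀ ⟨2 ^ k, rfl⟩
    push_cast at this
    exact this
  have hD₀0 : 0 ≤ D₀ := le_trans (by positivity) (hD₀ 0)
  set D := D₀ * R' with hD
  have hD0 : 0 ≤ D := by positivity
  -- Of the 3, two come from the term 2ρ^(2^k) X k and one from the summand 1 in 1 + X k / σ^(2^k).
  set E := C * D ^ θ + 3 with hE
  set Q := max E (1 + R / σ) with hQ
  have hQ1 : 1 ≤ Q := by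
    refine le_trans ?_ (le_max_right _ _)
    have : 0 ≤ R / σ := by positivity
    linarith
  have hQ0 : 0 < Q := one_pos.trans_le hQ1
  set τ := 2 - θ with hτ
  have hlim := tendsto_pow_two_pow_mul_rpow hσ0 hσ1 hQ1 (by linarith : 0 ≤ τ) (by linarith : τ < 2)
  have hlim2 : Tendsto (fun k : ℕ => (2 : ℝ) ^ k * ρ ^ 2 ^ k * R') atTop (𝓝 0) := by
    have := ((tendsto_self_mul_const_pow_of_lt_one hρ0.le hρ1).comp h2k).mul_const R'
    simpa [Function.comp_def] using this
  have hlim3 : Tendsto (fun k : ℕ => ρ ^ 2 ^ k) atTop (𝓝 0) :=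
    (tendsto_pow_atTop_nhds_zero_of_lt_one hρ0.le hρ1).comp h2k
  have hsum := (hlim.add hlim2).add hlim3
  rw [add_zero, add_zero] at hsum
  obtain ⟨k, hk⟩ := (hsum.eventually (ge_mem_nhds hε)).exists
  refine ⟨k, fun X Y hX hY hX0 hYle hrec => le_trans ?_ hk⟩
  -- With v k = 1 + X k / σ^(2^k) the recursion becomes v (k+1) ≤ E (v k)^τ. The summand 1 lets the
  -- linear term be dominated by the τ-th power.
  have hv : ∀ k, 1 + X k / σ ^ 2 ^ k ≤ Q ^ (((k : ℝ) + 1) * τ ^ k) := by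
    intro k
    induction k with
    | zero =>
      simp only [pow_zero, pow_one, Nat.cast_zero, zero_add, mul_one, Real.rpow_one]
      refine le_trans ?_ (le_max_right _ _)
      gcongr
    | succ k ih =>
      set S := σ ^ 2 ^ k with hS
      have hS0 : 0 < S := by positivity
      have hS1 : S ≤ 1 := pow_le_one₀ hσ0.le hσ1.le
      have hSS : ρ ^ 2 ^ k = S * S := by rw [hS, ← mul_pow, hσρ]
      have hS2 : σ ^ 2 ^ (k + 1) = S * S := by rw [hS, ← pow_add, pow_succ, mul_two]
      set x := X k / S with hx
      have hx0 : 0 ≤ x := div_nonneg (hX k) hS0.le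
      have hXx : X k = S * x := by rw [hx]; field_simp
      have hYk : Y k ≤ S * D := by
        refine (hYle k).trans ?_
        rw [hSS, hD]
        calc 2 ^ k * (S * S) * R' = S * (2 ^ k * S * R') := by ring
          _ ≤ S * (D₀ * R') := by
            gcongr
            exact hD₀ k
      have hv1 : 1 ≤ 1 + x := by linarith
      have hv0 : 0 < 1 + x := by linarith
      have hX1 : X (k + 1) ≤ S * S * ((C * D ^ θ + 2) * (1 + x) ^ τ) := by
        have h1 : X k ^ (1 - θ) * X k * Y k ^ θ ≤ S * S * (D ^ θ * (1 + x) ^ τ) := by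
          calc X k ^ (1 - θ) * X k * Y k ^ θ
              ≤ (S * x) ^ (1 - θ) * (S * x) * (S * D) ^ θ := by
                rw [hXx]
                have := Real.rpow_le_rpow (hY k) hYk hθ0.le
                gcongr
            _ = S * (S ^ (1 - θ) * S ^ θ) * (D ^ θ * (x ^ (1 - θ) * x)) := by
                rw [Real.mul_rpow hS0.le hx0, Real.mul_rpow hS0.le hD0]
                ring
            _ = S * S * (D ^ θ * (x ^ (1 - θ) * x)) := by
                rw [← Real.rpow_add hS0, sub_add_cancel, Real.rpow_one]
            _ ≤ S * S * (D ^ θ * ((1 + x) ^ (1 - θ) * (1 + x))) := by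
                have : x ^ (1 - θ) ≤ (1 + x) ^ (1 - θ) :=
                  Real.rpow_le_rpow hx0 (by linarith) (by linarith)
                gcongr
                linarith
            _ = S * S * (D ^ θ * (1 + x) ^ τ) := by
                nth_rewrite 2 [← Real.rpow_one (1 + x)]
                rw [← Real.rpow_add hv0, hτ]
                ring_nf
        have h2 : 2 * ρ ^ 2 ^ k * X k ≤ S * S * (2 * (1 + x) ^ τ) := by
          rw [hSS, hXx]
          have h3 : 1 + x ≤ (1 + x) ^ τ := by
            nth_rewrite 1 [← Real.rpow_one (1 + x)]
            exact Real.rpow_le_rpow_of_exponent_le hv1 (by linarith)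
          calc 2 * (S * S) * (S * x) = S * S * (2 * (S * x)) := by ring
            _ ≤ S * S * (2 * (1 * (1 + x) ^ τ)) := by
              gcongr
              linarith
            _ = _ := by ring
        calc X (k + 1) ≤ C * (X k ^ (1 - θ) * X k * Y k ^ θ) + 2 * ρ ^ 2 ^ k * X k := hrec k
          _ ≤ C * (S * S * (D ^ θ * (1 + x) ^ τ)) + S * S * (2 * (1 + x) ^ τ) :=
              add_le_add (mul_le_mul_of_nonneg_left h1 hC) h2
          _ = _ := by ring
      have h1τ : 1 ≤ (1 + x) ^ τ := Real.one_le_rpow hv1 (by linarith)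
      have hstep : 1 + X (k + 1) / σ ^ 2 ^ (k + 1) ≤ E * (1 + x) ^ τ := by
        rw [hS2]
        have : X (k + 1) / (S * S) ≤ (C * D ^ θ + 2) * (1 + x) ^ τ := by
          rw [div_le_iff₀ (by positivity)]
          linarith
        rw [hE]
        linarith
      have h1τk : (1 : ℝ) ≤ τ ^ (k + 1) := one_le_pow₀ (by linarith)
      calc 1 + X (k + 1) / σ ^ 2 ^ (k + 1) ≤ E * (1 + x) ^ τ := hstep
        _ ≤ Q * (Q ^ (((k : ℝ) + 1) * τ ^ k)) ^ τ := by
            have := Real.rpow_le_rpow hv0.le ih (by linarith : 0 ≤ τ)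
            have := le_max_left E (1 + R / σ)
            gcongr
        _ = Q ^ (1 + ((k : ℝ) + 1) * τ ^ (k + 1)) := by
            rw [← Real.rpow_mul hQ0.le, Real.rpow_add hQ0, Real.rpow_one, pow_succ]
            ring_nf
        _ ≤ Q ^ ((((k + 1 : ℕ) : ℝ) + 1) * τ ^ (k + 1)) := by
            refine Real.rpow_le_rpow_of_exponent_le hQ1 ?_
            push_cast
            linarith
  have hS0 : 0 < σ ^ 2 ^ k := by positivity
  have hXk : X k ≤ σ ^ 2 ^ k * Q ^ (((k : ℝ) + 1) * τ ^ k) := by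
    have h1 := hv k
    have h2 : X k = σ ^ 2 ^ k * (X k / σ ^ 2 ^ k) := by field_simp
    rw [h2]
    gcongr
    linarith
  exact add_le_add (add_le_add hXk (hYle k)) le_rfl

end DyadicRecursion

/-! ### Inversion through a Neumann series grouped by powers -/

section NormControl

variable {H : Type*} [NormedAddCommGroup H] [InnerProductSpace ℂ H] [CompleteSpace H]

/-- Expand ‖x - β⁻¹A∗Ax‖²: the cross term is -2β⁻¹‖Ax‖², the last term is at most β⁻¹‖Ax‖² as ‖A‖² ≤
β, and ‖x‖ ≤ τ‖Ax‖ by the left inverse. The square root appears because the square of the norm is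
estimated, with no spectral theory. -/
theorem norm_one_sub_smul_adjoint_mul_self_le {A T : H →L[ℂ] H} (hTA : T * A = 1) {β τ : ℝ}
    (hβ : 0 < β) (hAβ : ‖A‖ ^ 2 ≤ β) (hτ : 0 < τ) (hT : ‖T‖ ≤ τ) (hβτ : 1 ≤ β * τ ^ 2) :
    ‖1 - ((β⁻¹ : ℝ) : ℂ) • (ContinuousLinearMap.adjoint A * A)‖ ≤
      Real.sqrt (1 - (β * τ ^ 2)⁻¹) := by
  refine ContinuousLinearMap.opNorm_le_bound _ (Real.sqrt_nonneg _) fun x => ?_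
  have hnn : 0 ≤ 1 - (β * τ ^ 2)⁻¹ := sub_nonneg.2 (inv_le_one_of_one_le₀ hβτ)
  rw [← Real.sqrt_sq (norm_nonneg x), ← Real.sqrt_mul hnn]
  refine Real.le_sqrt_of_sq_le ?_
  set y := ContinuousLinearMap.adjoint A (A x) with hy
  have hc : (1 - ((β⁻¹ : ℝ) : ℂ) • (ContinuousLinearMap.adjoint A * A)) x =
      x - ((β⁻¹ : ℝ) : ℂ) • y := by
    simp [hy]
  have hin : RCLike.re (inner ℂ x (((β⁻¹ : ℝ) : ℂ) • y)) = β⁻¹ * ‖A x‖ ^ 2 := by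
    rw [inner_smul_right, hy, ContinuousLinearMap.adjoint_inner_right,
      inner_self_eq_norm_sq_to_K]
    rw [RCLike.re_to_complex, Complex.re_ofReal_mul]
    norm_cast
  have hy2 : ‖((β⁻¹ : ℝ) : ℂ) • y‖ ^ 2 ≤ β⁻¹ * ‖A x‖ ^ 2 := by
    have h1 : ‖y‖ ≤ ‖A‖ * ‖A x‖ := by
      have := (ContinuousLinearMap.adjoint A).le_opNorm (A x)
      rwa [LinearIsometryEquiv.norm_map] at this
    rw [norm_smul, Complex.norm_real, Real.norm_of_nonneg (inv_nonneg.2 hβ.le), mul_pow]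
    calc β⁻¹ ^ 2 * ‖y‖ ^ 2 ≤ β⁻¹ ^ 2 * (‖A‖ * ‖A x‖) ^ 2 := by gcongr
      _ = β⁻¹ ^ 2 * (‖A‖ ^ 2 * ‖A x‖ ^ 2) := by rw [mul_pow]
      _ ≤ β⁻¹ ^ 2 * (β * ‖A x‖ ^ 2) := by gcongr
      _ = β⁻¹ * ‖A x‖ ^ 2 := by field_simp
  have hlow : ‖x‖ ^ 2 ≤ τ ^ 2 * ‖A x‖ ^ 2 := by
    have h1 : ‖x‖ ≤ τ * ‖A x‖ := by
      have h2 : x = T (A x) := by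
        rw [← mul_apply_eq_comp, hTA, one_apply_eq_self]
      calc ‖x‖ = ‖T (A x)‖ := by rw [← h2]
        _ ≤ ‖T‖ * ‖A x‖ := T.le_opNorm _
        _ ≤ τ * ‖A x‖ := by gcongr
    calc ‖x‖ ^ 2 ≤ (τ * ‖A x‖) ^ 2 := by gcongr
      _ = _ := mul_pow _ _ _
  have hlow2 : (β * τ ^ 2)⁻¹ * ‖x‖ ^ 2 ≤ β⁻¹ * ‖A x‖ ^ 2 := by
    rw [mul_inv, mul_assoc]
    gcongr
    rw [inv_mul_le_iff₀ (by positivity)]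
    exact hlow
  rw [hc, norm_sub_sq (𝕜 := ℂ), hin]
  linarith

/-- Norm-controlled inversion for a family `P R` of "balls of radius `R`" of operators which is
stable under the algebra operations, adjoints and absolutely convergent series, and in which large
powers of strict contractions are small. -/
theorem exists_ball_inverse {P : ℝ → (H →L[ℂ] H) → Prop} {K : ℝ} (hK : 1 ≤ K)
    (hadd : ∀ R R' S T, P R S → P R' T → P (R + R') (S + T))
    (hsmul : ∀ R T (c : ℂ), P R T → P (‖c‖ * R) (c • T))
    (hmul : ∀ R R' S T, P R S → P R' T → P (K * R * R') (S * T))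
    (hone : P 1 1)
    (hadj : ∀ R T, P R T → P R (ContinuousLinearMap.adjoint T))
    (hbound : ∀ R T, P R T → ‖T‖ ≤ K * R)
    (hsum : ∀ (r : ℕ → ℝ) (T : ℕ → H →L[ℂ] H) (S : H →L[ℂ] H), Summable r →
      (∀ n, P (r n) (T n)) → HasSum T S → P (∑' n, r n) S)
    (hpow : ∀ R ρ ε, 0 < ρ → ρ < 1 → 0 < ε → ∃ k : ℕ, ∀ T, P R T → ‖T‖ ≤ ρ → P ε (T ^ 2 ^ k))
    (α τ : ℝ) :
    ∃ C, ∀ A T, P α A → ‖T‖ ≤ τ → A * T = 1 → T * A = 1 → P C T := by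
  -- The summand 2 ensures β > 1 and hence ρ > 0, whatever α is. The numbers α and τ are arbitrary
  -- reals; `τ'` replaces τ by a number at least 1.
  set β := (K * α) ^ 2 + 2 with hβ
  set τ' := max τ 1 with hτ'
  have hβ0 : 0 < β := by positivity
  have hβ1 : 1 < β := by
    have := sq_nonneg (K * α)
    linarith
  have hτ1 : 1 ≤ τ' := le_max_right _ _
  have hτ0 : 0 < τ' := one_pos.trans_le hτ1
  have hβτ : 1 < β * τ' ^ 2 := by
    have : 1 ≤ τ' ^ 2 := one_le_pow₀ hτ1
    nlinarith
  set ρ := Real.sqrt (1 - (β * τ' ^ 2)⁻¹) with hρ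
  have hinv1 : (β * τ' ^ 2)⁻¹ < 1 := inv_lt_one_of_one_lt₀ hβτ
  have hinv0 : 0 < (β * τ' ^ 2)⁻¹ := by positivity
  have hρ0 : 0 < ρ := Real.sqrt_pos.2 (by linarith)
  have hρ1 : ρ < 1 := by
    rw [hρ, Real.sqrt_lt' one_pos]
    linarith
  have hK0 : 0 < K := one_pos.trans_le hK
  set R := 1 + ‖-((β⁻¹ : ℝ) : ℂ)‖ * (K * α * α) with hR
  -- With radius 1/(2K) for q = c^(2^k), each multiplication by q halves the radius: K · r · 1/(2K)
  -- = r/2.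
  obtain ⟨k, hk⟩ := hpow R ρ (1 / (2 * K)) hρ0 hρ1 (by positivity)
  let rad : ℕ → ℝ := fun j => Nat.rec 1 (fun _ a => K * a * R) j
  let r : ℕ → ℝ := fun j => (1 / 2) ^ j
  have hr : Summable r := summable_geometric_two
  -- The radius of T = β⁻¹ Γ S A∗, where S is the sum of c^j over j < 2^k, Γ is the sum of all q^j,
  -- and ΓS inverts 1 - c = β⁻¹A∗A. The summand ‖0‖ · 1 is the radius of the empty sum, obtained as
  -- 0 • 1.
  refine ⟨‖((β⁻¹ : ℝ) : ℂ)‖ * (K * (K * (∑' n, r n) *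
    (∑ j ∈ Finset.range (2 ^ k), rad j + ‖(0 : ℂ)‖ * 1)) * α), fun A T hA hT hAT hTA => ?_⟩
  set A' := ContinuousLinearMap.adjoint A with hA'
  set c := 1 - ((β⁻¹ : ℝ) : ℂ) • (A' * A) with hc
  have hAβ : ‖A‖ ^ 2 ≤ β := by
    have h1 := hbound _ _ hA
    have h2 : ‖A‖ ^ 2 ≤ (K * α) ^ 2 := by gcongr
    linarith
  have hcρ : ‖c‖ ≤ ρ := norm_one_sub_smul_adjoint_mul_self_le hTA hβ0 hAβ hτ0
    (hT.trans (le_max_left _ _)) hβτ.le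
  have hcR : P R c := by
    have h1 := hadd _ _ _ _ hone (hsmul _ _ (-((β⁻¹ : ℝ) : ℂ)) (hmul _ _ _ _ (hadj _ _ hA) hA))
    have h2 : 1 + (-((β⁻¹ : ℝ) : ℂ)) • (ContinuousLinearMap.adjoint A * A) = c := by
      rw [hc, neg_smul, sub_eq_add_neg]
    rwa [h2] at h1
  set q := c ^ 2 ^ k with hq
  have hqP : P (1 / (2 * K)) q := hk c hcR hcρ
  have hcpow : ∀ j, P (rad j) (c ^ j) := by
    intro j
    induction j with
    | zero => simpa [rad] using hone
    | succ j ih =>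
      rw [pow_succ]
      exact hmul _ _ _ _ ih hcR
  have hS : ∀ n, P (∑ j ∈ Finset.range n, rad j + ‖(0 : ℂ)‖ * 1)
      (∑ j ∈ Finset.range n, c ^ j) := by
    intro n
    induction n with
    | zero => simpa using hsmul _ _ (0 : ℂ) hone
    | succ n ih =>
      rw [Finset.sum_range_succ, Finset.sum_range_succ, add_right_comm]
      exact hadd _ _ _ _ ih (hcpow n)
  have hqpow : ∀ j, P (r j) (q ^ j) := by
    intro j
    induction j with
    | zero => simpa [r] using hone
    | succ j ih =>
      rw [pow_succ]
      have h1 := hmul _ _ _ _ ih hqP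
      have h2 : K * r j * (1 / (2 * K)) = r (j + 1) := by
        simp only [r, pow_succ]
        field_simp
      rwa [h2] at h1
  have hq1 : ‖q‖ < 1 := by
    rcases Nat.eq_zero_or_pos (2 ^ k) with h0 | h0
    · exact absurd h0 (by positivity)
    · calc ‖q‖ ≤ ‖c‖ ^ 2 ^ k := norm_pow_le' c h0
        _ ≤ ρ ^ 2 ^ k := by gcongr
        _ < 1 := pow_lt_one₀ hρ0.le hρ1 h0.ne'
  have hgs : Summable fun j => q ^ j := summable_geometric_of_norm_lt_one hq1
  set Γ := ∑' j, q ^ j with hΓ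
  have hΓP : P (∑' n, r n) Γ := hsum r _ Γ hr hqpow hgs.hasSum
  set S := ∑ j ∈ Finset.range (2 ^ k), c ^ j with hSdef
  have hΓq : Γ * (1 - q) = 1 := geom_series_mul_neg q hq1
  have hSc : S * (1 - c) = 1 - q := geom_sum_mul_neg c (2 ^ k)
  have hcT : (1 - c) * ((β : ℂ) • T) = A' := by
    have h1 : 1 - c = ((β⁻¹ : ℝ) : ℂ) • (A' * A) := by rw [hc, sub_sub_cancel]
    have hβc : (β : ℂ) ≠ 0 := by exact_mod_cast hβ0.ne'
    rw [h1, smul_mul_smul_comm, mul_assoc, hAT, mul_one]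
    push_cast
    rw [inv_mul_cancel₀ hβc, one_smul]
  have hfinal : ((β⁻¹ : ℝ) : ℂ) • (Γ * S * A') = T := by
    have hβc : (β : ℂ) ≠ 0 := by exact_mod_cast hβ0.ne'
    rw [← hcT, ← mul_assoc, mul_assoc Γ S, hSc, hΓq, one_mul, smul_smul]
    push_cast
    rw [inv_mul_cancel₀ hβc, one_smul]
  rw [← hfinal]
  exact hsmul _ _ _ (hmul _ _ _ _ (hmul _ _ _ _ hΓP (hS _)) (hadj _ _ hA))

end NormControl

/-! ### The unitization: norm, product, involution, action -/

section WeightedUnitization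

/-- The estimates for convolution on `L^p(G, ω) ∩ L²(G)`: the embedding into `L¹` and the
differential norm inequality. -/
structure HasWeightedConvBounds {G : Type*} [Group G] [MeasurableSpace G] (μ : Measure G)
    (p : ℝ≥0∞) (ω : G → ℝ) (θ C₁ C₂ : ℝ) : Prop where
  measurable : Measurable ω
  map_inv : ∀ x, ω x⁻¹ = ω x
  pos : 0 < θ
  lt_one : θ < 1
  nonneg₁ : 0 ≤ C₁
  nonneg₂ : 0 ≤ C₂
  eLpNorm_one_le : ∀ f : G → ℂ, AEStronglyMeasurable f μ →
    eLpNorm f 1 μ ≤ ENNReal.ofReal C₁ * weightedENorm μ p ω f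
  weightedENorm_le : ∀ f g : G → ℂ, AEStronglyMeasurable f μ → AEStronglyMeasurable g μ →
    weightedENorm μ p ω (groupConv μ f g) ≤ ENNReal.ofReal C₂ *
      (weightedENorm μ p ω f ^ (1 - θ) * eLpNorm f 2 μ ^ θ * weightedENorm μ p ω g +
        weightedENorm μ p ω f * (weightedENorm μ p ω g ^ (1 - θ) * eLpNorm g 2 μ ^ θ))

section Norm

variable {G : Type*} [MeasurableSpace G] {μ : Measure G} {p : ℝ≥0∞} {ω : G → ℝ}

theorem memLp_weightedInter (f : weightedInter μ p ω) :
    MemLp (fun x => (ω x : ℂ) * (f : Lp ℂ 2 μ) x) p μ :=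
  f.2

/-- The multiplication by `ω`, from `L^p(G, ω) ∩ L²(G)` to `L^p(G)`. -/
noncomputable def weightMul (μ : Measure G) (p : ℝ≥0∞) (ω : G → ℝ) :
    weightedInter μ p ω →ₗ[ℂ] Lp ℂ p μ where
  toFun f := (memLp_weightedInter f).toLp _
  map_add' f g := by
    rw [← MemLp.toLp_add, MemLp.toLp_eq_toLp_iff]
    filter_upwards [Lp.coeFn_add (f : Lp ℂ 2 μ) g] with x hx
    rw [Submodule.coe_add, hx, Pi.add_apply, Pi.add_apply, mul_add]
  map_smul' c f := by
    rw [RingHom.id_apply, ← MemLp.toLp_const_smul, MemLp.toLp_eq_toLp_iff]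
    filter_upwards [Lp.coeFn_smul c (f : Lp ℂ 2 μ)] with x hx
    rw [Submodule.coe_smul, hx, Pi.smul_apply, Pi.smul_apply, smul_eq_mul, smul_eq_mul,
      mul_left_comm]

theorem coeFn_weightMul (f : weightedInter μ p ω) :
    weightMul μ p ω f =ᵐ[μ] fun x => (ω x : ℂ) * (f : Lp ℂ 2 μ) x :=
  MemLp.coeFn_toLp (memLp_weightedInter f)

theorem norm_weightMul (f : weightedInter μ p ω) :
    ‖weightMul μ p ω f‖ = (weightedENorm μ p ω (f : Lp ℂ 2 μ)).toReal :=
  Lp.norm_toLp _ (memLp_weightedInter f)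

theorem weightedInterNorm_eq (f : weightedInter μ p ω) :
    weightedInterNorm f = max ‖weightMul μ p ω f‖ ‖f‖ := by
  rw [norm_weightMul]
  rfl

theorem ofReal_norm_weightMul (f : weightedInter μ p ω) :
    ENNReal.ofReal ‖weightMul μ p ω f‖ = weightedENorm μ p ω (f : Lp ℂ 2 μ) := by
  rw [norm_weightMul]
  exact ENNReal.ofReal_toReal f.2.eLpNorm_ne_top

theorem ofReal_norm_eq_eLpNorm (f : Lp ℂ 2 μ) : ENNReal.ofReal ‖f‖ = eLpNorm f 2 μ := by
  rw [Lp.norm_def]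
  exact ENNReal.ofReal_toReal (Lp.eLpNorm_ne_top f)

theorem weightedInterNorm_nonneg (f : weightedInter μ p ω) : 0 ≤ weightedInterNorm f := by
  rw [weightedInterNorm_eq]
  exact le_max_of_le_right (norm_nonneg _)

theorem norm_weightMul_le (f : weightedInter μ p ω) :
    ‖weightMul μ p ω f‖ ≤ weightedInterNorm f := by
  rw [weightedInterNorm_eq]
  exact le_max_left _ _

theorem norm_le_weightedInterNorm (f : weightedInter μ p ω) : ‖f‖ ≤ weightedInterNorm f :=
  le_max_right _ _

theorem weightedInterNorm_le_iff (f : weightedInter μ p ω) {R : ℝ} :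
    weightedInterNorm f ≤ R ↔ ‖weightMul μ p ω f‖ ≤ R ∧ ‖f‖ ≤ R := by
  rw [weightedInterNorm_eq, max_le_iff]

theorem weightedInterNorm_add_le [Fact (1 ≤ p)] (f g : weightedInter μ p ω) :
    weightedInterNorm (f + g) ≤ weightedInterNorm f + weightedInterNorm g := by
  rw [weightedInterNorm_le_iff, map_add]
  exact ⟨(norm_add_le _ _).trans (add_le_add (norm_weightMul_le f) (norm_weightMul_le g)),
    (norm_add_le _ _).trans
      (add_le_add (norm_le_weightedInterNorm f) (norm_le_weightedInterNorm g))⟩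

theorem weightedInterNorm_smul [Fact (1 ≤ p)] (c : ℂ) (f : weightedInter μ p ω) :
    weightedInterNorm (c • f) = ‖c‖ * weightedInterNorm f := by
  rw [weightedInterNorm_eq, weightedInterNorm_eq, map_smul, norm_smul, norm_smul,
    mul_max_of_nonneg _ _ (norm_nonneg c)]

theorem weightedUnitizationNorm_nonneg (a : WeightedUnitization μ p ω) :
    0 ≤ weightedUnitizationNorm a :=
  add_nonneg (weightedInterNorm_nonneg _) (norm_nonneg _)

theorem weightedUnitizationNorm_add_le [Fact (1 ≤ p)] (a b : WeightedUnitization μ p ω) :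
    weightedUnitizationNorm (a + b) ≤ weightedUnitizationNorm a + weightedUnitizationNorm b := by
  have h1 := weightedInterNorm_add_le a.1 b.1
  have h2 := norm_add_le a.2 b.2
  simp only [weightedUnitizationNorm, Prod.fst_add, Prod.snd_add]
  linarith

theorem weightedUnitizationNorm_smul [Fact (1 ≤ p)] (c : ℂ) (a : WeightedUnitization μ p ω) :
    weightedUnitizationNorm (c • a) = ‖c‖ * weightedUnitizationNorm a := by
  simp only [weightedUnitizationNorm, Prod.smul_fst, Prod.smul_snd, weightedInterNorm_smul,
    norm_smul]
  ring

theorem weightedUnitizationNorm_one [Fact (1 ≤ p)] :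
    weightedUnitizationNorm ((0, 1) : WeightedUnitization μ p ω) = 1 := by
  simp [weightedUnitizationNorm, weightedInterNorm_eq]

/-- `L^p(G, ω) ∩ L²(G)` is complete. -/
theorem exists_hasSum_weightMul [Fact (1 ≤ p)] {f : ℕ → weightedInter μ p ω}
    (hf : Summable fun n => weightedInterNorm (f n)) :
    ∃ F : weightedInter μ p ω, HasSum (fun n => weightMul μ p ω (f n)) (weightMul μ p ω F) ∧
      weightedInterNorm F ≤ ∑' n, weightedInterNorm (f n) := by
  have hs2 : Summable fun n => ((f n : weightedInter μ p ω) : Lp ℂ 2 μ) :=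
    Summable.of_norm_bounded hf fun n => norm_le_weightedInterNorm (f n)
  have hsp : Summable fun n => weightMul μ p ω (f n) :=
    Summable.of_norm_bounded hf fun n => norm_weightMul_le (f n)
  set F := ∑' n, ((f n : weightedInter μ p ω) : Lp ℂ 2 μ) with hF
  set W := ∑' n, weightMul μ p ω (f n) with hW
  let S : ℕ → weightedInter μ p ω := fun n => ∑ i ∈ Finset.range n, f i
  have h2 : Tendsto (fun n => ((S n : weightedInter μ p ω) : Lp ℂ 2 μ)) atTop (𝓝 F) := by
    have := hs2.hasSum.tendsto_sum_nat
    simpa only [S, Submodule.coe_sum] using this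
  have hp : Tendsto (fun n => weightMul μ p ω (S n)) atTop (𝓝 W) := by
    have := hsp.hasSum.tendsto_sum_nat
    simpa only [S, map_sum] using this
  -- Along a common subsequence the partial sums converge almost everywhere both in L² and after
  -- multiplication by ω, which identifies the L^p limit W with ωF.
  obtain ⟨n₁, hn₁, h2'⟩ := (tendstoInMeasure_of_tendsto_Lp h2).exists_seq_tendsto_ae
  obtain ⟨n₂, hn₂, hp'⟩ := (tendstoInMeasure_of_tendsto_Lp
    (hp.comp hn₁.tendsto_atTop)).exists_seq_tendsto_ae
  have hall : ∀ᵐ x ∂μ, ∀ n, weightMul μ p ω (S n) x = (ω x : ℂ) * (S n : Lp ℂ 2 μ) x :=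
    ae_all_iff.2 fun n => coeFn_weightMul (S n)
  have hWF : (fun x => (ω x : ℂ) * F x) =ᵐ[μ] W := by
    filter_upwards [h2', hp', hall] with x h2x hpx hx
    refine tendsto_nhds_unique ((h2x.comp hn₂.tendsto_atTop).const_mul (ω x : ℂ)) ?_
    refine hpx.congr fun k => ?_
    exact hx _
  have hmem : F ∈ weightedInter μ p ω := (memLp_congr_ae hWF).2 (Lp.memLp W)
  have hWeq : weightMul μ p ω ⟨F, hmem⟩ = W :=
    Lp.ext ((coeFn_weightMul _).trans hWF)
  refine ⟨⟨F, hmem⟩, ?_, ?_⟩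
  · rw [hWeq]
    exact hsp.hasSum
  · rw [weightedInterNorm_le_iff, hWeq]
    exact ⟨tsum_of_norm_bounded hf.hasSum fun n => norm_weightMul_le (f n),
      tsum_of_norm_bounded (f := fun n => (f n : Lp ℂ 2 μ)) hf.hasSum
        fun n => norm_le_weightedInterNorm (f n)⟩

end Norm

namespace HasWeightedConvBounds

variable {G : Type*} [Group G] [TopologicalSpace G] [IsTopologicalGroup G]
    [LocallyCompactSpace G] [MeasurableSpace G] [BorelSpace G]
    {μ : Measure G} [μ.IsHaarMeasure] [μ.Regular] [SigmaFinite μ] [μ.IsInvInvariant]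
    {p : ℝ≥0∞} [Fact (1 ≤ p)] {ω : G → ℝ} {θ C₁ C₂ : ℝ}

theorem eLpNorm_one_le_ofReal (H : HasWeightedConvBounds μ p ω θ C₁ C₂) (f : weightedInter μ p ω) :
    eLpNorm (f : Lp ℂ 2 μ) 1 μ ≤ ENNReal.ofReal (C₁ * ‖weightMul μ p ω f‖) := by
  rw [ENNReal.ofReal_mul H.nonneg₁, ofReal_norm_weightMul]
  exact H.eLpNorm_one_le _ (Lp.aestronglyMeasurable _)

theorem integrable (H : HasWeightedConvBounds μ p ω θ C₁ C₂) (f : weightedInter μ p ω) :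
    Integrable (f : Lp ℂ 2 μ) μ :=
  memLp_one_iff_integrable.1 ⟨Lp.aestronglyMeasurable _,
    (H.eLpNorm_one_le_ofReal f).trans_lt ENNReal.ofReal_lt_top⟩

/-- Left convolution by an element of `L^p(G, ω) ∩ L²(G)`, as an operator on `L²(G)`. -/
noncomputable def convLin (H : HasWeightedConvBounds μ p ω θ C₁ C₂) :
    weightedInter μ p ω →ₗ[ℂ] (Lp ℂ 2 μ →L[ℂ] Lp ℂ 2 μ) where
  toFun f := convOp (f : Lp ℂ 2 μ) (H.integrable f)
  map_add' f g := by
    rw [← convOp_add]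
    exact convOp_congr _ _ (Lp.coeFn_add (f : Lp ℂ 2 μ) g)
  map_smul' c f := by
    rw [RingHom.id_apply, ← convOp_smul]
    exact convOp_congr _ _ (Lp.coeFn_smul c (f : Lp ℂ 2 μ))

theorem convLin_apply (H : HasWeightedConvBounds μ p ω θ C₁ C₂) (f : weightedInter μ p ω) :
    H.convLin f = convOp (f : Lp ℂ 2 μ) (H.integrable f) :=
  rfl

theorem norm_convLin_le (H : HasWeightedConvBounds μ p ω θ C₁ C₂) (f : weightedInter μ p ω) :
    ‖H.convLin f‖ ≤ C₁ * ‖weightMul μ p ω f‖ :=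
  (norm_convOp_le (H.integrable f)).trans (ENNReal.toReal_le_of_le_ofReal
    (mul_nonneg H.nonneg₁ (norm_nonneg _)) (H.eLpNorm_one_le_ofReal f))

theorem convLin_injective (H : HasWeightedConvBounds μ p ω θ C₁ C₂) {f : weightedInter μ p ω}
    (h : H.convLin f = 0) : f = 0 := by
  have h1 := ae_eq_zero_of_convOp_eq_zero (H.integrable f) (Lp.memLp (f : Lp ℂ 2 μ)) h
  exact Subtype.ext (Lp.ext (h1.trans (Lp.coeFn_zero ℂ 2 μ).symm))

theorem weightedENorm_groupConv_le (H : HasWeightedConvBounds μ p ω θ C₁ C₂)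
    (f g : weightedInter μ p ω) :
    weightedENorm μ p ω (groupConv μ (f : Lp ℂ 2 μ) (g : Lp ℂ 2 μ)) ≤ ENNReal.ofReal
      (C₂ * (‖weightMul μ p ω f‖ ^ (1 - θ) * ‖f‖ ^ θ * ‖weightMul μ p ω g‖ +
        ‖weightMul μ p ω f‖ * (‖weightMul μ p ω g‖ ^ (1 - θ) * ‖g‖ ^ θ))) := by
  have h := H.weightedENorm_le _ _ (Lp.aestronglyMeasurable (f : Lp ℂ 2 μ))
    (Lp.aestronglyMeasurable (g : Lp ℂ 2 μ))
  have hθ : 0 ≤ 1 - θ := sub_nonneg.2 H.lt_one.le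
  rw [ENNReal.ofReal_mul H.nonneg₂, ENNReal.ofReal_add (by positivity) (by positivity),
    ENNReal.ofReal_mul (by positivity), ENNReal.ofReal_mul (by positivity),
    ENNReal.ofReal_mul (by positivity), ENNReal.ofReal_mul (by positivity),
    ← ENNReal.ofReal_rpow_of_nonneg (by positivity) hθ,
    ← ENNReal.ofReal_rpow_of_nonneg (by positivity) hθ,
    ← ENNReal.ofReal_rpow_of_nonneg (by positivity) H.pos.le,
    ← ENNReal.ofReal_rpow_of_nonneg (by positivity) H.pos.le,
    ofReal_norm_weightMul, ofReal_norm_weightMul, Submodule.coe_norm, Submodule.coe_norm,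
    ofReal_norm_eq_eLpNorm, ofReal_norm_eq_eLpNorm]
  exact h

/-- Convolution on `L^p(G, ω) ∩ L²(G)`. -/
noncomputable def conv (H : HasWeightedConvBounds μ p ω θ C₁ C₂) (f g : weightedInter μ p ω) :
    weightedInter μ p ω :=
  ⟨H.convLin f g, by
    have h1 := coeFn_convOp (H.integrable f) (g : Lp ℂ 2 μ)
    have h2 : MemLp (fun x => (ω x : ℂ) * groupConv μ (f : Lp ℂ 2 μ) (g : Lp ℂ 2 μ) x) p μ :=
      ⟨(Complex.measurable_ofReal.comp H.measurable).aestronglyMeasurable.mul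
        (AEStronglyMeasurable.groupConv (Lp.aestronglyMeasurable _) (Lp.aestronglyMeasurable _)),
        (H.weightedENorm_groupConv_le f g).trans_lt ENNReal.ofReal_lt_top⟩
    refine (memLp_congr_ae ?_).2 h2
    filter_upwards [h1] with x hx
    rw [convLin_apply, hx]⟩

theorem coe_conv (H : HasWeightedConvBounds μ p ω θ C₁ C₂) (f g : weightedInter μ p ω) :
    (H.conv f g : Lp ℂ 2 μ) = H.convLin f g :=
  rfl

theorem coeFn_conv (H : HasWeightedConvBounds μ p ω θ C₁ C₂) (f g : weightedInter μ p ω) :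
    (H.conv f g : Lp ℂ 2 μ) =ᵐ[μ] groupConv μ (f : Lp ℂ 2 μ) (g : Lp ℂ 2 μ) :=
  coeFn_convOp (H.integrable f) (g : Lp ℂ 2 μ)

theorem convLin_conv (H : HasWeightedConvBounds μ p ω θ C₁ C₂) (f g : weightedInter μ p ω) :
    H.convLin (H.conv f g) = H.convLin f * H.convLin g := by
  rw [convLin_apply, convLin_apply, convLin_apply, ← convOp_groupConv]
  exact convOp_congr _ _ (H.coeFn_conv f g)

theorem norm_weightMul_conv_le (H : HasWeightedConvBounds μ p ω θ C₁ C₂)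
    (f g : weightedInter μ p ω) :
    ‖weightMul μ p ω (H.conv f g)‖ ≤
      C₂ * (‖weightMul μ p ω f‖ ^ (1 - θ) * ‖f‖ ^ θ * ‖weightMul μ p ω g‖ +
        ‖weightMul μ p ω f‖ * (‖weightMul μ p ω g‖ ^ (1 - θ) * ‖g‖ ^ θ)) := by
  have h0 := H.nonneg₂
  rw [norm_weightMul]
  refine ENNReal.toReal_le_of_le_ofReal (by positivity) ?_
  refine le_trans (le_of_eq ?_) (H.weightedENorm_groupConv_le f g)
  refine eLpNorm_congr_ae ?_
  filter_upwards [H.coeFn_conv f g] with x hx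
  rw [hx]

/-- Each interpolated quantity ‖fω‖_p^(1-θ) ‖f‖₂^θ is at most the maximum of the two norms, whence
2C₂ for the weighted part. The L² part costs C₁, through the embedding into L¹. -/
theorem weightedInterNorm_conv_le (H : HasWeightedConvBounds μ p ω θ C₁ C₂)
    (f g : weightedInter μ p ω) :
    weightedInterNorm (H.conv f g) ≤
      (C₁ + 2 * C₂) * weightedInterNorm f * weightedInterNorm g := by
  have h1 := H.nonneg₁
  have h2 := H.nonneg₂
  have hf := weightedInterNorm_nonneg f
  have hg := weightedInterNorm_nonneg g
  have hinterp : ∀ f : weightedInter μ p ω,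
      ‖weightMul μ p ω f‖ ^ (1 - θ) * ‖f‖ ^ θ ≤ weightedInterNorm f := by
    intro f
    calc ‖weightMul μ p ω f‖ ^ (1 - θ) * ‖f‖ ^ θ
        ≤ weightedInterNorm f ^ (1 - θ) * weightedInterNorm f ^ θ :=
          mul_le_mul (Real.rpow_le_rpow (norm_nonneg _) (norm_weightMul_le f)
            (sub_nonneg.2 H.lt_one.le)) (Real.rpow_le_rpow (norm_nonneg _)
            (norm_le_weightedInterNorm f) H.pos.le) (by positivity)
            (Real.rpow_nonneg (weightedInterNorm_nonneg f) _)
      _ = weightedInterNorm f := by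
          rw [← Real.rpow_add_of_nonneg (weightedInterNorm_nonneg f)
            (sub_nonneg.2 H.lt_one.le) H.pos.le, sub_add_cancel, Real.rpow_one]
  rw [weightedInterNorm_le_iff]
  constructor
  · refine (H.norm_weightMul_conv_le f g).trans ?_
    calc C₂ * (‖weightMul μ p ω f‖ ^ (1 - θ) * ‖f‖ ^ θ * ‖weightMul μ p ω g‖ +
          ‖weightMul μ p ω f‖ * (‖weightMul μ p ω g‖ ^ (1 - θ) * ‖g‖ ^ θ))
        ≤ C₂ * (weightedInterNorm f * weightedInterNorm g +
          weightedInterNorm f * weightedInterNorm g) := by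
          gcongr
          · exact hinterp f
          · exact norm_weightMul_le g
          · exact norm_weightMul_le f
          · exact hinterp g
      _ = 0 + 2 * C₂ * (weightedInterNorm f * weightedInterNorm g) := by ring
      _ ≤ C₁ * (weightedInterNorm f * weightedInterNorm g) +
          2 * C₂ * (weightedInterNorm f * weightedInterNorm g) := by
          gcongr
          positivity
      _ = _ := by ring
  · rw [Submodule.coe_norm, coe_conv]
    calc ‖H.convLin f g‖ ≤ ‖H.convLin f‖ * ‖g‖ := ContinuousLinearMap.le_opNorm _ _
      _ ≤ C₁ * weightedInterNorm f * weightedInterNorm g := by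
          have := H.norm_convLin_le f
          gcongr
          · exact this.trans (by gcongr; exact norm_weightMul_le f)
          · exact norm_le_weightedInterNorm g
      _ ≤ (C₁ + 2 * C₂) * weightedInterNorm f * weightedInterNorm g := by
          gcongr
          linarith

/-- The product of the unitization. -/
noncomputable def unitMul (H : HasWeightedConvBounds μ p ω θ C₁ C₂)
    (a b : WeightedUnitization μ p ω) : WeightedUnitization μ p ω :=
  (H.conv a.1 b.1 + b.2 • a.1 + a.2 • b.1, a.2 * b.2)

/-- The action of the unitization on `L²(G)`. -/
noncomputable def unitAction (H : HasWeightedConvBounds μ p ω θ C₁ C₂) :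
    WeightedUnitization μ p ω →ₗ[ℂ] (Lp ℂ 2 μ →L[ℂ] Lp ℂ 2 μ) :=
  H.convLin.coprod (LinearMap.toSpanSingleton ℂ _ 1)

theorem unitAction_apply (H : HasWeightedConvBounds μ p ω θ C₁ C₂)
    (a : WeightedUnitization μ p ω) :
    H.unitAction a = H.convLin a.1 + a.2 • (1 : Lp ℂ 2 μ →L[ℂ] Lp ℂ 2 μ) := by
  simp [unitAction]

theorem isUnitizationAction_unitAction (H : HasWeightedConvBounds μ p ω θ C₁ C₂)
    (a : WeightedUnitization μ p ω) : IsUnitizationAction a (H.unitAction a) := by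
  intro g
  rw [unitAction_apply, add_apply, smul_apply, one_apply_eq_self]
  filter_upwards [ae_groupConvExistsAt_Lp (H.integrable a.1) g,
    coeFn_convOp (H.integrable a.1) g, Lp.coeFn_add (H.convLin a.1 g) (a.2 • g),
    Lp.coeFn_smul a.2 g] with x h1 h2 h3 h4
  refine ⟨h1, ?_⟩
  rw [h3, Pi.add_apply, h4, Pi.smul_apply, convLin_apply, h2, smul_eq_mul]

theorem coeFn_unitMul_fst (H : HasWeightedConvBounds μ p ω θ C₁ C₂)
    (a b : WeightedUnitization μ p ω) :
    ∀ᵐ x ∂μ, ((H.unitMul a b).1 : Lp ℂ 2 μ) x =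
      groupConv μ (a.1 : Lp ℂ 2 μ) (b.1 : Lp ℂ 2 μ) x
        + b.2 * (a.1 : Lp ℂ 2 μ) x + a.2 * (b.1 : Lp ℂ 2 μ) x := by
  filter_upwards [H.coeFn_conv a.1 b.1, Lp.coeFn_smul b.2 (a.1 : Lp ℂ 2 μ),
    Lp.coeFn_smul a.2 (b.1 : Lp ℂ 2 μ),
    Lp.coeFn_add (H.conv a.1 b.1 : Lp ℂ 2 μ) (b.2 • (a.1 : Lp ℂ 2 μ)),
    Lp.coeFn_add ((H.conv a.1 b.1 : Lp ℂ 2 μ) + b.2 • (a.1 : Lp ℂ 2 μ))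
      (a.2 • (b.1 : Lp ℂ 2 μ))] with x h1 h2 h3 h4 h5
  simp only [unitMul, Submodule.coe_add, Submodule.coe_smul]
  rw [h5, Pi.add_apply, h4, Pi.add_apply, h1, h2, h3, Pi.smul_apply, Pi.smul_apply, smul_eq_mul,
    smul_eq_mul]

theorem isUnitizationProduct_unitMul (H : HasWeightedConvBounds μ p ω θ C₁ C₂)
    (a b : WeightedUnitization μ p ω) : IsUnitizationProduct a b (H.unitMul a b) := by
  refine ⟨?_, rfl⟩
  filter_upwards [ae_groupConvExistsAt_Lp (H.integrable a.1) (b.1 : Lp ℂ 2 μ),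
    H.coeFn_unitMul_fst a b] with x h1 h2
  exact ⟨h1, h2⟩

theorem eq_unitMul_of_isUnitizationProduct (H : HasWeightedConvBounds μ p ω θ C₁ C₂)
    {a b c : WeightedUnitization μ p ω} (h : IsUnitizationProduct a b c) :
    c = H.unitMul a b := by
  refine Prod.ext (Subtype.ext (Lp.ext ?_)) h.2
  filter_upwards [h.1, H.coeFn_unitMul_fst a b] with x h1 h2
  rw [h1.2, h2]

theorem unitAction_unitMul (H : HasWeightedConvBounds μ p ω θ C₁ C₂)
    (a b : WeightedUnitization μ p ω) :
    H.unitAction (H.unitMul a b) = H.unitAction a * H.unitAction b := by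
  rw [unitAction_apply, unitAction_apply, unitAction_apply]
  simp only [unitMul, map_add, map_smul, convLin_conv, add_mul, mul_add, smul_mul_assoc,
    mul_smul_comm, one_mul, mul_one, smul_smul, smul_add, mul_comm b.2]
  abel

theorem unitAction_one (H : HasWeightedConvBounds μ p ω θ C₁ C₂) : H.unitAction (0, 1) = 1 := by
  rw [unitAction_apply, map_zero, zero_add, one_smul]

theorem norm_snd_le [T2Space G] (H : HasWeightedConvBounds μ p ω θ C₁ C₂)
    (hG : ¬ DiscreteTopology G) (a : WeightedUnitization μ p ω) :
    ‖a.2‖ ≤ ‖H.unitAction a‖ := by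
  rw [unitAction_apply]
  exact norm_le_norm_convOp_add_smul hG (H.integrable a.1) (Lp.memLp _) a.2

theorem unitAction_injective [T2Space G] (H : HasWeightedConvBounds μ p ω θ C₁ C₂)
    (hG : ¬ DiscreteTopology G) : Function.Injective H.unitAction := by
  rw [injective_iff_map_eq_zero]
  intro a ha
  have h2 : a.2 = 0 := by
    have := H.norm_snd_le hG a
    rw [ha, norm_zero] at this
    exact norm_le_zero_iff.1 this
  rw [unitAction_apply, h2, zero_smul, add_zero] at ha
  exact Prod.ext (H.convLin_injective ha) h2

/-- The constant is larger than necessary so that the same one, which is at least 1, also bounds the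
product, as `exists_ball_inverse` requires. -/
theorem norm_unitAction_le (H : HasWeightedConvBounds μ p ω θ C₁ C₂)
    (a : WeightedUnitization μ p ω) :
    ‖H.unitAction a‖ ≤ (C₁ + 2 * C₂ + 1) * weightedUnitizationNorm a := by
  have h1 := H.nonneg₁
  have h2 := H.nonneg₂
  have h3 := weightedInterNorm_nonneg a.1
  have h4 := norm_nonneg a.2
  have h5 := H.norm_convLin_le a.1
  have h6 := norm_weightMul_le a.1
  have h7 : ‖a.2 • (1 : Lp ℂ 2 μ →L[ℂ] Lp ℂ 2 μ)‖ ≤ ‖a.2‖ := by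
    rw [norm_smul]
    exact mul_le_of_le_one_right (norm_nonneg _) ContinuousLinearMap.norm_id_le
  rw [unitAction_apply]
  calc ‖H.convLin a.1 + a.2 • (1 : Lp ℂ 2 μ →L[ℂ] Lp ℂ 2 μ)‖
      ≤ C₁ * weightedInterNorm a.1 + 1 * ‖a.2‖ := by
        rw [one_mul]
        refine (norm_add_le _ _).trans (add_le_add (h5.trans ?_) h7)
        gcongr
    _ ≤ (C₁ + 2 * C₂ + 1) * weightedInterNorm a.1 + (C₁ + 2 * C₂ + 1) * ‖a.2‖ := by
        gcongr <;> linarith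
    _ = _ := by rw [weightedUnitizationNorm, mul_add]

theorem weightedUnitizationNorm_unitMul_le
    (H : HasWeightedConvBounds μ p ω θ C₁ C₂) (a b : WeightedUnitization μ p ω) :
    weightedUnitizationNorm (H.unitMul a b) ≤
      (C₁ + 2 * C₂ + 1) * weightedUnitizationNorm a * weightedUnitizationNorm b := by
  have h1 := H.nonneg₁
  have h2 := H.nonneg₂
  have h3 := weightedInterNorm_nonneg a.1
  have h4 := weightedInterNorm_nonneg b.1
  have h5 := norm_nonneg a.2
  have h6 := norm_nonneg b.2
  have h7 := weightedInterNorm_add_le (H.conv a.1 b.1 + b.2 • a.1) (a.2 • b.1)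
  have h8 := weightedInterNorm_add_le (H.conv a.1 b.1) (b.2 • a.1)
  have h9 := H.weightedInterNorm_conv_le a.1 b.1
  rw [weightedInterNorm_smul] at h7 h8
  simp only [weightedUnitizationNorm, unitMul, norm_mul]
  calc _ ≤ (C₁ + 2 * C₂) * (weightedInterNorm a.1 * weightedInterNorm b.1) +
        (‖b.2‖ * weightedInterNorm a.1 + ‖a.2‖ * weightedInterNorm b.1 + ‖a.2‖ * ‖b.2‖) := by
        linarith
    _ ≤ (C₁ + 2 * C₂) * ((weightedInterNorm a.1 + ‖a.2‖) * (weightedInterNorm b.1 + ‖b.2‖)) +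
        (weightedInterNorm a.1 + ‖a.2‖) * (weightedInterNorm b.1 + ‖b.2‖) := by
        gcongr
        · linarith
        · linarith
        · nlinarith [mul_nonneg h3 h4]
    _ = _ := by ring

/-- The involution on `L^p(G, ω) ∩ L²(G)`. -/
noncomputable def star (H : HasWeightedConvBounds μ p ω θ C₁ C₂) (f : weightedInter μ p ω) :
    weightedInter μ p ω :=
  ⟨(Lp.memLp (f : Lp ℂ 2 μ)).convStar.toLp _, by
    refine (memLp_congr_ae ?_).2 (memLp_weightedInter f).convStar
    filter_upwards [(Lp.memLp (f : Lp ℂ 2 μ)).convStar.coeFn_toLp] with x hx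
    rw [hx]
    simp [convStar, H.map_inv]⟩

theorem coeFn_star (H : HasWeightedConvBounds μ p ω θ C₁ C₂) (f : weightedInter μ p ω) :
    (H.star f : Lp ℂ 2 μ) =ᵐ[μ] convStar (f : Lp ℂ 2 μ) :=
  (Lp.memLp (f : Lp ℂ 2 μ)).convStar.coeFn_toLp

theorem eLpNorm_convStar {f : G → ℂ} (hf : AEStronglyMeasurable f μ) (p : ℝ≥0∞) :
    eLpNorm (convStar f) p μ = eLpNorm f p μ := by
  rw [← eLpNorm_comp_inv hf p]
  exact eLpNorm_congr_norm_ae (Eventually.of_forall fun x => by simp [convStar])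

theorem weightedInterNorm_star (H : HasWeightedConvBounds μ p ω θ C₁ C₂)
    (f : weightedInter μ p ω) : weightedInterNorm (H.star f) = weightedInterNorm f := by
  have h1 : eLpNorm (fun x => (ω x : ℂ) * (H.star f : Lp ℂ 2 μ) x) p μ =
      eLpNorm (fun x => (ω x : ℂ) * (f : Lp ℂ 2 μ) x) p μ := by
    rw [← eLpNorm_convStar (memLp_weightedInter f).1]
    refine eLpNorm_congr_ae ?_
    filter_upwards [H.coeFn_star f] with x hx
    rw [hx]
    simp [convStar, H.map_inv]
  have h2 : ‖(H.star f : Lp ℂ 2 μ)‖ = ‖(f : Lp ℂ 2 μ)‖ := by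
    rw [Lp.norm_def, Lp.norm_def, eLpNorm_congr_ae (H.coeFn_star f),
      eLpNorm_convStar (Lp.aestronglyMeasurable _)]
  rw [weightedInterNorm, weightedInterNorm, h1, h2]

theorem adjoint_unitAction (H : HasWeightedConvBounds μ p ω θ C₁ C₂)
    (a : WeightedUnitization μ p ω) :
    ContinuousLinearMap.adjoint (H.unitAction a) =
      H.unitAction (H.star a.1, starRingEnd ℂ a.2) := by
  have h : H.convLin (H.star a.1) = ContinuousLinearMap.adjoint (H.convLin a.1) := by
    rw [convLin_apply, convLin_apply, adjoint_convOp]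
    exact convOp_congr _ _ (H.coeFn_star a.1)
  rw [unitAction_apply, unitAction_apply, h, map_add, LinearIsometryEquiv.map_smulₛₗ]
  congr 2
  exact star_one (Lp ℂ 2 μ →L[ℂ] Lp ℂ 2 μ)

theorem hasSum_convLin (H : HasWeightedConvBounds μ p ω θ C₁ C₂)
    {f : ℕ → weightedInter μ p ω} {F : weightedInter μ p ω}
    (h : HasSum (fun n => weightMul μ p ω (f n)) (weightMul μ p ω F)) :
    HasSum (fun n => H.convLin (f n)) (H.convLin F) := by
  rw [HasSum, tendsto_iff_norm_sub_tendsto_zero] at h ⊢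
  have h2 := h.const_mul C₁
  rw [mul_zero] at h2
  refine squeeze_zero (fun _ => norm_nonneg _) (fun s => ?_) h2
  rw [← map_sum, ← map_sum, ← map_sub, ← map_sub]
  exact H.norm_convLin_le _

/-- By completeness the series also converges in the unitization. The weighted norm dominates the
operator norm, so the action of its sum is S by uniqueness of limits. -/
theorem exists_unitAction_eq_of_hasSum (H : HasWeightedConvBounds μ p ω θ C₁ C₂)
    {a : ℕ → WeightedUnitization μ p ω} {r : ℕ → ℝ} (hr : Summable r)
    (har : ∀ n, weightedUnitizationNorm (a n) ≤ r n) {S : Lp ℂ 2 μ →L[ℂ] Lp ℂ 2 μ}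
    (hS : HasSum (fun n => H.unitAction (a n)) S) :
    ∃ b, H.unitAction b = S ∧ weightedUnitizationNorm b ≤ ∑' n, r n := by
  have hN : Summable fun n => weightedUnitizationNorm (a n) :=
    Summable.of_nonneg_of_le (fun n => weightedUnitizationNorm_nonneg _) har hr
  have h1 : Summable fun n => weightedInterNorm (a n).1 :=
    Summable.of_nonneg_of_le (fun n => weightedInterNorm_nonneg _)
      (fun n => le_add_of_nonneg_right (norm_nonneg _)) hN
  have h2 : Summable fun n => ‖(a n).2‖ :=
    Summable.of_nonneg_of_le (fun n => norm_nonneg _)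
      (fun n => le_add_of_nonneg_left (weightedInterNorm_nonneg _)) hN
  obtain ⟨F, hF, hFle⟩ := exists_hasSum_weightMul h1
  refine ⟨(F, ∑' n, (a n).2), ?_, ?_⟩
  · refine HasSum.unique ?_ hS
    simp only [unitAction_apply]
    exact (H.hasSum_convLin hF).add (h2.of_norm.hasSum.smul_const _)
  · calc weightedInterNorm F + ‖∑' n, (a n).2‖
        ≤ ∑' n, weightedInterNorm (a n).1 + ∑' n, ‖(a n).2‖ :=
          add_le_add hFle (norm_tsum_le_tsum_norm h2)
      _ = ∑' n, weightedUnitizationNorm (a n) := (h1.tsum_add h2).symm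
      _ ≤ ∑' n, r n := hN.tsum_le_tsum har hr

/-- Large powers of strict contractions in the unitization are small in its norm. -/
theorem exists_pow_small [T2Space G] (H : HasWeightedConvBounds μ p ω θ C₁ C₂)
    (hG : ¬ DiscreteTopology G) {R ρ ε : ℝ} (hρ0 : 0 < ρ) (hρ1 : ρ < 1) (hε : 0 < ε) :
    ∃ k : ℕ, ∀ a : WeightedUnitization μ p ω, weightedUnitizationNorm a ≤ R →
      ‖H.unitAction a‖ ≤ ρ →
      ∃ b, H.unitAction b = H.unitAction a ^ 2 ^ k ∧ weightedUnitizationNorm b ≤ ε := by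
  -- For f = g the two terms of the differential inequality coincide, hence 2C₂. Division by ρ makes
  -- the bound on Y at k = 0 equal to max R 0.
  obtain ⟨k, hk⟩ := exists_dyadic_small (C := 2 * C₂) (R := max R 0) (R' := max R 0 / ρ)
    (mul_nonneg zero_le_two H.nonneg₂) (le_max_right _ _)
    (div_nonneg (le_max_right _ _) hρ0.le) hρ0 hρ1 H.pos H.lt_one hε
  refine ⟨k, fun a ha haρ => ?_⟩
  let z : ℕ → WeightedUnitization μ p ω := fun n => Nat.rec a (fun _ b => H.unitMul b b) n
  have hz : ∀ n, z (n + 1) = H.unitMul (z n) (z n) := fun n => rfl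
  have hact : ∀ n, H.unitAction (z n) = H.unitAction a ^ 2 ^ n := by
    intro n
    induction n with
    | zero =>
      rw [pow_zero, pow_one]
      rfl
    | succ n ih => rw [hz, unitAction_unitMul, ih, ← pow_add, pow_succ, mul_two]
  have hactn : ∀ n, ‖H.unitAction (z n)‖ ≤ ρ ^ 2 ^ n := by
    intro n
    rw [hact]
    refine (norm_pow_le' _ (by positivity)).trans ?_
    gcongr
  have hsnd : ∀ n, ‖(z n).2‖ ≤ ρ ^ 2 ^ n := fun n => (H.norm_snd_le hG _).trans (hactn n)
  have hfst : ∀ n, (z (n + 1)).1 = H.conv (z n).1 (z n).1 + (z n).2 • (z n).1 +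
      (z n).2 • (z n).1 := fun n => rfl
  have ha1 : weightedInterNorm a.1 ≤ max R 0 := by
    refine le_trans ?_ (ha.trans (le_max_left _ _))
    exact le_add_of_nonneg_right (norm_nonneg _)
  -- If z = (f, t), the first component of z² is Φ(z)f + tf. Both ‖Φ(z)‖ and |t| are at most ρ^(2^n)
  -- at stage n, so each squaring contributes this factor and a factor 2.
  have hY : ∀ n, ‖(z n).1‖ ≤ 2 ^ n * ρ ^ 2 ^ n * (max R 0 / ρ) := by
    intro n
    induction n with
    | zero =>
      have h1 : (2 : ℝ) ^ 0 * ρ ^ 2 ^ 0 * (max R 0 / ρ) = max R 0 := by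
        rw [pow_zero, one_mul, pow_zero, pow_one]
        field_simp
      rw [h1]
      exact (norm_le_weightedInterNorm _).trans ha1
    | succ n ih =>
      have h1 : (((z (n + 1)).1 : weightedInter μ p ω) : Lp ℂ 2 μ) =
          H.unitAction (z n) ((z n).1 : Lp ℂ 2 μ) + (z n).2 • ((z n).1 : Lp ℂ 2 μ) := by
        rw [hfst, unitAction_apply]
        rfl
      rw [Submodule.coe_norm] at ih ⊢
      rw [h1]
      calc _ ≤ ‖H.unitAction (z n)‖ * ‖((z n).1 : Lp ℂ 2 μ)‖ +
            ‖(z n).2‖ * ‖((z n).1 : Lp ℂ 2 μ)‖ := by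
            refine (norm_add_le _ _).trans (add_le_add (ContinuousLinearMap.le_opNorm _ _) ?_)
            rw [norm_smul]
        _ ≤ ρ ^ 2 ^ n * (2 ^ n * ρ ^ 2 ^ n * (max R 0 / ρ)) +
            ρ ^ 2 ^ n * (2 ^ n * ρ ^ 2 ^ n * (max R 0 / ρ)) := by
            have := hactn n
            have := hsnd n
            gcongr
        _ = _ := by
            rw [pow_succ 2 n, pow_succ 2 n, pow_mul]
            ring
  refine ⟨z k, hact k, le_trans ?_ (hk (fun n => ‖weightMul μ p ω (z n).1‖)
    (fun n => ‖(z n).1‖) (fun n => norm_nonneg _) (fun n => norm_nonneg _)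
    ((norm_weightMul_le _).trans ha1) hY fun n => ?_)⟩
  · rw [weightedUnitizationNorm, weightedInterNorm_eq]
    exact add_le_add (max_le_add_of_nonneg (norm_nonneg _) (norm_nonneg _)) (hsnd k)
  · rw [hfst, map_add, map_add, map_smul]
    have h1 := H.norm_weightMul_conv_le (z n).1 (z n).1
    have h2 : ‖(z n).2 • weightMul μ p ω (z n).1‖ ≤ ρ ^ 2 ^ n * ‖weightMul μ p ω (z n).1‖ := by
      rw [norm_smul]
      have := hsnd n
      gcongr
    have h3 := norm_add₃_le (a := weightMul μ p ω (H.conv (z n).1 (z n).1))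
      (b := (z n).2 • weightMul μ p ω (z n).1) (c := (z n).2 • weightMul μ p ω (z n).1)
    linarith

/-- Here the ball of radius R consists of the operators Φ(a) with ‖a‖ ≤ R. The constant depends on α
and τ only, so this yields inverse-closedness and norm control at once. -/
theorem exists_inverse_bound [T2Space G]
    (H : HasWeightedConvBounds μ p ω θ C₁ C₂) (hG : ¬ DiscreteTopology G) (α τ : ℝ) :
    ∃ C, ∀ (a : WeightedUnitization μ p ω) (T : Lp ℂ 2 μ →L[ℂ] Lp ℂ 2 μ),
      weightedUnitizationNorm a ≤ α → ‖T‖ ≤ τ → H.unitAction a * T = 1 → T * H.unitAction a = 1 →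
      ∃ b, H.unitAction b = T ∧ weightedUnitizationNorm b ≤ C := by
  have h1 := H.nonneg₁
  have h2 := H.nonneg₂
  have hK : 1 ≤ C₁ + 2 * C₂ + 1 := by linarith
  obtain ⟨C, hC⟩ := exists_ball_inverse (K := C₁ + 2 * C₂ + 1)
    (P := fun R T => ∃ a, H.unitAction a = T ∧ weightedUnitizationNorm a ≤ R) hK
    (fun R R' S T ⟨a, ha, haR⟩ ⟨b, hb, hbR⟩ => ⟨a + b, by rw [map_add, ha, hb],
      (weightedUnitizationNorm_add_le a b).trans (add_le_add haR hbR)⟩)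
    (fun R T c ⟨a, ha, haR⟩ => ⟨c • a, by rw [map_smul, ha], by
      rw [weightedUnitizationNorm_smul]
      gcongr⟩)
    (fun R R' S T ⟨a, ha, haR⟩ ⟨b, hb, hbR⟩ => ⟨H.unitMul a b, by
      rw [unitAction_unitMul, ha, hb], by
      have hb0 := weightedUnitizationNorm_nonneg b
      have ha0 := (weightedUnitizationNorm_nonneg a).trans haR
      refine (H.weightedUnitizationNorm_unitMul_le a b).trans ?_
      gcongr⟩)
    ⟨(0, 1), H.unitAction_one, weightedUnitizationNorm_one.le⟩
    (fun R T ⟨a, ha, haR⟩ => ⟨(H.star a.1, starRingEnd ℂ a.2), by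
      rw [← adjoint_unitAction, ha], by
      rw [weightedUnitizationNorm, weightedInterNorm_star, RCLike.norm_conj]
      exact haR⟩)
    (fun R T ⟨a, ha, haR⟩ => by
      rw [← ha]
      refine (H.norm_unitAction_le a).trans ?_
      gcongr)
    (fun r T S hr hT hS => by
      choose a ha har using hT
      refine H.exists_unitAction_eq_of_hasSum hr har ?_
      simpa only [ha] using hS)
    (fun R ρ ε hρ0 hρ1 hε => by
      obtain ⟨k, hk⟩ := H.exists_pow_small hG (R := R) hρ0 hρ1 hε
      refine ⟨k, ?_⟩
      rintro T ⟨a, rfl, haR⟩ hT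
      exact hk a haR hT)
    α τ
  exact ⟨C, fun a T ha hT haT hTa => hC (H.unitAction a) T ⟨a, rfl, ha⟩ hT haT hTa⟩

theorem inverseClosedVia [T2Space G]
    (H : HasWeightedConvBounds μ p ω θ C₁ C₂) (hG : ¬ DiscreteTopology G) :
    InverseClosedVia H.unitAction := by
  intro a T haT hTa
  obtain ⟨C, hC⟩ := H.exists_inverse_bound hG (weightedUnitizationNorm a) ‖T‖
  obtain ⟨b, hb, -⟩ := hC a T le_rfl le_rfl haT hTa
  exact ⟨b, hb⟩

theorem normControlledInversionVia [T2Space G]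
    (H : HasWeightedConvBounds μ p ω θ C₁ C₂) (hG : ¬ DiscreteTopology G) :
    NormControlledInversionVia weightedUnitizationNorm H.unitAction := by
  choose h hh using H.exists_inverse_bound hG
  refine ⟨h, fun a b hab hba => ?_⟩
  obtain ⟨b', hb', hle⟩ := hh _ _ a (H.unitAction b) le_rfl le_rfl hab hba
  rwa [H.unitAction_injective hG hb'] at hle

end HasWeightedConvBounds
end WeightedUnitization

/-! ### From the hypotheses on the weight to the convolution bounds -/

section Weights

/-- For φ = u^s ω^r this makes G σ-finite, which is not assumed but is needed for Fubini. -/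
theorem sigmaFinite_of_integrable_pos {X : Type*} [MeasurableSpace X] {μ : Measure X} {φ : X → ℝ}
    (hφ : Integrable φ μ) (hpos : ∀ x, 0 < φ x) : SigmaFinite μ := by
  refine ⟨⟨⟨fun n => {x | 1 / ((n : ℝ) + 1) ≤ ‖φ x‖}, fun _ => trivial,
    fun n => hφ.measure_norm_ge_lt_top (by positivity), ?_⟩⟩⟩
  refine Set.eq_univ_of_forall fun x => ?_
  obtain ⟨n, hn⟩ := exists_nat_one_div_lt (hpos x)
  exact Set.mem_iUnion.2 ⟨n, hn.le.trans (le_abs_self _)⟩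

/-- Conjugate exponents, in terms of real numbers. -/
theorem conjugate_exponent_facts {p q : ℝ≥0∞} (hp1 : 1 ≤ p) (hp : p ≠ ∞) (hpq : p⁻¹ + q⁻¹ = 1)
    {s : ℝ} (hs : ENNReal.ofReal s < q) :
    1 ≤ p.toReal ∧ q ≠ 0 ∧ (q ≠ ∞ → max s 1 ≤ q.toReal) ∧ max s 1 * (1 - 1 / p.toReal) < 1 := by
  have hP : 1 ≤ p.toReal := by
    rw [← ENNReal.toReal_one]
    exact ENNReal.toReal_mono hp hp1
  have hq0 : q ≠ 0 := (bot_le.trans_lt hs).ne'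
  have hsum : p.toReal⁻¹ + q.toReal⁻¹ = 1 := by
    rw [← ENNReal.toReal_inv, ← ENNReal.toReal_inv, ← ENNReal.toReal_add
      (ENNReal.inv_ne_top.2 (one_pos.trans_le hp1).ne') (ENNReal.inv_ne_top.2 hq0), hpq,
      ENNReal.toReal_one]
  have hPpos : 0 < p.toReal⁻¹ := inv_pos.2 (one_pos.trans_le hP)
  have hκ : 1 - 1 / p.toReal = q.toReal⁻¹ := by
    rw [one_div]
    linarith
  refine ⟨hP, hq0, ?_⟩
  rw [hκ]
  by_cases hq : q = ∞
  · simp [hq]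
  · have hQ : 0 < q.toReal := ENNReal.toReal_pos hq0 hq
    have h1 : 1 < q.toReal := (inv_lt_one₀ hQ).1 (by linarith)
    have h2 : s < q.toReal := by
      by_contra! h
      have := ENNReal.ofReal_le_ofReal h
      rw [ENNReal.ofReal_toReal hq] at this
      exact absurd hs this.not_gt
    exact ⟨fun _ => (max_lt h2 h1).le, (mul_inv_lt_iff₀ hQ).2 (by rw [one_mul]; exact max_lt h2 h1)⟩

theorem lintegral_rpow_mul_rpow_ne_top {X : Type*} [MeasurableSpace X] {μ : Measure X}
    {u ω : X → ℝ} (hu : ∀ x, 0 < u x) {B : ℝ} (huB : ∀ x, u x ≤ B) (hω : ∀ x, 0 ≤ ω x)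
    {s t r : ℝ} (hst : s ≤ t) (hint : Integrable (fun x => u x ^ s * ω x ^ r) μ) :
    ∫⁻ x, ENNReal.ofReal (u x ^ t * ω x ^ r) ∂μ ≠ ∞ := by
  refine ((lintegral_mono fun x => ENNReal.ofReal_le_ofReal ?_).trans_lt
    (hint.const_mul (B ^ (t - s))).lintegral_lt_top).ne
  rw [← mul_assoc]
  have := hω x
  gcongr
  exact rpow_le_const_mul_rpow (hu x) (huB x) hst

variable {G : Type*} [Group G] [TopologicalSpace G] [IsTopologicalGroup G]
    [LocallyCompactSpace G] [MeasurableSpace G] [BorelSpace G]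
    {μ : Measure G} [μ.IsHaarMeasure] [μ.Regular] [SigmaFinite μ] [μ.IsInvInvariant]

theorem IsInterpolationWeight.exists_hasWeightedConvBounds {p q : ℝ≥0∞} (hp1 : 1 ≤ p)
    (hp : p ≠ ∞) (hpq : p⁻¹ + q⁻¹ = 1) {ω : G → ℝ} {θ : ℝ} {h : G → ℝ≥0∞}
    (H : IsInterpolationWeight μ ω p.toReal θ h) (hω : IsGroupWeight ω) (hω1 : ∀ x, 1 ≤ ω x)
    (hωq : MemLp (fun x => (((ω x)⁻¹ : ℝ) : ℂ)) q μ) :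
    ∃ C₁ C₂, HasWeightedConvBounds μ p ω θ C₁ C₂ := by
  obtain ⟨C, hC, hle⟩ := H.exists_weightedENorm_groupConv_le hω.measurable hω1 hp1 hp
  refine ⟨(eLpNorm (fun x => (((ω x)⁻¹ : ℝ) : ℂ)) q μ).toReal, C.toReal, hω.measurable,
    hω.map_inv, H.pos, H.lt_one, ENNReal.toReal_nonneg, ENNReal.toReal_nonneg, ?_, ?_⟩
  · intro f hf
    rw [ENNReal.ofReal_toReal hωq.eLpNorm_ne_top]
    exact eLpNorm_one_le_weightedENorm hω.measurable hω1 hpq hf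
  · intro f g hf hg
    rw [ENNReal.ofReal_toReal hC]
    exact hle f g hf hg

end Weights

theorem theorem5p10 {G : Type*} [Group G] [TopologicalSpace G] [IsTopologicalGroup G]
    [LocallyCompactSpace G] [T2Space G] [MeasurableSpace G] [BorelSpace G]
    (hG : ¬ DiscreteTopology G)
    (μ : Measure G) [μ.IsHaarMeasure] [μ.Regular]
    (p q : ℝ≥0∞) (hp1 : 1 ≤ p) (hp : p ≠ ∞) (hpq : p⁻¹ + q⁻¹ = 1)
    (ω : G → ℝ) (hω : IsGroupWeight ω) (hω1 : ∀ x, 1 ≤ ω x)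
    (u : G → ℝ) (hu_meas : Measurable u) (hu_nonneg : ∀ x, 0 ≤ u x)
    (hu_bdd : ∃ M : ℝ, ∀ x, u x ≤ M)
    (hσ : ∃ δ : ℝ, 0 < δ ∧ ∀ x, δ ≤ ω x * u x)
    (hωu : ∀ x y, ω (x * y) / (ω x * ω y) ≤ u x + u y)
    (s r : ℝ) (hs : ENNReal.ofReal s < q) (hr : 0 < r)
    (hint : Integrable (fun x => u x ^ s * ω x ^ r) μ) :
    ∃ Φ : WeightedUnitization μ p ω →ₗ[ℂ] (Lp ℂ 2 μ →L[ℂ] Lp ℂ 2 μ),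
      -- `Φ (f, t)` is the operator `g ↦ f ∗ g + t g`
      (∀ a : WeightedUnitization μ p ω, IsUnitizationAction a (Φ a)) ∧
      -- the unitization is an algebra with continuous product, and `Φ` is a continuous
      -- injective unital homomorphism
      (∀ a b : WeightedUnitization μ p ω, ∃ c, IsUnitizationProduct a b c ∧ Φ c = Φ a * Φ b) ∧
      (∃ K : ℝ, ∀ a b c : WeightedUnitization μ p ω, IsUnitizationProduct a b c →
        weightedUnitizationNorm c ≤ K * weightedUnitizationNorm a * weightedUnitizationNorm b) ∧
      Φ (0, 1) = 1 ∧
      Function.Injective Φ ∧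
      (∃ K : ℝ, ∀ a : WeightedUnitization μ p ω, ‖Φ a‖ ≤ K * weightedUnitizationNorm a) ∧
      InverseClosedVia Φ ∧
      NormControlledInversionVia weightedUnitizationNorm Φ := by
  obtain ⟨B, huB⟩ := hu_bdd
  obtain ⟨δ, hδ, hσ⟩ := hσ
  have hω0 : ∀ x, 0 < ω x := fun x => one_pos.trans_le (hω1 x)
  have hu0 : ∀ x, 0 < u x := fun x => (hu_nonneg x).lt_of_ne fun h => by
    have := hσ x
    rw [← h, mul_zero] at this
    exact hδ.not_ge this
  have hωu' : ∀ x y, ω (x * y) ≤ ω x * ω y * (u x + u y) := fun x y => by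
    rw [mul_comm]
    exact (div_le_iff₀ (mul_pos (hω0 x) (hω0 y))).1 (hωu x y)
  have : SigmaFinite μ := sigmaFinite_of_integrable_pos hint fun x =>
    mul_pos (Real.rpow_pos_of_pos (hu0 x) _) (Real.rpow_pos_of_pos (hω0 x) _)
  obtain ⟨hP, hq0, hsq, hsP⟩ := conjugate_exponent_facts hp1 hp hpq hs
  -- The exponent s may be small or negative. It is raised to max s 1, since unimodularity needs a
  -- positive exponent and the averaging for p = 1 an exponent at least 1; the new exponent is still
  -- at most q.
  have hint' := lintegral_rpow_mul_rpow_ne_top hu0 huB (fun x => (hω0 x).le)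
    (le_max_left s 1) hint
  have hint1 : ∫⁻ x, ENNReal.ofReal (u x ^ max s 1) ∂μ ≠ ∞ := by
    refine ((lintegral_mono fun x => ENNReal.ofReal_le_ofReal ?_).trans_lt hint'.lt_top).ne
    exact le_mul_of_one_le_right (Real.rpow_nonneg (hu0 x).le _) (Real.one_le_rpow (hω1 x) hr.le)
  have : μ.IsMulRightInvariant := isMulRightInvariant_of_weight μ hω.measurable hω1
    hω.map_mul_le hu_meas hωu' (one_pos.trans_le (le_max_right s 1)) hint1
  have : μ.IsInvInvariant := isInvInvariant_of_isMulRightInvariant μ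
  obtain ⟨θ, h, H⟩ : ∃ θ h, IsInterpolationWeight μ ω p.toReal θ h := by
    rcases hP.eq_or_lt with hP1 | hP1
    · rw [← hP1]
      exact exists_isInterpolationWeight_one hω hω1 hu_meas hu_nonneg hωu' (le_max_right s 1) hr
        hint'
    · exact exists_isInterpolationWeight_of_one_lt hω1 hu_meas hu0 huB hωu' hP1 hsP hr hint'
  obtain ⟨C₁, C₂, H⟩ := H.exists_hasWeightedConvBounds hp1 hp hpq hω hω1
    (memLp_inv_weight hω.measurable hω1 hu0 huB hδ hσ hq0 hsq hr hint')
  have : Fact (1 ≤ p) := ⟨hp1⟩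
  refine ⟨H.unitAction, H.isUnitizationAction_unitAction,
    fun a b => ⟨H.unitMul a b, H.isUnitizationProduct_unitMul a b, H.unitAction_unitMul a b⟩,
    ⟨C₁ + 2 * C₂ + 1, fun a b c habc => ?_⟩, H.unitAction_one, H.unitAction_injective hG,
    ⟨C₁ + 2 * C₂ + 1, H.norm_unitAction_le⟩, H.inverseClosedVia hG,
    H.normControlledInversionVia hG⟩
  rw [H.eq_unitMul_of_isUnitizationProduct habc]
  exact H.weightedUnitizationNorm_unitMul_le a b
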